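/- Identify the circle with $\mathbb R/2\pi\mathbb Z$, the two-torus with $\mathbb T^2=(\mathbb R/2\pi\mathbb Z)^2$, and circle maps with their lifts to $\mathbb R$. **The map.** Let $0<\delta<\pi$, $s_0>0$, $\eta>0$, and let $f_2$ be a $C^1$ circle map of degree two, odd, with $f_2'>0$, whose fixed points are exactly $0,\delta,-\delta$, with $f_2'(0)<1$, $f_2(-\pi+\delta/3)=\delta$ (mod $2\pi$), and $f_2'(t)>2$ for $\delta<|t|\le\pi$. Then there is $\varepsilon_0>0$ (depending on $\delta,s_0,\eta,f_2$) such that for every $0<\varepsilon<\varepsilon_0$ there is $\lambda_0>0$ such that the conclusions below hold for every $0<\lambda<\lambda_0$ and all $f_1,\varphi$ with the following properties. - $f_1$ is an odd orientation preserving $C^1$ circle diffeomorphism of degree one with $f_1'>0$, $f_1(s)=\lambda s$ for $|s|\le s_0$, $f_1(s)<s$ for $0<s<\pi$, $f_1(s)\le s-\eta$ for $s_0\le s\le \pi-s_0$, and $f_1'(\pi)>1$. - $\varphi$ is a $C^1$, $2\pi$-periodic function with $0\le\varphi\le\varepsilon$, $\varphi(s)=\varepsilon$ for $|s|<s_0$,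 $\varphi(s)=0$ for $|s-\pi|<s_0$, $|\varphi'|<\varepsilon$, and $|\varphi'(s)|<|f_1'(s)|$ for all $s$. Let $f:\mathbb T^2\to\mathbb T^2$ be Przytycki's map $f(s,t)=(f_1(s)+\sin(t)\,\varphi(s),\,f_2(t))$, let $\Omega$ be its nonwandering set, and let $K_1=\Omega(f_2)\setminus\{0\}$. **Definitions.** A *basic piece* is a nonempty compact transitive set $\Lambda\subset\Omega$ with $f(\Lambda)=\Lambda$, relatively open in $\Omega$. It is *expanding* if $|Df^n v|\ge c\mu^n|v|$ on $T_\Lambda\mathbb T^2$ for all $n\ge0$ and some $c>0$, $\mu>1$; it is *attracting* if it has an open neighbourhood $N$ with $\overline{f(N)}\subset N$ and $\bigcap_n f^n(N)=\Lambda$. A compact set $\Lambda=f(\Lambda)$ has a *hyperbolic structure* if there are uniform constants such that every full orbit $(x_n)_{n\in\mathbb Z}$ in $\Lambda$ has a $Df$-invariant splitting $T_{x_n}\mathbb T^2=E^s_n\oplus E^u_n$, uniformly exponentially contracted, respectively expanded, by $Df$; it is of *saddle type* if both summands are nonzero along all its orbits. *Axiom A* means: $\Omega$ has a hyperbolic structure,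 periodic points are dense in $\Omega$, and $f$ is expanding or injective on each basic piece. Let $\Gamma$ be $\Omega$ minus the attracting and the expanding basic pieces. For $x\in\Omega$ let $W^s_r(x)=\{y: d(f^nx,f^ny)<r\ \forall n\ge0\}$, and for a preorbit $(x_n)_{n\ge 0}$ in $\Gamma$ let $W^u_r$ at $x_k$ be the set of points $y$ having a preorbit $(y_n)$ with $d(x_{k+n},y_n)<r$ for all $n\ge0$. If $(z_n)$ is a preorbit of $z=z_0$ with $d(x_n,z_n)\to0$ for some preorbit $(x_n)$ contained in $\Gamma$, put $E^u(\{z_n\})=Df^k_{z_k}(T_{z_k}W^u_r(x_k))$ ($r$ small, $k$ large); let $\alpha_z$ be the family of these subspaces of $T_z\mathbb T^2$, indexed by all such preorbits of $z$. If $d(f^nx,f^nz)\to0$ with $x\in\Omega$, put $E^s(z)=(Df^k_z)^{-1}(T_{f^kz}W^s_r(f^kx))$ ($r$ small, $k$ large), the tangent space at $z$ of the stable set of $x$. The *Strong Transversality Condition* means: for every $z$ the subspaces in $\alpha_z$ are well defined and $\alpha_z$ is in general position (the sum of the codimensions of its members is the codimension of their intersection), and whenever $\alpha_z$ is nonempty,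 $E^s(z)$ is well defined and $E^s(z)+\bigcap\alpha_z=T_z\mathbb T^2$. **Conclusion.** 1. $f$ is a covering map, every point has exactly two preimages, and $f$ has no critical points. 2. $f$ satisfies Axiom A, and $\Omega$ is the disjoint union of four basic pieces: the attracting fixed point $\{(0,0)\}$; the fixed point $\{(\pi,0)\}$ of saddle type; the expanding set $K=\{\pi\}\times K_1$, which is homeomorphic to the Cantor set; and a set $\Gamma_0$ of saddle type, on which $f$ is injective, and which is close to $\{0\}\times K_1$ in the sense that $t\in K_1$ and $|s|\le2\varepsilon$ for all $(s,t)\in\Gamma_0$. 3. $f$ satisfies the Strong Transversality Condition. In particular $f$ is neither invertible nor expanding. -/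

import Mathlib

open Set Filter Topology

noncomputable section

/-! ### Topological dynamics -/

/-- The nonwandering set: every neighbourhood `U` of `z` meets one of its forward images
`g^n(U)`, `n ≥ 1`. -/
def nonwanderingSet {X : Type*} [TopologicalSpace X] (g : X → X) : Set X :=
  {z | ∀ U ∈ 𝓝 z, ∃ n : ℕ, 1 ≤ n ∧ (g^[n] '' U ∩ U).Nonempty}

/-- `w 0, w 1, w 2, …` is a preorbit of `w 0`, that is, `g (w (n+1)) = w n`. -/
def IsPreorbit {X : Type*} (g : X → X) (w : ℕ → X) : Prop :=
  ∀ n, g (w (n + 1)) = w n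

/-- Topological transitivity of the restriction of `g` to the set `L`. -/
def IsTransitiveOn {X : Type*} [TopologicalSpace X] (g : X → X) (L : Set X) : Prop :=
  ∀ U V : Set X, IsOpen U → IsOpen V → (U ∩ L).Nonempty → (V ∩ L).Nonempty →
    ∃ n : ℕ, (g^[n] '' (U ∩ L) ∩ V).Nonempty

/-- A basic piece, i.e. an element of the spectral decomposition of the nonwandering set:
a nonempty compact invariant transitive set that is relatively open in the nonwandering set. -/
structure IsBasicPiece {X : Type*} [TopologicalSpace X] (g : X → X) (L : Set X) : Prop where
  nonempty : L.Nonempty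
  isCompact : IsCompact L
  image_eq : g '' L = L
  transitive : IsTransitiveOn g L
  subset : L ⊆ nonwanderingSet g
  isolated : ∃ U : Set X, IsOpen U ∧ U ∩ nonwanderingSet g = L

/-- An attracting set: `L` has an open neighbourhood `N` with `closure (g N) ⊆ N` and
`⋂ₙ g^n(N) = L`. -/
def IsAttractingSet {X : Type*} [TopologicalSpace X] (g : X → X) (L : Set X) : Prop :=
  ∃ N : Set X, IsOpen N ∧ L ⊆ N ∧ closure (g '' N) ⊆ N ∧ ⋂ n : ℕ, g^[n] '' N = L

/-! ### The circle and the two-torus -/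

/-- The circle `ℝ / 2πℤ`. -/
abbrev Circ : Type := AddCircle (2 * Real.pi)

/-- The two-torus. -/
abbrev T2 : Type := Circ × Circ

/-- The representative in `[-π, π)` of a point of the circle. -/
def circRep (a : Circ) : ℝ :=
  haveI : Fact (0 < 2 * Real.pi) := ⟨Real.two_pi_pos⟩
  (AddCircle.equivIco (2 * Real.pi) (-Real.pi) a : ℝ)

theorem coe_circRep (a : Circ) : ((circRep a : ℝ) : Circ) = a := by
  have : Fact (0 < 2 * Real.pi) := ⟨Real.two_pi_pos⟩
  exact AddCircle.coe_equivIco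

/-- Two real numbers with the same class differ by an integer multiple of `2π`. -/
theorem exists_int_of_coe_eq {x y : ℝ} (h : (x : Circ) = (y : Circ)) :
    ∃ n : ℤ, x = y + n * (2 * Real.pi) := by
  have h0 : ((x - y : ℝ) : Circ) = 0 := by
    rw [AddCircle.coe_sub, h, sub_self]
  obtain ⟨n, hn⟩ := (AddCircle.coe_eq_zero_iff (2 * Real.pi)).1 h0
  refine ⟨n, ?_⟩
  rw [zsmul_eq_mul] at hn
  linarith

theorem coe_add_int_mul (x : ℝ) (n : ℤ) : ((x + n * (2 * Real.pi) : ℝ) : Circ) = x := by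
  have h0 : ((n * (2 * Real.pi) : ℝ) : Circ) = 0 :=
    (AddCircle.coe_eq_zero_iff (2 * Real.pi)).2 ⟨n, by rw [zsmul_eq_mul]⟩
  rw [AddCircle.coe_add, h0, add_zero]

/-- The map of the circle induced by `g : ℝ → ℝ` (where `g` commutes with the projection to
the circle up to a degree, see `inducedCircleMap_coe`). -/
def inducedCircleMap (g : ℝ → ℝ) (a : Circ) : Circ := ((g (circRep a) : ℝ) : Circ)

/-- The universal covering `ℝ² → 𝕋²`. -/
def torusProj (x : ℝ × ℝ) : T2 := ((x.1 : Circ), (x.2 : Circ))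

/-- A representative in `[-π, π)²` of a point of the torus. -/
def torusRep (z : T2) : ℝ × ℝ := (circRep z.1, circRep z.2)

theorem torusProj_torusRep (z : T2) : torusProj (torusRep z) = z :=
  Prod.ext (coe_circRep z.1) (coe_circRep z.2)

/-- The element of the lattice `(2πℤ)²` with the given integer coordinates. -/
def latticeVec (k : ℤ × ℤ) : ℝ × ℝ := (k.1 * (2 * Real.pi), k.2 * (2 * Real.pi))

theorem torusProj_add_latticeVec (x : ℝ × ℝ) (k : ℤ × ℤ) :
    torusProj (x + latticeVec k) = torusProj x :=
  Prod.ext (coe_add_int_mul x.1 k.1) (coe_add_int_mul x.2 k.2)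

theorem exists_latticeVec_of_torusProj_eq {x y : ℝ × ℝ} (h : torusProj x = torusProj y) :
    ∃ k : ℤ × ℤ, x = y + latticeVec k := by
  obtain ⟨n, hn⟩ := exists_int_of_coe_eq (congrArg Prod.fst h)
  obtain ⟨m, hm⟩ := exists_int_of_coe_eq (congrArg Prod.snd h)
  exact ⟨(n, m), Prod.ext hn hm⟩

/-- A `C¹` map of the two-torus, given by a `C¹` lift to the universal covering `ℝ²`. -/
structure TorusEndo where
  /-- the lift to `ℝ²` -/
  lift : ℝ × ℝ → ℝ × ℝ
  contDiff : ContDiff ℝ 1 lift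
  equivariant : ∀ k : ℤ × ℤ, ∃ m : ℤ × ℤ, ∀ x, lift (x + latticeVec k) = lift x + latticeVec m

namespace TorusEndo

/-- The map of the torus defined by the lift. -/
def toFun (f : TorusEndo) (z : T2) : T2 := torusProj (f.lift (torusRep z))

instance : CoeFun TorusEndo (fun _ => T2 → T2) := ⟨toFun⟩

/-- The map of the torus is indeed covered by the lift. -/
theorem toFun_torusProj (f : TorusEndo) (x : ℝ × ℝ) :
    f (torusProj x) = torusProj (f.lift x) := by
  obtain ⟨k, hk⟩ := exists_latticeVec_of_torusProj_eq (torusProj_torusRep (torusProj x))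
  obtain ⟨m, hm⟩ := f.equivariant k
  change torusProj (f.lift (torusRep (torusProj x))) = _
  rw [hk, hm, torusProj_add_latticeVec]

theorem equivariant_iterate (f : TorusEndo) (n : ℕ) (k : ℤ × ℤ) :
    ∃ m : ℤ × ℤ, ∀ x, f.lift^[n] (x + latticeVec k) = f.lift^[n] x + latticeVec m := by
  induction n with
  | zero => exact ⟨k, fun x => rfl⟩
  | succ n ih =>
    obtain ⟨m, hm⟩ := ih
    obtain ⟨l, hl⟩ := f.equivariant m
    refine ⟨l, fun x => ?_⟩
    rw [Function.iterate_succ_apply', Function.iterate_succ_apply', hm, hl]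

/-- The differential `D(fⁿ)_z`, in the trivialization `T𝕋² = 𝕋² × ℝ²` of the tangent bundle. -/
def diff (f : TorusEndo) (n : ℕ) (z : T2) : ℝ × ℝ →L[ℝ] ℝ × ℝ :=
  fderiv ℝ (f.lift^[n]) (torusRep z)

/-- The differential may be computed at any representative. -/
theorem diff_torusProj (f : TorusEndo) (n : ℕ) (x : ℝ × ℝ) :
    f.diff n (torusProj x) = fderiv ℝ (f.lift^[n]) x := by
  obtain ⟨k, hk⟩ := exists_latticeVec_of_torusProj_eq (torusProj_torusRep (torusProj x))
  obtain ⟨m, hm⟩ := f.equivariant_iterate n k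
  change fderiv ℝ (f.lift^[n]) (torusRep (torusProj x)) = _
  rw [hk, ← fderiv_comp_add_right (𝕜 := ℝ) (latticeVec k)]
  have h : (fun y => f.lift^[n] (y + latticeVec k)) = fun y => f.lift^[n] y + latticeVec m :=
    funext hm
  rw [h, fderiv_add_const]

/-- `z` is a critical point of `f`: the differential of `f` at `z` is not invertible. -/
def IsCritical (f : TorusEndo) (z : T2) : Prop := ¬ Function.Bijective (f.diff 1 z)

/-! ### Hyperbolicity and Axiom A -/

/-- `x : ℤ → 𝕋²` is a full orbit of `f`. -/
def IsFullOrbit (f : TorusEndo) (x : ℤ → T2) : Prop := ∀ n, f (x n) = x (n + 1)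

/-- An invariant hyperbolic splitting along the full orbit `x`, with constants `C` and `μ`. -/
structure IsHyperbolicSplitting (f : TorusEndo) (x : ℤ → T2)
    (Es Eu : ℤ → Submodule ℝ (ℝ × ℝ)) (C μ : ℝ) : Prop where
  isCompl : ∀ n, IsCompl (Es n) (Eu n)
  map_stable : ∀ n, (Es n).map (f.diff 1 (x n)).toLinearMap ≤ Es (n + 1)
  map_unstable : ∀ n, (Eu n).map (f.diff 1 (x n)).toLinearMap = Eu (n + 1)
  contract : ∀ n, ∀ v ∈ Es n, ∀ k : ℕ, ‖f.diff k (x n) v‖ ≤ C * μ ^ k * ‖v‖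
  expand : ∀ n, ∀ v ∈ Eu n, ∀ k : ℕ, ‖v‖ ≤ C * μ ^ k * ‖f.diff k (x n) v‖

/-- Hyperbolic structure on a compact invariant set of a noninvertible map: uniformly
hyperbolic splittings along all full orbits contained in the set (the unstable space at a point
may depend on the orbit through it). -/
def IsHyperbolicSet (f : TorusEndo) (L : Set T2) : Prop :=
  IsCompact L ∧ f '' L = L ∧ ∃ C μ : ℝ, 0 < C ∧ 0 < μ ∧ μ < 1 ∧
    ∀ x : ℤ → T2, f.IsFullOrbit x → (∀ n, x n ∈ L) →
      ∃ Es Eu, f.IsHyperbolicSplitting x Es Eu C μ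

/-- A hyperbolic set of saddle type: both subbundles are nonzero. -/
def IsSaddleSet (f : TorusEndo) (L : Set T2) : Prop :=
  IsCompact L ∧ f '' L = L ∧ ∃ C μ : ℝ, 0 < C ∧ 0 < μ ∧ μ < 1 ∧
    ∀ x : ℤ → T2, f.IsFullOrbit x → (∀ n, x n ∈ L) →
      ∃ Es Eu, f.IsHyperbolicSplitting x Es Eu C μ ∧ ∀ n, Es n ≠ ⊥ ∧ Eu n ≠ ⊥

/-- `f` is expanding on `L`. -/
def IsExpandingOn (f : TorusEndo) (L : Set T2) : Prop :=
  ∃ c μ : ℝ, 0 < c ∧ 1 < μ ∧ ∀ z ∈ L, ∀ n : ℕ, ∀ v, c * μ ^ n * ‖v‖ ≤ ‖f.diff n z v‖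

/-- The nonwandering set of `f`. -/
abbrev Om (f : TorusEndo) : Set T2 := nonwanderingSet f.toFun

/-- The (strong) Axiom A. -/
structure AxiomA (f : TorusEndo) : Prop where
  hyperbolic : f.IsHyperbolicSet f.Om
  dense_periodic : f.Om ⊆ closure (Function.periodicPts f.toFun)
  expanding_or_injective : ∀ L, IsBasicPiece f.toFun L → f.IsExpandingOn L ∨ InjOn f.toFun L

/-! ### Stable and unstable spaces, strong transversality -/

/-- `Γ`: the nonwandering points outside the attracting and the expanding basic pieces. -/
def gammaSet (f : TorusEndo) : Set T2 :=
  {z ∈ f.Om | ∀ L, IsBasicPiece f.toFun L → z ∈ L →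
    ¬ IsAttractingSet f.toFun L ∧ ¬ f.IsExpandingOn L}

/-- The local stable manifold of `x`. -/
def localStable (f : TorusEndo) (r : ℝ) (x : T2) : Set T2 :=
  {y | ∀ n : ℕ, dist (f^[n] x) (f^[n] y) < r}

/-- The local unstable manifold of `x 0` relative to the preorbit `x`. -/
def localUnstable (f : TorusEndo) (r : ℝ) (x : ℕ → T2) : Set T2 :=
  {y | ∃ w : ℕ → T2, w 0 = y ∧ IsPreorbit f w ∧ ∀ n, dist (x n) (w n) < r}

end TorusEndo

/-- The tangent space at `z` of a subset `S` of the torus: the linear span of the limits of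
directions of `S` at `z`. If `S` is a `C¹` embedded disk near `z`, this is `T_z S`. -/
def tangentSpaceOf (S : Set T2) (z : T2) : Submodule ℝ (ℝ × ℝ) :=
  Submodule.span ℝ (tangentConeAt ℝ (torusProj ⁻¹' S) (torusRep z))

/-- A (possibly infinite) family of subspaces is in general position if the sum of the
codimensions is the codimension of the intersection. -/
def GeneralPosition {ι : Type*} (V : ι → Submodule ℝ (ℝ × ℝ)) : Prop :=
  ∑' i, (Module.finrank ℝ ((ℝ × ℝ) ⧸ V i) : ENNReal) =
    (Module.finrank ℝ ((ℝ × ℝ) ⧸ ⨅ i, V i) : ENNReal)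

namespace TorusEndo

/-- `x` is a preorbit contained in `Γ` and `w` is asymptotic to it in the past. -/
def IsPastAsymptotic (f : TorusEndo) (x w : ℕ → T2) : Prop :=
  IsPreorbit f x ∧ (∀ n, x n ∈ f.gammaSet) ∧ Tendsto (fun n => dist (x n) (w n)) atTop (𝓝 0)

/-- The preorbits of `z` along which `z` belongs to the unstable set of `Γ`. -/
def UnstablePreorbit (f : TorusEndo) (z : T2) : Type :=
  {w : ℕ → T2 // w 0 = z ∧ IsPreorbit f w ∧ ∃ x, f.IsPastAsymptotic x w}

/-- `V = E^u({w n})`: for small `r` and all large `k`, `V` is the image under `D(f^k)` of the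
tangent space at `w k` of the local unstable manifold of `x k`. -/
def IsUnstableSpace (f : TorusEndo) (w : ℕ → T2) (V : Submodule ℝ (ℝ × ℝ)) : Prop :=
  ∀ x, f.IsPastAsymptotic x w → ∃ r₀ > 0, ∀ r, 0 < r → r < r₀ → ∀ᶠ k : ℕ in atTop,
    w k ∈ f.localUnstable r (fun n => x (n + k)) ∧
    V = (tangentSpaceOf (f.localUnstable r (fun n => x (n + k))) (w k)).map
      (f.diff k (w k)).toLinearMap

/-- `z` belongs to the stable set of `x`. -/
def IsFutureAsymptotic (f : TorusEndo) (x z : T2) : Prop :=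
  Tendsto (fun n : ℕ => dist (f^[n] x) (f^[n] z)) atTop (𝓝 0)

/-- `V = E^s(z)`, the tangent space at `z` of the stable set of a nonwandering point `x` with
`z ∈ W^s(x)`: since `W^s(x)` is the increasing union of the sets `f^{-k}(W^s_r(f^k x))` near `z`,
`V` is the preimage under `D(f^k)` of the tangent space at `f^k z` of the local stable manifold of
`f^k x`, for small `r` and all large `k`. -/
def IsStableSpace (f : TorusEndo) (z : T2) (V : Submodule ℝ (ℝ × ℝ)) : Prop :=
  (∃ x ∈ f.Om, f.IsFutureAsymptotic x z) ∧
  ∀ x ∈ f.Om, f.IsFutureAsymptotic x z → ∃ r₀ > 0, ∀ r, 0 < r → r < r₀ → ∀ᶠ k : ℕ in atTop,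
    f^[k] z ∈ f.localStable r (f^[k] x) ∧
    V = (tangentSpaceOf (f.localStable r (f^[k] x)) (f^[k] z)).comap (f.diff k z).toLinearMap

/-- The Strong Transversality Condition: at every point `z`, the unstable spaces
`E^u({w n})` of the preorbits `w` of `z` in the unstable set of `Γ` exist and are in general
position, and, if `z` lies in the unstable set of `Γ`, their intersection is transverse
to `E^s(z)`. -/
def StrongTransversality (f : TorusEndo) : Prop :=
  ∀ z : T2, ∃ V : f.UnstablePreorbit z → Submodule ℝ (ℝ × ℝ),
    (∀ w, f.IsUnstableSpace w.1 (V w)) ∧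
    GeneralPosition V ∧
    (Nonempty (f.UnstablePreorbit z) → ∃ Es, f.IsStableSpace z Es ∧ Es ⊔ ⨅ w, V w = ⊤)

end TorusEndo

/-! ### Przytycki's map -/

/-- The assumptions on the first circle diffeomorphism, given by its lift `f₁ : ℝ → ℝ`:
it is odd, equals `s ↦ lam * s` on `[-s₀, s₀]`, moves the points of `(0, π)` towards `0`, by at
least `η` on `[s₀, π - s₀]`, and has a hyperbolic repeller at `π`. -/
structure IsFirstMap (s₀ η lam : ℝ) (f₁ : ℝ → ℝ) : Prop where
  contDiff : ContDiff ℝ 1 f₁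
  add_period : ∀ s, f₁ (s + 2 * Real.pi) = f₁ s + 2 * Real.pi
  odd : ∀ s, f₁ (-s) = -f₁ s
  deriv_pos : ∀ s, 0 < deriv f₁ s
  linear : ∀ s, |s| ≤ s₀ → f₁ s = lam * s
  lt_self : ∀ s, 0 < s → s < Real.pi → f₁ s < s
  drift : ∀ s, s₀ ≤ s → s ≤ Real.pi - s₀ → f₁ s ≤ s - η
  repelling : 1 < deriv f₁ Real.pi

/-- The assumptions on the second circle map (derived from `z ↦ z²`), given by its lift
`f₂ : ℝ → ℝ`: it is odd, of degree two and without critical points, its fixed points are `0`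
(hyperbolic and attracting) and `±δ`, the preimage of `δ` other than `δ` is `-π + δ/3`, and
`f₂' > 2` for `δ < |t| ≤ π`. -/
structure IsSecondMap (δ : ℝ) (f₂ : ℝ → ℝ) : Prop where
  contDiff : ContDiff ℝ 1 f₂
  add_period : ∀ t, f₂ (t + 2 * Real.pi) = f₂ t + 2 * (2 * Real.pi)
  odd : ∀ t, f₂ (-t) = -f₂ t
  deriv_pos : ∀ t, 0 < deriv f₂ t
  attracting : deriv f₂ 0 < 1
  fixed : ∀ t, -Real.pi ≤ t → t ≤ Real.pi →
    (((f₂ t : ℝ) : Circ) = (t : Circ) ↔ t = 0 ∨ t = δ ∨ t = -δ)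
  preimage : ((f₂ (-Real.pi + δ / 3) : ℝ) : Circ) = (δ : Circ)
  expanding : ∀ t, δ < |t| → |t| ≤ Real.pi → 2 < deriv f₂ t

/-- The assumptions on the perturbation `φ`. -/
structure IsBump (s₀ ε : ℝ) (φ : ℝ → ℝ) : Prop where
  contDiff : ContDiff ℝ 1 φ
  add_period : ∀ s, φ (s + 2 * Real.pi) = φ s
  nonneg : ∀ s, 0 ≤ φ s
  le : ∀ s, φ s ≤ ε
  eq_eps : ∀ s, |s| < s₀ → φ s = ε
  eq_zero : ∀ s, |s - Real.pi| < s₀ → φ s = 0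
  abs_deriv_lt : ∀ s, |deriv φ s| < ε

theorem map_add_int_mul {g : ℝ → ℝ} {p d : ℝ} (h : ∀ s, g (s + p) = g s + d) (n : ℤ) (s : ℝ) :
    g (s + n * p) = g s + n * d := by
  induction n using Int.induction_on with
  | zero => simp
  | succ i ih =>
    have := h (s + i * p)
    push_cast at *
    rw [show s + ((i : ℝ) + 1) * p = s + i * p + p by ring, this, ih]
    ring
  | pred i ih =>
    have := h (s + (-(i : ℝ) - 1) * p)
    push_cast at *
    rw [show s + (-(i : ℝ) - 1) * p + p = s + -(i : ℝ) * p by ring, ih] at this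
    linarith

/-- The circle map induced by a lift of integer degree `d` is covered by the lift. -/
theorem inducedCircleMap_coe {g : ℝ → ℝ} {d : ℤ}
    (h : ∀ t, g (t + 2 * Real.pi) = g t + d * (2 * Real.pi)) (t : ℝ) :
    inducedCircleMap g (t : Circ) = ((g t : ℝ) : Circ) := by
  obtain ⟨n, hn⟩ := exists_int_of_coe_eq (coe_circRep (t : Circ))
  have h2 := coe_add_int_mul (g t) (n * d)
  unfold inducedCircleMap
  rw [hn, map_add_int_mul h, ← h2]
  congr 1
  push_cast
  ring

/-- Przytycki's map `f(s, t) = (f₁(s) + sin(t) φ(s), f₂(t))` of the two-torus. -/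
def przytyckiMap {δ s₀ η ε lam : ℝ} {f₁ f₂ φ : ℝ → ℝ} (h₁ : IsFirstMap s₀ η lam f₁)
    (h₂ : IsSecondMap δ f₂) (hφ : IsBump s₀ ε φ) : TorusEndo where
  lift x := (f₁ x.1 + Real.sin x.2 * φ x.1, f₂ x.2)
  contDiff :=
    ((h₁.contDiff.comp contDiff_fst).add
      ((Real.contDiff_sin.comp contDiff_snd).mul (hφ.contDiff.comp contDiff_fst))).prodMk
      (h₂.contDiff.comp contDiff_snd)
  equivariant := by
    rintro ⟨n, m⟩
    refine ⟨(n, m * 2), fun x => ?_⟩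
    have e₁ := map_add_int_mul h₁.add_period n x.1
    have e₂ := map_add_int_mul h₂.add_period m x.2
    have e₃ := map_add_int_mul (g := φ) (d := 0) (fun s => by rw [hφ.add_period, add_zero]) n x.1
    have e₄ := Real.sin_add_int_mul_two_pi x.2 m
    simp only [latticeVec, Prod.fst_add, Prod.snd_add, Prod.mk_add_mk] at *
    rw [e₁, e₂, e₃, e₄]
    ext
    · simp only
      ring
    · simp only
      push_cast
      ring

end

/-! ### Nonwandering points and basic pieces -/

section Dynamics

variable {X : Type*} [TopologicalSpace X] {g : X → X}

/-! The map is a skew product over the circle map `f₂`, so its dynamics is organised by the two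
coordinates. In the base, the arc |t| < δ is the basin of 0, and the complement of the whole basin
is the repeller K₁. It lies in two arcs, each mapped expandingly across both of them, so itineraries
identify K₁ with the full shift on two symbols (`exists_coding`). In the fibre, the circle s = π is
invariant, and every orbit off it drifts into the annulus |s| ≤ 2ε, where the map is (s, t) ↦ (λs +
ε sin t, f₂(t)). A nonwandering point thus has t = 0 or t ∈ K₁, and has s = π or lies in every
forward image of the annulus. This leaves a sink, a saddle point, {π} × K₁ and the set Γ₀
(`solenoid`), the intersection of the forward images of the part of the annulus over K₁ (`Om_eq`).
On that part f is injective: each arc is mapped injectively, and sin t has opposite signs over the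
two arcs with modulus above 2λ, which exceeds what λs can compensate (`injOn_strip`). Hyperbolicity
of Γ₀ is explicit: horizontal vectors contract by λ, and unstable slopes form the bounded solution
of an affine recurrence.

Strong transversality requires all preorbits of a point z that are asymptotic in the past to Γ,
which consists of the saddle point and Γ₀ (`gammaSet_eq`). Those belonging to the saddle point run
along t = 0, have horizontal unstable space, and there is at most one of them for each z. Those
belonging to Γ₀ remain in the annulus. Their s-coordinates are determined by their t-coordinates
through a convergent series of sines, so the unstable manifolds are graphs over t with a computable
slope (`tangentSpaceOf_localUnstable`, `isUnstableSpace_slope`).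

Two such preorbits of z in the annulus can separate only where two points over different t have the
same image. The sines must then agree up to 4λ, which forces one t to be π + σ and the other to be
τ, with σ and τ of order λ (`exists_isBranch`). There the cosines have opposite signs, hence so do
the slopes, and the two unstable lines at z differ (`IsBranch.slope_ne`). Looking one more step into
the past gives sin|σ| + sin|τ| = λ sin q + O(λ²), where f₂(q) = π (`IsBranch.estimate`).

A third preorbit would yield two consecutive branches. One preorbit would then pass near t = 0 at
both branch times, so that |τ| ≤ θ|τ'| with θ < 1, whereas the estimate makes |τ| and |τ'| nearly
equal (`IsBranch.not_isBranch`). So at most two distinct lines occur at each point, and these are in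
general position. Over t = 0 the same estimate leaves only one preorbit in the annulus besides the
possible horizontal one. Finally, in the basin of the sink the stable space is the whole plane, and
elsewhere the unstable line is unique and complementary to the stable one. -/

theorem isClosed_nonwanderingSet (g : X → X) : IsClosed (nonwanderingSet g) := by
  rw [← isOpen_compl_iff, isOpen_iff_mem_nhds]
  intro z hz
  simp only [nonwanderingSet, mem_compl_iff, mem_ofPred_eq, not_forall] at hz
  obtain ⟨U, hU, hn⟩ := hz
  filter_upwards [eventually_mem_nhds_iff.2 hU] with y hy
  exact fun h => hn (h U hy)

theorem mem_nonwanderingSet_of_mem_periodicPts {z : X} (h : z ∈ Function.periodicPts g) :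
    z ∈ nonwanderingSet g := by
  obtain ⟨n, hn, hz⟩ := h
  exact fun U hU => ⟨n, hn, z, ⟨z, mem_of_mem_nhds hU, hz⟩, mem_of_mem_nhds hU⟩

/-- Either a nonwandering point is periodic, or arbitrarily small neighbourhoods return to
themselves after arbitrarily long times. -/
theorem exists_long_return [T2Space X] (hg : Continuous g) {z : X} (hz : z ∈ nonwanderingSet g)
    (hp : z ∉ Function.periodicPts g) (m : ℕ) {U : Set X} (hU : U ∈ 𝓝 z) :
    ∃ n, m ≤ n ∧ (g^[n] '' U ∩ U).Nonempty := by
  have key : ∀ i, 1 ≤ i → ∃ V ∈ 𝓝 z, g^[i] '' V ∩ V = ∅ := by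
    intro i hi
    have hne : g^[i] z ≠ z := fun h => hp ⟨i, hi, h⟩
    obtain ⟨A, B, hA, hB, hzA, hzB, hd⟩ := t2_separation hne
    refine ⟨g^[i] ⁻¹' A ∩ B, inter_mem ((hg.iterate i).continuousAt.preimage_mem_nhds
      (hA.mem_nhds hzA)) (hB.mem_nhds hzB), ?_⟩
    rw [eq_empty_iff_forall_notMem]
    rintro _ ⟨⟨y, ⟨hy, -⟩, rfl⟩, -, hy'⟩
    exact disjoint_left.1 hd hy hy'
  choose! V hV hV' using key
  -- Shrinking by all the `V i` rules out returns at times 1, …, m, so the next return is late.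
  have hW : U ∩ ⋂ i ∈ Finset.Icc 1 m, V i ∈ 𝓝 z :=
    inter_mem hU ((Filter.biInter_finset_mem _).2 fun i hi => hV i (Finset.mem_Icc.1 hi).1)
  obtain ⟨n, hn, x, ⟨y, hy, hyx⟩, hx⟩ := hz _ hW
  refine ⟨n, ?_, x, ⟨y, hy.1, hyx⟩, hx.1⟩
  by_contra! hlt
  have hmem : n ∈ Finset.Icc 1 m := Finset.mem_Icc.2 ⟨hn, hlt.le⟩
  have : x ∈ g^[n] '' V n ∩ V n :=
    ⟨⟨y, mem_iInter₂.1 hy.2 n hmem, hyx⟩, mem_iInter₂.1 hx.2 n hmem⟩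
  rw [hV' n hn] at this
  exact this

/-- A nonwandering point that has a neighbourhood which is mapped into a closed forward invariant
set by some iterate belongs to that set. -/
theorem mem_of_mem_nonwanderingSet [T2Space X] (hg : Continuous g) {z : X}
    (hz : z ∈ nonwanderingSet g) {W : Set X} (hW : IsClosed W) (hgW : MapsTo g W W) (m : ℕ)
    (hm : ∀ᶠ y in 𝓝 z, g^[m] y ∈ W) : z ∈ W := by
  by_cases hp : z ∈ Function.periodicPts g
  · obtain ⟨n, hn, h⟩ := hp
    have h1 : g^[m * n] z = z := h.const_mul m
    obtain ⟨j, hj⟩ := Nat.exists_eq_add_of_le (Nat.le_mul_of_pos_right m hn)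
    rw [hj, add_comm, Function.iterate_add_apply] at h1
    rw [← h1]
    exact hgW.iterate j hm.self_of_nhds
  · rw [← hW.closure_eq, mem_closure_iff_nhds]
    intro U hU
    obtain ⟨n, hn, x, ⟨y, hy, hyx⟩, hx⟩ := exists_long_return hg hz hp m (inter_mem hU hm)
    refine ⟨x, hx.1, ?_⟩
    obtain ⟨j, rfl⟩ := Nat.exists_eq_add_of_le hn
    rw [← hyx, add_comm, Function.iterate_add_apply]
    exact hgW.iterate j hy.2

theorem map_mem_nonwanderingSet_of_semiconj {Y : Type*} [TopologicalSpace Y] {h : Y → Y}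
    {π : X → Y} (hπ : Continuous π) (hs : Function.Semiconj π g h) {z : X}
    (hz : z ∈ nonwanderingSet g) : π z ∈ nonwanderingSet h := by
  intro U hU
  obtain ⟨n, hn, x, ⟨y, hy, hyx⟩, hx⟩ := hz _ (hπ.continuousAt.preimage_mem_nhds hU)
  refine ⟨n, hn, π x, ⟨π y, hy, ?_⟩, hx⟩
  rw [← hyx, (hs.iterate_right n).eq]

/-- A nonwandering point that is attracted by a point with a basis of closed forward invariant
neighbourhoods is equal to it. -/
theorem eq_of_mem_nonwanderingSet_of_tendsto [T2Space X] (hg : Continuous g) {z p : X}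
    (hz : z ∈ nonwanderingSet g) (hp : ∀ O ∈ 𝓝 p, ∃ W ∈ 𝓝 p, IsClosed W ∧ MapsTo g W W ∧ W ⊆ O)
    (ht : Tendsto (fun n => g^[n] z) atTop (𝓝 p)) : z = p := by
  by_contra hne
  obtain ⟨W, hW, hWc, hgW, hWO⟩ := hp {z}ᶜ (isOpen_compl_singleton.mem_nhds (Ne.symm hne))
  obtain ⟨m, hm⟩ := (ht.eventually (eventually_mem_nhds_iff.2 hW)).exists
  exact hWO (mem_of_mem_nonwanderingSet hg hz hWc hgW m
    ((hg.iterate m).continuousAt.eventually hm)) rfl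

/-- A transitive set that meets an invariant relatively open subset of a set in which the
complement is also invariant and relatively open is contained in that subset. -/
theorem IsTransitiveOn.subset_of_mem {L P Q : Set X} (hL : IsTransitiveOn g L)
    (hPQ : L ⊆ P ∪ Q) (hP : MapsTo g P P) {A B : Set X} (hA : IsOpen A) (hB : IsOpen B)
    (hAP : P ⊆ A) (hBQ : Q ⊆ B) (hAQ : Disjoint A Q) (hBP : Disjoint B P) {z : X} (hz : z ∈ L)
    (hzP : z ∈ P) : L ⊆ P := by
  intro y hy
  by_contra hyP
  have hyQ : y ∈ Q := (hPQ hy).resolve_left hyP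
  obtain ⟨n, x, ⟨w, ⟨hwA, hwL⟩, hwx⟩, hx⟩ :=
    hL A B hA hB ⟨z, hAP hzP, hz⟩ ⟨y, hBQ hyQ, hy⟩
  have hwP : w ∈ P := (hPQ hwL).resolve_right (disjoint_left.1 hAQ hwA)
  exact disjoint_left.1 hBP hx (hwx ▸ hP.iterate n hwP)

end Dynamics

/-! ### The circle -/

instance fact_two_pi_pos : Fact (0 < 2 * Real.pi) := ⟨Real.two_pi_pos⟩

section Circle

theorem norm_coe_of_abs_le {x : ℝ} (h : |x| ≤ Real.pi) : ‖(x : Circ)‖ = |x| := by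
  rw [AddCircle.norm_coe_eq_abs_iff _ Real.two_pi_pos.ne', abs_of_pos Real.two_pi_pos]
  linarith

theorem norm_coe_le_abs (x : ℝ) : ‖(x : Circ)‖ ≤ |x| := by
  by_cases h : |x| ≤ Real.pi
  · exact (norm_coe_of_abs_le h).le
  · have := AddCircle.norm_le_half_period (2 * Real.pi) (x := (x : Circ)) Real.two_pi_pos.ne'
    rw [abs_of_pos Real.two_pi_pos] at this
    linarith

theorem norm_circ_le_pi (a : Circ) : ‖a‖ ≤ Real.pi := by
  have := AddCircle.norm_le_half_period (2 * Real.pi) (x := a) Real.two_pi_pos.ne'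
  rw [abs_of_pos Real.two_pi_pos] at this
  linarith

theorem circRep_mem (a : Circ) : circRep a ∈ Ico (-Real.pi) Real.pi := by
  have h := (AddCircle.equivIco (2 * Real.pi) (-Real.pi) a).2
  exact ⟨h.1, h.2.trans_eq (by ring)⟩

theorem abs_circRep (a : Circ) : |circRep a| = ‖a‖ := by
  have h := circRep_mem a
  conv_rhs => rw [← coe_circRep a]
  rw [norm_coe_of_abs_le (abs_le.2 ⟨h.1, h.2.le⟩)]

theorem exists_coe_eq_abs_sub (a : Circ) (x : ℝ) : ∃ y : ℝ, (y : Circ) = a ∧ |y - x| = dist a x := by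
  refine ⟨x + circRep (a - x), ?_, ?_⟩
  · rw [AddCircle.coe_add, coe_circRep]; abel
  · rw [add_sub_cancel_left, abs_circRep, dist_eq_norm]

theorem exists_coe_eq_abs (a : Circ) : ∃ y : ℝ, (y : Circ) = a ∧ |y| = ‖a‖ :=
  ⟨circRep a, coe_circRep a, abs_circRep a⟩

/-- The passage from the circle back to the line: a congruence becomes an equality once a size
estimate excludes a nonzero period. -/
theorem eq_of_coe_eq {x y : ℝ} (h : (x : Circ) = y) (hlt : |x - y| < 2 * Real.pi) : x = y := by
  obtain ⟨n, rfl⟩ := exists_int_of_coe_eq h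
  rw [add_sub_cancel_left, abs_mul, abs_of_pos Real.two_pi_pos] at hlt
  have h1 : |(n : ℝ)| < 1 := by
    by_contra! hc
    nlinarith [Real.two_pi_pos]
  have : n = 0 := by
    rw [← Int.cast_abs] at h1
    exact Int.abs_lt_one_iff.1 (by exact_mod_cast h1)
  simp [this]

theorem dist_coe_le (x y : ℝ) : dist (x : Circ) (y : Circ) ≤ |x - y| := by
  rw [dist_eq_norm, ← AddCircle.coe_sub]
  exact norm_coe_le_abs _

theorem dist_coe_of_abs_le {x y : ℝ} (h : |x - y| ≤ Real.pi) :
    dist (x : Circ) (y : Circ) = |x - y| := by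
  rw [dist_eq_norm, ← AddCircle.coe_sub, norm_coe_of_abs_le h]

theorem continuous_coe_circ : Continuous ((↑) : ℝ → Circ) := AddCircle.continuous_mk' _

theorem continuous_torusProj : Continuous torusProj :=
  (continuous_coe_circ.comp continuous_fst).prodMk (continuous_coe_circ.comp continuous_snd)

theorem isLocalHomeomorph_torusProj : IsLocalHomeomorph torusProj := by
  have h := AddCircle.isLocalHomeomorph_coe (2 * Real.pi)
  intro x
  obtain ⟨e₁, h₁, e₁'⟩ := h x.1
  obtain ⟨e₂, h₂, e₂'⟩ := h x.2
  refine ⟨e₁.prod e₂, ⟨h₁, h₂⟩, ?_⟩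
  funext y
  simp only [torusProj, OpenPartialHomeomorph.prod_apply, ← e₁', ← e₂']

theorem surjective_torusProj : Function.Surjective torusProj :=
  fun z => ⟨torusRep z, torusProj_torusRep z⟩

theorem TorusEndo.continuous (f : TorusEndo) : Continuous f.toFun := by
  have hq : IsOpenQuotientMap torusProj :=
    ⟨surjective_torusProj, continuous_torusProj, isLocalHomeomorph_torusProj.isOpenMap⟩
  rw [hq.isQuotientMap.continuous_iff]
  refine (continuous_torusProj.comp f.contDiff.continuous).congr fun x => ?_
  exact (f.toFun_torusProj x).symm

/-- The differential of an iterate is the composition of the differentials along the orbit. -/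
theorem TorusEndo.diff_succ_apply (f : TorusEndo) (n : ℕ) (z : T2) (v : ℝ × ℝ) :
    f.diff (n + 1) z v = f.diff 1 (f.toFun^[n] z) (f.diff n z v) := by
  have hit : ∀ n x, f.toFun^[n] (torusProj x) = torusProj (f.lift^[n] x) := fun n x =>
    ((Function.Semiconj.iterate_right (f := torusProj) (ga := f.lift) (gb := f.toFun)
      (fun y => (f.toFun_torusProj y).symm) n) x).symm
  have hd : ∀ n, Differentiable ℝ (f.lift^[n]) := fun n =>
    (f.contDiff.differentiable one_ne_zero).iterate n
  obtain ⟨x, rfl⟩ := surjective_torusProj z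
  rw [hit, f.diff_torusProj, f.diff_torusProj, f.diff_torusProj, Function.iterate_succ',
    fderiv_comp _ ((f.contDiff.differentiable one_ne_zero) _) (hd n x)]
  rfl

theorem TorusEndo.diff_zero_apply (f : TorusEndo) (z : T2) (v : ℝ × ℝ) : f.diff 0 z v = v := by
  simp [TorusEndo.diff]

theorem TorusEndo.diff_add_apply (f : TorusEndo) (n k : ℕ) (z : T2) (v : ℝ × ℝ) :
    f.diff (k + n) z v = f.diff k (f.toFun^[n] z) (f.diff n z v) := by
  induction k with
  | zero => rw [zero_add, f.diff_zero_apply]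
  | succ k ih =>
    rw [Nat.add_right_comm, f.diff_succ_apply (k + n), ih, f.diff_succ_apply k,
      ← Function.iterate_add_apply]

end Circle

/-! ### Tangent spaces of curves -/

section Tangent

/-- If near `x` a set is contained in the zero set of a function whose derivative vanishes only
along `v`, and contains a curve with velocity `v`, its tangent space is spanned by `v`. -/
theorem span_tangentConeAt_eq {S : Set (ℝ × ℝ)} {x v : ℝ × ℝ} {γ : ℝ → ℝ × ℝ} {a : ℝ}
    {F : ℝ × ℝ → ℝ} {L : ℝ × ℝ →L[ℝ] ℝ} (hγ : HasDerivAt γ v a) (hγa : γ a = x)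
    (hγS : ∀ᶠ t in 𝓝 a, γ t ∈ S) (hF : HasFDerivAt F L x) (hFx : F x = 0)
    (hFS : ∀ᶠ y in 𝓝 x, y ∈ S → F y = 0) (hL : ∀ u, L u = 0 → ∃ c : ℝ, u = c • v) :
    Submodule.span ℝ (tangentConeAt ℝ S x) = Submodule.span ℝ {v} := by
  apply le_antisymm
  · rw [Submodule.span_le]
    intro u hu
    rw [← tangentConeAt_inter_nhds (hFS : {y | y ∈ S → F y = 0} ∈ 𝓝 x)] at hu
    -- The derivative of `F` sends the tangent cone of the set into that of its image {0}, which is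
    -- trivial, so tangent vectors lie in the kernel of `L`.
    have h1 := (hF.hasFDerivWithinAt (s := S ∩ {y | y ∈ S → F y = 0})).mapsTo_tangent_cone hu
    have h2 : F '' (S ∩ {y | y ∈ S → F y = 0}) ⊆ {0} := by
      rintro _ ⟨y, ⟨hy, hy'⟩, rfl⟩
      exact hy' hy
    have h3 := tangentConeAt_mono h2 h1
    rw [hFx] at h3
    have h4 : L u = 0 := by
      have := tangentConeAt_subset_zero (𝕜 := ℝ) (x := (0 : ℝ)) (s := {0}) (by
        rw [accPt_principal_iff_nhdsWithin]
        simp) h3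
      simpa using this
    obtain ⟨c, rfl⟩ := hL u h4
    exact Submodule.smul_mem _ _ (Submodule.mem_span_singleton_self v)
  · rw [Submodule.span_le, singleton_subset_iff]
    apply Submodule.subset_span
    have h1 := hγ.hasFDerivAt.hasFDerivWithinAt (s := {t | γ t ∈ S})
    have h2 := h1.mapsTo_tangent_cone (show (1 : ℝ) ∈ tangentConeAt ℝ {t | γ t ∈ S} a by
      rw [tangentConeAt_of_mem_nhds hγS]; trivial)
    rw [hγa] at h2
    have h3 := tangentConeAt_mono (𝕜 := ℝ) (x := x) (image_subset_iff.2 fun t ht => ht :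
      γ '' {t | γ t ∈ S} ⊆ S) h2
    simpa using h3

theorem tangentSpaceOf_graph {S : Set T2} {z : T2} {Φ : ℝ → ℝ} {u : ℝ}
    (hΦ : HasDerivAt Φ u (circRep z.2)) (hΦz : Φ (circRep z.2) = circRep z.1)
    (h : ∀ᶠ y in 𝓝 (torusRep z), torusProj y ∈ S → y.1 = Φ y.2)
    (h' : ∀ᶠ t in 𝓝 (circRep z.2), torusProj (Φ t, t) ∈ S) :
    tangentSpaceOf S z = Submodule.span ℝ {(u, 1)} := by
  have h1 : HasFDerivAt (fun y : ℝ × ℝ => Φ y.2)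
      ((ContinuousLinearMap.toSpanSingleton ℝ u).comp (ContinuousLinearMap.snd ℝ ℝ ℝ))
      (torusRep z) :=
    HasFDerivAt.comp (torusRep z) (hΦ.hasFDerivAt :) hasFDerivAt_snd
  refine span_tangentConeAt_eq (γ := fun t => (Φ t, t)) (a := circRep z.2)
    (F := fun y => y.1 - Φ y.2) (hΦ.prodMk (hasDerivAt_id _)) (Prod.ext hΦz rfl) h'
    (hasFDerivAt_fst.sub h1) ?_ ?_ ?_
  · simp only [torusRep, hΦz, sub_self]
  · filter_upwards [h] with y hy hyS
    rw [hy hyS, sub_self]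
  · intro w hw
    refine ⟨w.2, ?_⟩
    simp at hw
    ext
    · simp; linarith
    · simp

theorem tangentSpaceOf_horizontal {S : Set T2} {z : T2}
    (h : ∀ᶠ y in 𝓝 (torusRep z), torusProj y ∈ S → y.2 = circRep z.2)
    (h' : ∀ᶠ s in 𝓝 (circRep z.1), torusProj (s, circRep z.2) ∈ S) :
    tangentSpaceOf S z = Submodule.span ℝ {(1, 0)} := by
  refine span_tangentConeAt_eq (γ := fun s => (s, circRep z.2)) (a := circRep z.1)
    (F := fun y => y.2 - circRep z.2) ((hasDerivAt_id _).prodMk (hasDerivAt_const _ _)) rfl h'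
    (hasFDerivAt_snd.sub_const _) ?_ ?_ ?_
  · simp [torusRep]
  · filter_upwards [h] with y hy hyS
    rw [hy hyS, sub_self]
  · intro w hw
    refine ⟨w.1, ?_⟩
    simp at hw
    ext <;> simp [hw]

theorem tangentSpaceOf_of_mem_nhds {S : Set T2} {z : T2} (h : S ∈ 𝓝 z) :
    tangentSpaceOf S z = ⊤ := by
  unfold tangentSpaceOf
  rw [tangentConeAt_of_mem_nhds, Submodule.span_univ]
  apply continuous_torusProj.continuousAt.preimage_mem_nhds
  rwa [torusProj_torusRep]

end Tangent

/-! ### Families of lines in the plane -/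

section Lines

theorem finrank_quotient_span_singleton {v : ℝ × ℝ} (hv : v ≠ 0) :
    Module.finrank ℝ ((ℝ × ℝ) ⧸ Submodule.span ℝ {v}) = 1 := by
  have h := (Submodule.span ℝ {v}).finrank_quotient_add_finrank
  rw [finrank_span_singleton hv] at h
  simpa using h

/-- A family of at most two lines, pairwise distinct, is in general position. -/
theorem generalPosition_of_lines {ι : Type*} {V : ι → Submodule ℝ (ℝ × ℝ)}
    (hV : ∀ i, ∃ v ≠ 0, V i = Submodule.span ℝ {v}) (h2 : ∀ i j, i ≠ j → V i ≠ V j)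
    (h3 : ∀ i j k : ι, i ≠ j → i ≠ k → j ≠ k → False) : GeneralPosition V := by
  classical
  have hfin : ∀ i, Module.finrank ℝ ((ℝ × ℝ) ⧸ V i) = 1 := by
    intro i
    obtain ⟨v, hv, h⟩ := hV i
    rw [h, finrank_quotient_span_singleton hv]
  unfold GeneralPosition
  by_cases he : Nonempty ι
  swap
  · rw [not_nonempty_iff] at he
    rw [tsum_empty, iInf_of_empty]
    have : Module.finrank ℝ ((ℝ × ℝ) ⧸ (⊤ : Submodule ℝ (ℝ × ℝ))) = 0 :=
      Module.finrank_zero_of_subsingleton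
    simp [this]
  obtain ⟨i⟩ := he
  by_cases hi : ∀ j, j = i
  · have : Unique ι := ⟨⟨i⟩, hi⟩
    rw [tsum_eq_single i fun j hj => absurd (hi j) hj]
    congr 1
    have hinf : ⨅ j, V j = V i := le_antisymm (iInf_le _ i) (le_iInf fun j => by rw [hi j])
    rw [hinf]
  push Not at hi
  obtain ⟨j, hj⟩ := hi
  have hall : ∀ k, k = i ∨ k = j := by
    intro k
    by_contra! hk
    exact h3 i j k (Ne.symm hj) (Ne.symm hk.1) (Ne.symm hk.2)
  have hinf : ⨅ k, V k = V i ⊓ V j := by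
    refine le_antisymm (le_inf (iInf_le _ i) (iInf_le _ j)) (le_iInf fun k => ?_)
    rcases hall k with rfl | rfl
    · exact inf_le_left
    · exact inf_le_right
  have hbot : V i ⊓ V j = ⊥ := by
    obtain ⟨v, hv, hvi⟩ := hV i
    obtain ⟨w, hw, hwj⟩ := hV j
    rw [Submodule.eq_bot_iff]
    rintro x ⟨hx1, hx2⟩
    by_contra hx
    have e1 : V i = Submodule.span ℝ {x} := by
      rw [hvi] at hx1 ⊢
      obtain ⟨c, rfl⟩ := Submodule.mem_span_singleton.1 hx1
      have hc : c ≠ 0 := by rintro rfl; simp at hx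
      exact (Submodule.span_singleton_smul_eq hc.isUnit v).symm
    have e2 : V j = Submodule.span ℝ {x} := by
      rw [hwj] at hx2 ⊢
      obtain ⟨c, rfl⟩ := Submodule.mem_span_singleton.1 hx2
      have hc : c ≠ 0 := by rintro rfl; simp at hx
      exact (Submodule.span_singleton_smul_eq hc.isUnit w).symm
    exact h2 i j (Ne.symm hj) (e1.trans e2.symm)
  rw [tsum_eq_sum (s := {i, j}) fun k hk => absurd (hall k) (by simpa using hk),
    Finset.sum_pair (Ne.symm hj), hinf, hbot, hfin, hfin]
  have h := (⊥ : Submodule ℝ (ℝ × ℝ)).finrank_quotient_add_finrank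
  simp only [finrank_bot, Module.finrank_prod, Module.finrank_self] at h
  rw [show Module.finrank ℝ ((ℝ × ℝ) ⧸ (⊥ : Submodule ℝ (ℝ × ℝ))) = 2 by omega]
  norm_num

end Lines

/-! ### The expanding circle map -/

namespace IsSecondMap

variable {δ : ℝ} {f₂ : ℝ → ℝ}

theorem strictMono (h : IsSecondMap δ f₂) : StrictMono f₂ := strictMono_of_deriv_pos h.deriv_pos

theorem differentiable (h : IsSecondMap δ f₂) : Differentiable ℝ f₂ :=
  h.contDiff.differentiable one_ne_zero

theorem continuous (h : IsSecondMap δ f₂) : Continuous f₂ := h.contDiff.continuous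

theorem continuous_deriv (h : IsSecondMap δ f₂) : Continuous (deriv f₂) :=
  h.contDiff.continuous_deriv le_rfl

theorem map_zero (h : IsSecondMap δ f₂) : f₂ 0 = 0 := by
  have := h.odd 0
  rw [neg_zero] at this
  linarith

theorem map_pi (h : IsSecondMap δ f₂) : f₂ Real.pi = 2 * Real.pi := by
  have h1 := h.add_period (-Real.pi)
  rw [h.odd, show -Real.pi + 2 * Real.pi = Real.pi by ring] at h1
  linarith

theorem abs_map (h : IsSecondMap δ f₂) (t : ℝ) : |f₂ t| = f₂ |t| := by
  have h0 := h.map_zero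
  rcases le_total 0 t with ht | ht
  · have := h.strictMono.monotone ht
    rw [abs_of_nonneg ht, abs_of_nonneg (by linarith)]
  · have := h.strictMono.monotone ht
    rw [abs_of_nonpos ht, h.odd, abs_of_nonpos (by linarith)]

theorem deriv_neg (h : IsSecondMap δ f₂) (t : ℝ) : deriv f₂ (-t) = deriv f₂ t := by
  have h1 : (fun s => f₂ (-s)) = fun s => -f₂ s := funext h.odd
  have h2 := deriv_comp_neg f₂ t
  rw [h1, deriv.fun_neg] at h2
  linarith

theorem deriv_abs (h : IsSecondMap δ f₂) (t : ℝ) : deriv f₂ |t| = deriv f₂ t := by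
  rcases abs_choice t with ht | ht <;> rw [ht]
  exact h.deriv_neg t

theorem map_add_int (h : IsSecondMap δ f₂) (t : ℝ) (n : ℤ) :
    f₂ (t + n * (2 * Real.pi)) = f₂ t + (2 * n : ℤ) * (2 * Real.pi) := by
  rw [map_add_int_mul h.add_period]
  push_cast
  ring

theorem deriv_eq_of_coe_eq (h : IsSecondMap δ f₂) {s t : ℝ} (hst : (s : Circ) = t) :
    deriv f₂ s = deriv f₂ t := by
  obtain ⟨n, rfl⟩ := exists_int_of_coe_eq hst
  rw [← deriv_comp_add_const, funext fun t => h.map_add_int t n, deriv_add_const]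

theorem map_fixed (h : IsSecondMap δ f₂) (hδ : 0 < δ) (hδπ : δ < Real.pi) : f₂ δ = δ := by
  refine eq_of_coe_eq ((h.fixed δ (by linarith) hδπ.le).2 (by simp)) ?_
  have h0 := h.strictMono hδ
  have h1 := h.strictMono hδπ
  rw [h.map_zero] at h0
  rw [h.map_pi] at h1
  rw [abs_lt]
  constructor <;> linarith

/-- Monotonicity puts f₂(-π + δ/3) between -2π and 0, which selects the lift -2π + δ of the
prescribed image δ; oddness then transfers this to π - δ/3. -/
theorem map_pi_sub (h : IsSecondMap δ f₂) (hδ : 0 < δ) (hδπ : δ < Real.pi) :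
    f₂ (Real.pi - δ / 3) = 2 * Real.pi - δ := by
  have h1 : f₂ (-Real.pi + δ / 3) = -(2 * Real.pi) + δ := by
    refine eq_of_coe_eq ?_ ?_
    · rw [h.preimage]
      have := coe_add_int_mul δ (-1)
      rw [← this]
      push_cast
      congr 1
      ring
    · have h2 := h.strictMono (show -Real.pi < -Real.pi + δ / 3 by linarith)
      have h3 := h.strictMono (show -Real.pi + δ / 3 < 0 by linarith)
      rw [h.map_zero] at h3
      rw [h.odd, h.map_pi] at h2
      rw [abs_lt]
      constructor <;> linarith
  rw [show Real.pi - δ / 3 = -(-Real.pi + δ / 3) by ring, h.odd, h1]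
  ring

theorem lt_pi_sub (h : IsSecondMap δ f₂) (hδ : 0 < δ) (hδπ : δ < Real.pi) :
    δ < Real.pi - δ / 3 := by
  by_contra! hc
  have := h.strictMono.monotone hc
  rw [h.map_pi_sub hδ hδπ, h.map_fixed hδ hδπ] at this
  linarith

/-- Since f₂'(0) < 1 the graph starts below the diagonal; crossing it before δ would create a fixed
point in (0, δ). -/
theorem map_lt_self (h : IsSecondMap δ f₂) (hδπ : δ < Real.pi) {t : ℝ} (ht : 0 < t)
    (htδ : t < δ) : f₂ t < t := by
  have hd : HasDerivAt f₂ (deriv f₂ 0) 0 := (h.differentiable 0).hasDerivAt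
  have hne : ∀ x, 0 < x → x < δ → f₂ x ≠ x := by
    intro x hx hxδ he
    rcases (h.fixed x (by linarith) (by linarith)).1 (by rw [he]) with h1 | h1 | h1 <;> linarith
  by_contra! hc
  have hsmall : ∃ x, 0 < x ∧ x < t ∧ f₂ x < x := by
    have h1 := hd.tendsto_slope_zero_right
    have h2 := h1.eventually (gt_mem_nhds h.attracting)
    have h3 : ∀ᶠ x : ℝ in 𝓝[>] 0, x < t := nhdsWithin_le_nhds (gt_mem_nhds ht)
    obtain ⟨x, ⟨hx, hxt⟩, hx0⟩ := ((h2.and h3).and self_mem_nhdsWithin).exists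
    have hx0 : 0 < x := hx0
    refine ⟨x, hx0, hxt, ?_⟩
    simp only [zero_add, h.map_zero, sub_zero, smul_eq_mul] at hx
    rwa [inv_mul_lt_iff₀ hx0, mul_one] at hx
  obtain ⟨x, hx0, hxt, hx⟩ := hsmall
  obtain ⟨y, hy, hy'⟩ := intermediate_value_Icc hxt.le
    ((h.continuous.sub continuous_id).continuousOn) (show (0 : ℝ) ∈ Icc (f₂ x - x) (f₂ t - t) from
      ⟨by linarith, by linarith⟩)
  exact hne y (by linarith [hy.1]) (by linarith [hy.2]) (by simp at hy'; linarith)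

theorem map_le_self (h : IsSecondMap δ f₂) (hδ : 0 < δ) (hδπ : δ < Real.pi) {t : ℝ} (ht : 0 ≤ t)
    (htδ : t ≤ δ) : f₂ t ≤ t := by
  rcases ht.eq_or_lt with rfl | ht
  · rw [h.map_zero]
  rcases htδ.eq_or_lt with rfl | htδ
  · rw [h.map_fixed hδ hδπ]
  · exact (h.map_lt_self hδπ ht htδ).le

end IsSecondMap

/-! ### Quantitative constants, the repeller of `f₂` and its symbolic coding -/

/-- Constants that quantify the expansion and contraction of the circle map `f₂`. -/
structure SecondConsts (δ : ℝ) (f₂ : ℝ → ℝ) (m M ρ θ q : ℝ) : Prop where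
  map : IsSecondMap δ f₂
  δ_pos : 0 < δ
  δ_lt : δ < Real.pi
  m_pos : 0 < m
  m_le_one : m ≤ 1
  le_deriv : ∀ t, m ≤ deriv f₂ t
  deriv_le : ∀ t, deriv f₂ t ≤ M
  one_le_M : 1 ≤ M
  ρ_pos : 0 < ρ
  ρ_lt : 3 * ρ < δ
  ρ_le : ρ ≤ 1
  expand : ∀ t : ℝ, δ - ρ ≤ ‖(t : Circ)‖ → 3 / 2 ≤ deriv f₂ t
  θ_pos : 0 < θ
  θ_lt : θ < 1
  contract : ∀ t, |t| ≤ ρ → deriv f₂ t ≤ θ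
  q_pos : 0 < q
  q_lt : q < Real.pi
  map_q : f₂ q = Real.pi

/-- The bounds on f₂' come from periodicity and compactness. Expansion by 3/2 extends a distance ρ
into the arc |t| < δ, because f₂'(δ) ≥ 2 by continuity from outside. The number θ lies between
f₂'(0) and 1, and q comes from the intermediate value theorem; both serve only the comparison of
branching preorbits. -/
theorem IsSecondMap.exists_consts {δ : ℝ} {f₂ : ℝ → ℝ} (h : IsSecondMap δ f₂) (hδ : 0 < δ)
    (hδπ : δ < Real.pi) : ∃ m M ρ θ q, SecondConsts δ f₂ m M ρ θ q := by
  have hper : ∀ t : ℝ, ∃ s ∈ Icc (-Real.pi) Real.pi, deriv f₂ s = deriv f₂ t := fun t =>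
    ⟨circRep (t : Circ), Ico_subset_Icc_self (circRep_mem _),
      h.deriv_eq_of_coe_eq (coe_circRep _)⟩
  have hne : (Icc (-Real.pi) Real.pi).Nonempty := ⟨0, by simp [Real.pi_pos.le]⟩
  obtain ⟨a, -, ha⟩ := isCompact_Icc.exists_isMinOn hne h.continuous_deriv.continuousOn
  obtain ⟨b, -, hb⟩ := isCompact_Icc.exists_isMaxOn hne h.continuous_deriv.continuousOn
  have hδ2 : 2 ≤ deriv f₂ δ := by
    refine ge_of_tendsto (h.continuous_deriv.continuousAt.tendsto.mono_left
      (nhdsWithin_le_nhds (s := Ioi δ))) ?_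
    have : ∀ᶠ x in 𝓝[>] δ, x < Real.pi := nhdsWithin_le_nhds (gt_mem_nhds hδπ)
    filter_upwards [this, self_mem_nhdsWithin] with x hx hx'
    have hx' : δ < x := hx'
    exact (h.expanding x (by rwa [abs_of_pos (hδ.trans hx')])
      (by rw [abs_of_pos (hδ.trans hx')]; exact hx.le)).le
  obtain ⟨r₁, hr₁, hr₁'⟩ := Metric.eventually_nhds_iff.1
    (h.continuous_deriv.continuousAt.eventually (lt_mem_nhds (show 3 / 2 < deriv f₂ δ by linarith)))
  obtain ⟨θ, hθ, hθ1⟩ := exists_between h.attracting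
  obtain ⟨r₂, hr₂, hr₂'⟩ := Metric.eventually_nhds_iff.1
    (h.continuous_deriv.continuousAt.eventually (gt_mem_nhds hθ))
  obtain ⟨ρ, hρ, hρ'⟩ := exists_between (show 0 < min (min r₁ r₂) (min (δ / 3) 1) by positivity)
  simp only [lt_min_iff] at hρ'
  obtain ⟨q, hq, hq'⟩ := intermediate_value_Ioo Real.pi_pos.le h.continuous.continuousOn
    (show Real.pi ∈ Ioo (f₂ 0) (f₂ Real.pi) by
      rw [h.map_zero, h.map_pi]; constructor <;> linarith [Real.pi_pos])
  refine ⟨min (deriv f₂ a) 1, max (deriv f₂ b) 1, ρ, θ, q, h, hδ, hδπ,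
    lt_min (h.deriv_pos a) one_pos, min_le_right _ _, fun t => ?_, fun t => ?_, le_max_right _ _, hρ,
    by linarith, by linarith, fun t ht => ?_, (h.deriv_pos 0).trans hθ, hθ1, fun t ht => ?_,
    hq.1, hq.2, hq'⟩
  · obtain ⟨s, hs, hs'⟩ := hper t
    exact (min_le_left _ _).trans (hs' ▸ ha hs)
  · obtain ⟨s, hs, hs'⟩ := hper t
    exact le_trans (hs' ▸ hb hs) (le_max_left _ _)
  · obtain ⟨y, hy, hy'⟩ := exists_coe_eq_abs (t : Circ)
    rw [← h.deriv_eq_of_coe_eq hy, ← h.deriv_abs, hy']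
    have hle := norm_circ_le_pi (t : Circ)
    rcases lt_or_ge δ ‖(t : Circ)‖ with h1 | h1
    · have := h.expanding ‖(t : Circ)‖ (by rwa [abs_norm]) (by rwa [abs_norm])
      linarith
    · refine (hr₁' ?_).le
      rw [Real.dist_eq, abs_lt]
      constructor <;> linarith
  · refine (hr₂' ?_).le
    rw [Real.dist_eq, sub_zero]
    linarith

/-- The points of the circle whose `f₂`-orbits stay away from the attracting fixed point. -/
def repeller (δ : ℝ) (f₂ : ℝ → ℝ) : Set Circ := {a | ∀ n, δ ≤ ‖(inducedCircleMap f₂)^[n] a‖}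

/-- The two arcs that contain the repeller. -/
def halfArc (δ : ℝ) : Bool → Set Circ
  | true => (↑) '' Icc δ (Real.pi - δ / 3)
  | false => (↑) '' Icc (-(Real.pi - δ / 3)) (-δ)

namespace SecondConsts

variable {δ : ℝ} {f₂ : ℝ → ℝ} {m M ρ θ q : ℝ}

theorem mul_sub_le {c x y : ℝ} (H : SecondConsts δ f₂ m M ρ θ q) (hxy : x ≤ y)
    (h : ∀ t ∈ Icc x y, c ≤ deriv f₂ t) : c * (y - x) ≤ f₂ y - f₂ x :=
  (convex_Icc x y).mul_sub_le_image_sub_of_le_deriv H.map.continuous.continuousOn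
    H.map.differentiable.differentiableOn (fun t ht => h t (interior_subset ht)) x
    (left_mem_Icc.2 hxy) y (right_mem_Icc.2 hxy) hxy

theorem mul_abs_sub_le_of {c x y : ℝ} (H : SecondConsts δ f₂ m M ρ θ q)
    (h : ∀ t ∈ uIcc x y, c ≤ deriv f₂ t) : c * |x - y| ≤ |f₂ x - f₂ y| := by
  wlog hxy : x ≤ y generalizing x y
  · rw [abs_sub_comm x, abs_sub_comm (f₂ x)]
    exact this (by rwa [uIcc_comm]) (le_of_not_ge hxy)
  rw [uIcc_of_le hxy] at h
  have := H.map.strictMono.monotone hxy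
  rw [abs_sub_comm x, abs_sub_comm (f₂ x), abs_of_nonneg (by linarith), abs_of_nonneg (by linarith)]
  exact H.mul_sub_le hxy h

theorem mul_abs_sub_le (H : SecondConsts δ f₂ m M ρ θ q) (x y : ℝ) :
    m * |x - y| ≤ |f₂ x - f₂ y| := H.mul_abs_sub_le_of fun t _ => H.le_deriv t

theorem abs_sub_le_of {c x y : ℝ} (H : SecondConsts δ f₂ m M ρ θ q)
    (h : ∀ t ∈ uIcc x y, deriv f₂ t ≤ c) : |f₂ x - f₂ y| ≤ c * |x - y| := by
  have := (convex_uIcc x y).norm_image_sub_le_of_norm_deriv_le (f := f₂) (C := c)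
    (fun t _ => H.map.differentiable t) (fun t ht => by
      rw [Real.norm_of_nonneg (H.map.deriv_pos t).le]; exact h t ht) right_mem_uIcc left_mem_uIcc
  simpa [Real.norm_eq_abs] using this

theorem abs_sub_le (H : SecondConsts δ f₂ m M ρ θ q) (x y : ℝ) :
    |f₂ x - f₂ y| ≤ M * |x - y| := H.abs_sub_le_of fun t _ => H.deriv_le t

theorem surjective (H : SecondConsts δ f₂ m M ρ θ q) : Function.Surjective f₂ := by
  have hm := H.m_pos
  refine H.map.continuous.surjective ?_ ?_
  · refine tendsto_atTop_mono' _ ?_ (tendsto_id.const_mul_atTop hm)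
    filter_upwards [eventually_ge_atTop 0] with x hx
    have := H.mul_sub_le hx fun t _ => H.le_deriv t
    rw [H.map.map_zero] at this
    simpa using this
  · refine tendsto_atBot_mono' _ ?_ (tendsto_id.const_mul_atBot hm)
    filter_upwards [eventually_le_atBot 0] with x hx
    have := H.mul_sub_le hx fun t _ => H.le_deriv t
    rw [H.map.map_zero] at this
    simp only [id]
    linarith

theorem map_invFun (H : SecondConsts δ f₂ m M ρ θ q) (t : ℝ) : f₂ (Function.invFun f₂ t) = t :=
  Function.rightInverse_invFun H.surjective t

theorem hasDerivAt_invFun (H : SecondConsts δ f₂ m M ρ θ q) (t : ℝ) :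
    HasDerivAt (Function.invFun f₂) (deriv f₂ (Function.invFun f₂ t))⁻¹ t := by
  refine HasDerivAt.of_local_left_inverse ?_ (H.map.differentiable _).hasDerivAt
    (H.map.deriv_pos _).ne' (Eventually.of_forall H.map_invFun)
  refine Continuous.continuousAt ?_
  refine LipschitzWith.continuous (K := ⟨m⁻¹, (inv_pos.2 H.m_pos).le⟩)
    (LipschitzWith.of_dist_le_mul fun x y => ?_)
  have := H.mul_abs_sub_le (Function.invFun f₂ x) (Function.invFun f₂ y)
  rw [H.map_invFun, H.map_invFun] at this
  change |_| ≤ m⁻¹ * |_|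
  rw [inv_mul_eq_div, le_div_iff₀ H.m_pos]
  linarith

theorem circ_coe (H : SecondConsts δ f₂ m M ρ θ q) (t : ℝ) :
    inducedCircleMap f₂ (t : Circ) = ((f₂ t : ℝ) : Circ) :=
  inducedCircleMap_coe (d := 2) (fun t => by rw [H.map.add_period]; push_cast; ring) t

theorem circ_zero (H : SecondConsts δ f₂ m M ρ θ q) : inducedCircleMap f₂ (0 : Circ) = 0 := by
  have := H.circ_coe 0
  rwa [H.map.map_zero, AddCircle.coe_zero] at this

theorem continuous_circ (H : SecondConsts δ f₂ m M ρ θ q) : Continuous (inducedCircleMap f₂) := by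
  have hq : IsOpenQuotientMap ((↑) : ℝ → Circ) :=
    ⟨fun a => ⟨circRep a, coe_circRep a⟩, continuous_coe_circ,
      (AddCircle.isLocalHomeomorph_coe (2 * Real.pi)).isOpenMap⟩
  rw [hq.isQuotientMap.continuous_iff]
  exact (continuous_coe_circ.comp H.map.continuous).congr fun t => (H.circ_coe t).symm

theorem norm_circ (H : SecondConsts δ f₂ m M ρ θ q) {a : Circ} (ha : ‖a‖ ≤ δ) :
    ‖inducedCircleMap f₂ a‖ = f₂ ‖a‖ := by
  obtain ⟨y, rfl, hy⟩ := exists_coe_eq_abs a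
  rw [H.circ_coe, ← hy, ← H.map.abs_map]
  apply norm_coe_of_abs_le
  rw [H.map.abs_map, hy]
  exact (H.map.map_le_self H.δ_pos H.δ_lt (norm_nonneg _) ha).trans (norm_circ_le_pi _)

theorem norm_circ_le (H : SecondConsts δ f₂ m M ρ θ q) {a : Circ} (ha : ‖a‖ ≤ δ) :
    ‖inducedCircleMap f₂ a‖ ≤ ‖a‖ := by
  rw [H.norm_circ ha]
  exact H.map.map_le_self H.δ_pos H.δ_lt (norm_nonneg _) ha

theorem norm_circ_lt (H : SecondConsts δ f₂ m M ρ θ q) {a : Circ} (ha : ‖a‖ < δ) :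
    ‖inducedCircleMap f₂ a‖ < δ := (H.norm_circ_le ha.le).trans_lt ha

theorem norm_circ_iterate_le (H : SecondConsts δ f₂ m M ρ θ q) {a : Circ} (ha : ‖a‖ ≤ δ) (n : ℕ) :
    ‖(inducedCircleMap f₂)^[n] a‖ ≤ ‖a‖ := by
  induction n with
  | zero => rfl
  | succ n ih =>
    rw [Function.iterate_succ_apply']
    exact (H.norm_circ_le (ih.trans ha)).trans ih

theorem norm_circ_iterate (H : SecondConsts δ f₂ m M ρ θ q) {a : Circ} (ha : ‖a‖ ≤ δ) (n : ℕ) :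
    ‖(inducedCircleMap f₂)^[n] a‖ = f₂^[n] ‖a‖ := by
  induction n with
  | zero => rfl
  | succ n ih =>
    rw [Function.iterate_succ_apply', Function.iterate_succ_apply', ← ih]
    exact H.norm_circ ((H.norm_circ_iterate_le ha n).trans ha)

theorem iterate_bounds (H : SecondConsts δ f₂ m M ρ θ q) {r : ℝ} (hr : 0 ≤ r) (hrδ : r ≤ δ)
    (n : ℕ) : 0 ≤ f₂^[n] r ∧ f₂^[n] r ≤ r := by
  induction n with
  | zero => exact ⟨hr, le_rfl⟩
  | succ n ih =>
    rw [Function.iterate_succ_apply']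
    refine ⟨?_, (H.map.map_le_self H.δ_pos H.δ_lt ih.1 (ih.2.trans hrδ)).trans ih.2⟩
    rw [← H.map.map_zero]
    exact H.map.strictMono.monotone ih.1

/-- The iterates decrease to a fixed point in [0, δ), and only 0 is available. -/
theorem tendsto_iterate (H : SecondConsts δ f₂ m M ρ θ q) {r : ℝ} (hr : 0 ≤ r) (hrδ : r < δ) :
    Tendsto (fun n => f₂^[n] r) atTop (𝓝 0) := by
  have hb := H.iterate_bounds hr hrδ.le
  have hanti : Antitone fun n => f₂^[n] r := antitone_nat_of_succ_le fun n => by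
    rw [Function.iterate_succ_apply']
    exact H.map.map_le_self H.δ_pos H.δ_lt (hb n).1 ((hb n).2.trans hrδ.le)
  have hlim := tendsto_atTop_ciInf hanti ⟨0, by rintro _ ⟨n, rfl⟩; exact (hb n).1⟩
  set L := ⨅ n, f₂^[n] r
  have hfix : f₂ L = L := isFixedPt_of_tendsto_iterate hlim H.map.continuous.continuousAt
  have hL0 : 0 ≤ L := ge_of_tendsto' hlim fun n => (hb n).1
  have hLr : L ≤ r := le_of_tendsto' hlim fun n => (hb n).2
  rcases hL0.eq_or_lt with h | h
  · rwa [h]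
  · have := H.map.map_lt_self H.δ_lt h (hLr.trans_lt hrδ)
    linarith

theorem tendsto_circ (H : SecondConsts δ f₂ m M ρ θ q) {a : Circ} {k : ℕ}
    (ha : ‖(inducedCircleMap f₂)^[k] a‖ < δ) :
    Tendsto (fun n => (inducedCircleMap f₂)^[n] a) atTop (𝓝 0) := by
  rw [← tendsto_add_atTop_iff_nat k, tendsto_zero_iff_norm_tendsto_zero]
  refine (H.tendsto_iterate (norm_nonneg _) ha).congr fun n => ?_
  rw [← H.norm_circ_iterate ha.le, ← Function.iterate_add_apply]

theorem surjective_circ (H : SecondConsts δ f₂ m M ρ θ q) :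
    Function.Surjective (inducedCircleMap f₂) := by
  intro b
  obtain ⟨t, ht⟩ := H.surjective (circRep b)
  exact ⟨t, by rw [H.circ_coe, ht, coe_circRep]⟩

theorem isClosed_repeller (H : SecondConsts δ f₂ m M ρ θ q) : IsClosed (repeller δ f₂) := by
  have : repeller δ f₂ = ⋂ n, {a | δ ≤ ‖(inducedCircleMap f₂)^[n] a‖} := by
    ext a; simp [repeller]
  rw [this]
  exact isClosed_iInter fun n =>
    isClosed_le continuous_const (H.continuous_circ.iterate n).norm

theorem map_mem_repeller {a : Circ} (ha : a ∈ repeller δ f₂) :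
    inducedCircleMap f₂ a ∈ repeller δ f₂ := fun n => ha (n + 1)

/-- Backward invariance holds because the arc |t| < δ is forward invariant: a point inside it cannot
have its image outside. -/
theorem mem_repeller_of_map_mem (H : SecondConsts δ f₂ m M ρ θ q) {a : Circ}
    (ha : inducedCircleMap f₂ a ∈ repeller δ f₂) : a ∈ repeller δ f₂ := by
  intro n
  cases n with
  | zero =>
    by_contra! h
    exact absurd (ha 0) (not_le.2 (H.norm_circ_lt h))
  | succ n => exact ha n

theorem iterate_mem_repeller {a : Circ} (ha : a ∈ repeller δ f₂) (n : ℕ) :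
    (inducedCircleMap f₂)^[n] a ∈ repeller δ f₂ :=
  MapsTo.iterate (fun _ h => map_mem_repeller h) n ha

theorem mem_repeller_of_iterate_mem (H : SecondConsts δ f₂ m M ρ θ q) {a : Circ} (n : ℕ)
    (ha : (inducedCircleMap f₂)^[n] a ∈ repeller δ f₂) : a ∈ repeller δ f₂ := by
  induction n with
  | zero => exact ha
  | succ n ih =>
    rw [Function.iterate_succ_apply'] at ha
    exact ih (H.mem_repeller_of_map_mem ha)

theorem zero_notMem_repeller (H : SecondConsts δ f₂ m M ρ θ q) : (0 : Circ) ∉ repeller δ f₂ :=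
  fun h => absurd (h 0) (by simpa using H.δ_pos)

theorem fixed_mem_repeller (H : SecondConsts δ f₂ m M ρ θ q) : (δ : Circ) ∈ repeller δ f₂ := by
  intro n
  have h1 : inducedCircleMap f₂ (δ : Circ) = δ := by
    rw [H.circ_coe, H.map.map_fixed H.δ_pos H.δ_lt]
  have h2 : (inducedCircleMap f₂)^[n] (δ : Circ) = δ := Function.iterate_fixed h1 n
  rw [h2, norm_coe_of_abs_le (by rw [abs_of_pos H.δ_pos]; exact H.δ_lt.le), abs_of_pos H.δ_pos]

/-- Besides |t| < δ, the gap |t| > π - δ/3 must be removed: there |f₂(t)| lies in (2π - δ, 2π], so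
the image falls into the basin of 0. -/
theorem mem_halfArc {a : Circ} (H : SecondConsts δ f₂ m M ρ θ q) (ha : a ∈ repeller δ f₂) :
    a ∈ halfArc δ true ∨ a ∈ halfArc δ false := by
  obtain ⟨y, rfl, hy⟩ := exists_coe_eq_abs a
  have h0 : δ ≤ |y| := hy ▸ ha 0
  have hπ : |y| ≤ Real.pi := hy ▸ norm_circ_le_pi _
  have h1 : |y| ≤ Real.pi - δ / 3 := by
    by_contra! hc
    have h2 := H.map.strictMono hc
    have h3 := H.map.strictMono.monotone hπ
    rw [H.map.map_pi_sub H.δ_pos H.δ_lt] at h2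
    rw [H.map.map_pi] at h3
    have h4 : ‖inducedCircleMap f₂ (y : Circ)‖ < δ := by
      rw [← H.map.abs_map] at h2 h3
      rw [H.circ_coe]
      rcases abs_cases (f₂ y) with h5 | h5
      · have h6 : ((f₂ y : ℝ) : Circ) = ((f₂ y - 2 * Real.pi : ℝ) : Circ) := by
          rw [AddCircle.coe_sub, AddCircle.coe_period, sub_zero]
        rw [h6]
        refine (norm_coe_le_abs _).trans_lt ?_
        rw [abs_lt]
        constructor <;> linarith
      · have h6 : ((f₂ y : ℝ) : Circ) = ((f₂ y + 2 * Real.pi : ℝ) : Circ) := by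
          rw [AddCircle.coe_add, AddCircle.coe_period, add_zero]
        rw [h6]
        refine (norm_coe_le_abs _).trans_lt ?_
        rw [abs_lt]
        constructor <;> linarith
    exact absurd (ha 1) (not_le.2 h4)
  rcases abs_cases y with h2 | h2
  · exact Or.inl ⟨y, ⟨by linarith, by linarith⟩, rfl⟩
  · exact Or.inr ⟨y, ⟨by linarith, by linarith⟩, rfl⟩

theorem le_norm_of_mem_halfArc {a : Circ} (H : SecondConsts δ f₂ m M ρ θ q) {b : Bool}
    (h : a ∈ halfArc δ b) : δ ≤ ‖a‖ := by
  have hδ := H.δ_pos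
  cases b
  · obtain ⟨y, ⟨h1, h2⟩, rfl⟩ := h
    rw [norm_coe_of_abs_le, abs_of_neg (by linarith)]
    · linarith
    · rw [abs_of_neg (by linarith)]; linarith
  · obtain ⟨y, ⟨h1, h2⟩, rfl⟩ := h
    rw [norm_coe_of_abs_le, abs_of_pos (by linarith)]
    · linarith
    · rw [abs_of_pos (by linarith)]; linarith

theorem disjoint_halfArc (H : SecondConsts δ f₂ m M ρ θ q) :
    Disjoint (halfArc δ true) (halfArc δ false) := by
  rw [disjoint_left]
  rintro _ ⟨y, ⟨h1, h2⟩, rfl⟩ ⟨x, ⟨h3, h4⟩, he⟩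
  have hδ := H.δ_pos
  have := eq_of_coe_eq he (by rw [abs_lt]; constructor <;> linarith)
  linarith

theorem isClosed_halfArc (δ : ℝ) (b : Bool) : IsClosed (halfArc δ b) := by
  cases b
  · exact (isCompact_Icc.image continuous_coe_circ).isClosed
  · exact (isCompact_Icc.image continuous_coe_circ).isClosed

/-- Both arcs are mapped onto the complementary arc of the basin of `0`, expanding distances. -/
theorem exists_lift_of_mem_halfArc (H : SecondConsts δ f₂ m M ρ θ q) (b : Bool) :
    ∃ c c' d : ℝ, Icc c c' ⊆ Icc δ (2 * Real.pi - δ) ∧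
      (∀ y : ℝ, ((y + d : ℝ) : Circ) = y) ∧
      (∀ a ∈ halfArc δ b, ∃ x ∈ Icc c c', (x : Circ) = a ∧
        f₂ x - d ∈ Icc δ (2 * Real.pi - δ)) ∧
      (∀ y ∈ Icc δ (2 * Real.pi - δ), ∃ x : ℝ, f₂ x = y + d ∧ (x : Circ) ∈ halfArc δ b) ∧
      (∀ x ∈ Icc c c', 3 / 2 ≤ deriv f₂ x) := by
  have hδ := H.δ_pos
  have e1 := H.map.map_fixed H.δ_pos H.δ_lt
  have e2 := H.map.map_pi_sub H.δ_pos H.δ_lt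
  have hρ := H.ρ_pos
  have hlt := H.map.lt_pi_sub H.δ_pos H.δ_lt
  cases b
  · have e3 : f₂ (Real.pi + δ / 3) = 2 * Real.pi + δ := by
      have := H.map.add_period (-(Real.pi - δ / 3))
      rw [H.map.odd, e2, show -(Real.pi - δ / 3) + 2 * Real.pi = Real.pi + δ / 3 by ring] at this
      linarith
    have e4 : f₂ (2 * Real.pi - δ) = 4 * Real.pi - δ := by
      have := H.map.add_period (-δ)
      rw [H.map.odd, e1, show -δ + 2 * Real.pi = 2 * Real.pi - δ by ring] at this
      linarith
    -- The left arc is represented by its translate by 2π, so that both arcs lie in [δ, 2π - δ],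
    -- where the projection to the circle is injective. Its image under `f₂` is [2π + δ, 4π - δ],
    -- hence the translation d = 2π.
    refine ⟨Real.pi + δ / 3, 2 * Real.pi - δ, 2 * Real.pi, ?_, fun y => ?_, ?_, ?_, ?_⟩
    · exact Icc_subset_Icc (by linarith [Real.pi_pos]) le_rfl
    · rw [AddCircle.coe_add, AddCircle.coe_period, add_zero]
    · rintro _ ⟨y, hy, rfl⟩
      have hy1 : Real.pi + δ / 3 ≤ y + 2 * Real.pi := by linarith [hy.1]
      have hy2 : y + 2 * Real.pi ≤ 2 * Real.pi - δ := by linarith [hy.2]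
      refine ⟨y + 2 * Real.pi, ⟨hy1, hy2⟩, ?_, ?_⟩
      · rw [AddCircle.coe_add, AddCircle.coe_period, add_zero]
      have h1 := H.map.strictMono.monotone hy1
      have h2 := H.map.strictMono.monotone hy2
      rw [e3] at h1
      rw [e4] at h2
      constructor <;> linarith
    · intro y hy
      obtain ⟨x, hx, hx'⟩ := intermediate_value_Icc
        (show Real.pi + δ / 3 ≤ 2 * Real.pi - δ by linarith) H.map.continuous.continuousOn
        (show y + 2 * Real.pi ∈ _ by
          rw [e3, e4]; constructor <;> linarith [hy.1, hy.2])
      refine ⟨x, hx', x - 2 * Real.pi, ⟨by linarith [hx.1], by linarith [hx.2]⟩, ?_⟩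
      rw [AddCircle.coe_sub, AddCircle.coe_period, sub_zero]
    · intro x hx
      apply H.expand
      have : (x : Circ) ∈ halfArc δ false :=
        ⟨x - 2 * Real.pi, ⟨by linarith [hx.1], by linarith [hx.2]⟩, by
          rw [AddCircle.coe_sub, AddCircle.coe_period, sub_zero]⟩
      linarith [H.le_norm_of_mem_halfArc this]
  · refine ⟨δ, Real.pi - δ / 3, 0, ?_, fun y => by rw [add_zero], ?_, ?_, ?_⟩
    · exact Icc_subset_Icc le_rfl (by linarith [Real.pi_pos])
    · rintro _ ⟨y, hy, rfl⟩
      refine ⟨y, hy, rfl, ?_⟩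
      have h1 := H.map.strictMono.monotone hy.1
      have h2 := H.map.strictMono.monotone hy.2
      rw [e1] at h1
      rw [e2] at h2
      constructor <;> linarith
    · intro y hy
      obtain ⟨x, hx, hx'⟩ := intermediate_value_Icc
        (show δ ≤ Real.pi - δ / 3 by linarith) H.map.continuous.continuousOn
        (show y ∈ _ by rw [e1, e2]; exact hy)
      exact ⟨x, by rw [hx', add_zero], x, hx, rfl⟩
    · intro x hx
      apply H.expand
      have : (x : Circ) ∈ halfArc δ true := ⟨x, hx, rfl⟩
      linarith [H.le_norm_of_mem_halfArc this]

theorem eq_of_coe_eq_of_mem_Icc (H : SecondConsts δ f₂ m M ρ θ q) {x y : ℝ}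
    (hx : x ∈ Icc δ (2 * Real.pi - δ)) (hy : y ∈ Icc δ (2 * Real.pi - δ)) (h : (x : Circ) = y) :
    x = y :=
  eq_of_coe_eq h (by
    rw [abs_lt]; constructor <;> linarith [hx.1, hx.2, hy.1, hy.2, H.δ_pos])

/-- The circle map is injective on each of the two arcs. -/
theorem injOn_halfArc (H : SecondConsts δ f₂ m M ρ θ q) (b : Bool) :
    InjOn (inducedCircleMap f₂) (halfArc δ b) := by
  obtain ⟨c, c', d, -, h1, h2, -, -⟩ := H.exists_lift_of_mem_halfArc b
  intro a ha a' ha' he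
  obtain ⟨x, -, rfl, hx'⟩ := h2 a ha
  obtain ⟨y, -, rfl, hy'⟩ := h2 a' ha'
  rw [H.circ_coe, H.circ_coe, ← sub_add_cancel (f₂ x) d, h1, ← sub_add_cancel (f₂ y) d, h1] at he
  have := H.eq_of_coe_eq_of_mem_Icc hx' hy' he
  rw [H.map.strictMono.injective (sub_left_injective this)]

/-- Points of the repeller with the same itinerary coincide. -/
theorem eq_of_itinerary_eq (H : SecondConsts δ f₂ m M ρ θ q) {a a' : Circ} {ω : ℕ → Bool}
    (ha : ∀ n, (inducedCircleMap f₂)^[n] a ∈ halfArc δ (ω n))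
    (ha' : ∀ n, (inducedCircleMap f₂)^[n] a' ∈ halfArc δ (ω n)) : a = a' := by
  -- The points and the itinerary are quantified inside the induction, since the inductive step
  -- applies to their images and to the shifted itinerary.
  have key : ∀ n, ∀ a a' : Circ, ∀ ω : ℕ → Bool,
      (∀ n, (inducedCircleMap f₂)^[n] a ∈ halfArc δ (ω n)) →
      (∀ n, (inducedCircleMap f₂)^[n] a' ∈ halfArc δ (ω n)) →
      ∃ y y' : ℝ, y ∈ Icc δ (2 * Real.pi - δ) ∧ y' ∈ Icc δ (2 * Real.pi - δ) ∧ (y : Circ) = a ∧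
      (y' : Circ) = a' ∧ (3 / 2 : ℝ) ^ n * |y - y'| ≤ 2 * Real.pi := by
    intro n
    induction n with
    | zero =>
      intro a a' ω ha ha'
      obtain ⟨c, c', d, h0, h1, h2, -, h4⟩ := H.exists_lift_of_mem_halfArc (ω 0)
      obtain ⟨x, hx, hxa, -⟩ := h2 a (ha 0)
      obtain ⟨x', hx', hxa', -⟩ := h2 a' (ha' 0)
      refine ⟨x, x', h0 hx, h0 hx', hxa, hxa', ?_⟩
      rw [pow_zero, one_mul, abs_le]
      have h5 := h0 hx
      have h6 := h0 hx'
      have := H.δ_pos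
      constructor <;> linarith [h5.1, h5.2, h6.1, h6.2]
    | succ n ih =>
      intro a a' ω ha ha'
      obtain ⟨c, c', d, h0, h1, h2, -, h4⟩ := H.exists_lift_of_mem_halfArc (ω 0)
      obtain ⟨x, hx, rfl, hxd⟩ := h2 a (ha 0)
      obtain ⟨x', hx', rfl, hxd'⟩ := h2 a' (ha' 0)
      refine ⟨x, x', h0 hx, h0 hx', rfl, rfl, ?_⟩
      obtain ⟨y, y', hy, hy', hya, hya', hle⟩ := ih (inducedCircleMap f₂ x)
        (inducedCircleMap f₂ x') (fun n => ω (n + 1)) (fun n => ha (n + 1)) (fun n => ha' (n + 1))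
      rw [H.circ_coe, ← sub_add_cancel (f₂ _) d, h1] at hya hya'
      rw [H.eq_of_coe_eq_of_mem_Icc hy hxd hya, H.eq_of_coe_eq_of_mem_Icc hy' hxd' hya',
        sub_sub_sub_cancel_right] at hle
      have hexp := H.mul_abs_sub_le_of (c := 3 / 2) (x := x) (y := x') fun t ht =>
        h4 t (ordConnected_Icc.uIcc_subset hx hx' ht)
      calc (3 / 2 : ℝ) ^ (n + 1) * |x - x'| = (3 / 2) ^ n * (3 / 2 * |x - x'|) := by ring
        _ ≤ (3 / 2) ^ n * |f₂ x - f₂ x'| := by gcongr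
        _ ≤ _ := hle
  obtain ⟨c, c', d, h0, h1, h2, -, h4⟩ := H.exists_lift_of_mem_halfArc (ω 0)
  obtain ⟨x, hx, hxa, -⟩ := h2 a (ha 0)
  obtain ⟨x', hx', hxa', -⟩ := h2 a' (ha' 0)
  have hall : ∀ n, (3 / 2 : ℝ) ^ n * |x - x'| ≤ 2 * Real.pi := by
    intro n
    obtain ⟨y, y', hy, hy', hya, hya', hle⟩ := key n a a' ω ha ha'
    rwa [H.eq_of_coe_eq_of_mem_Icc hy (h0 hx) (hya.trans hxa.symm),
      H.eq_of_coe_eq_of_mem_Icc hy' (h0 hx') (hya'.trans hxa'.symm)] at hle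
  have hzero : |x - x'| = 0 := by
    by_contra hne
    have hpos : 0 < |x - x'| := lt_of_le_of_ne (abs_nonneg _) (Ne.symm hne)
    obtain ⟨n, hn⟩ := pow_unbounded_of_one_lt (2 * Real.pi / |x - x'|)
      (show (1 : ℝ) < 3 / 2 by norm_num)
    rw [div_lt_iff₀ hpos] at hn
    linarith [hall n]
  rw [← hxa, ← hxa', sub_eq_zero.1 (abs_eq_zero.1 hzero)]

/-- Every itinerary is realized. -/
theorem exists_itinerary (H : SecondConsts δ f₂ m M ρ θ q) (ω : ℕ → Bool) :
    ∃ a, ∀ n, (inducedCircleMap f₂)^[n] a ∈ halfArc δ (ω n) := by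
  -- Finite words are realized by pulling back through the arcs, starting from the last symbol;
  -- compactness then handles infinite words.
  have hne : ∀ n, ∀ ω : ℕ → Bool,
      ∃ a, ∀ i < n + 1, (inducedCircleMap f₂)^[i] a ∈ halfArc δ (ω i) := by
    have hpre : ∀ b, ∀ y ∈ Icc δ (2 * Real.pi - δ), ∃ a ∈ halfArc δ b,
        inducedCircleMap f₂ a = (y : Circ) := by
      intro b y hy
      obtain ⟨c, c', d, h0, h1, -, h3, -⟩ := H.exists_lift_of_mem_halfArc b
      obtain ⟨x, hx, hx'⟩ := h3 y hy
      exact ⟨x, hx', by rw [H.circ_coe, hx, h1]⟩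
    intro n
    induction n with
    | zero =>
      intro ω
      obtain ⟨a, ha, -⟩ := hpre (ω 0) δ ⟨le_rfl, by linarith [H.δ_lt]⟩
      refine ⟨a, fun i hi => ?_⟩
      obtain rfl : i = 0 := by omega
      exact ha
    | succ n ih =>
      intro ω
      obtain ⟨a, ha⟩ := ih fun n => ω (n + 1)
      obtain ⟨c, c', d, h0, h1, h2, -, -⟩ := H.exists_lift_of_mem_halfArc (ω 1)
      obtain ⟨y, hy, hya, -⟩ := h2 a (ha 0 (by omega))
      obtain ⟨b, hb, hba⟩ := hpre (ω 0) y (h0 hy)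
      refine ⟨b, fun i hi => ?_⟩
      cases i with
      | zero => exact hb
      | succ i =>
        rw [Function.iterate_succ_apply, hba, hya]
        exact ha i (by omega)
  have hcl : ∀ n, IsClosed {a | ∀ i < n + 1, (inducedCircleMap f₂)^[i] a ∈ halfArc δ (ω i)} := by
    intro n
    simp only [ofPred_forall]
    exact isClosed_iInter fun i => isClosed_iInter fun _ =>
      (isClosed_halfArc δ (ω i)).preimage (H.continuous_circ.iterate i)
  obtain ⟨a, ha⟩ := IsCompact.nonempty_iInter_of_sequence_nonempty_isCompact_isClosed
    (fun n => {a | ∀ i < n + 1, (inducedCircleMap f₂)^[i] a ∈ halfArc δ (ω i)})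
    (fun n a ha i hi => ha i (by omega)) (fun n => hne n ω) (hcl 0).isCompact hcl
  exact ⟨a, fun n => mem_iInter.1 ha n n (by omega)⟩

theorem mem_repeller_of_itinerary (H : SecondConsts δ f₂ m M ρ θ q) {a : Circ} {ω : ℕ → Bool}
    (ha : ∀ n, (inducedCircleMap f₂)^[n] a ∈ halfArc δ (ω n)) : a ∈ repeller δ f₂ :=
  fun n => H.le_norm_of_mem_halfArc (ha n)

/-- The repeller is conjugate to the full shift on two symbols. -/
theorem exists_coding (H : SecondConsts δ f₂ m M ρ θ q) :
    ∃ e : repeller δ f₂ ≃ₜ (ℕ → Bool),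
      ∀ a n, (inducedCircleMap f₂)^[n] (a : Circ) ∈ halfArc δ (e a n) := by
  have hex : ∀ a : repeller δ f₂, ∃ ω : ℕ → Bool,
      ∀ n, (inducedCircleMap f₂)^[n] (a : Circ) ∈ halfArc δ (ω n) := by
    intro a
    have : ∀ n, ∃ b, (inducedCircleMap f₂)^[n] (a : Circ) ∈ halfArc δ b := fun n =>
      (H.mem_halfArc (iterate_mem_repeller a.2 n)).elim (fun h => ⟨_, h⟩) fun h => ⟨_, h⟩
    exact ⟨fun n => (this n).choose, fun n => (this n).choose_spec⟩
  choose code hcode using hex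
  choose dec hdec using H.exists_itinerary
  have huniq : ∀ {a : Circ} {b b' : Bool}, a ∈ halfArc δ b → a ∈ halfArc δ b' → b = b' := by
    intro a b b' h h'
    cases b <;> cases b'
    · rfl
    · exact absurd h (disjoint_left.1 H.disjoint_halfArc h')
    · exact absurd h' (disjoint_left.1 H.disjoint_halfArc h)
    · rfl
  let e : repeller δ f₂ ≃ (ℕ → Bool) :=
    { toFun := code
      invFun := fun ω => ⟨dec ω, H.mem_repeller_of_itinerary (hdec ω)⟩
      left_inv := fun a => Subtype.ext (H.eq_of_itinerary_eq (hdec _) (hcode a))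
      right_inv := fun ω => funext fun n => huniq (hcode _ n) (hdec ω n) }
  -- The arcs are disjoint and closed, so each symbol is a locally constant function on the
  -- repeller. A continuous bijection from a compact space to a Hausdorff space is then a
  -- homeomorphism.
  have hcont : Continuous e := by
    refine continuous_pi fun n => ?_
    have hpre : ∀ b, IsClosed ((fun a => e a n) ⁻¹' {b}) := by
      intro b
      have : (fun a => e a n) ⁻¹' {b} =
          (fun a : repeller δ f₂ => (inducedCircleMap f₂)^[n] (a : Circ)) ⁻¹' halfArc δ b := by
        ext a
        constructor
        · rintro rfl
          exact hcode a n
        · exact fun h => huniq (hcode a n) h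
      rw [this]
      exact (isClosed_halfArc δ b).preimage
        ((H.continuous_circ.iterate n).comp continuous_subtype_val)
    rw [continuous_bool_rng true]
    refine ⟨hpre true, ?_⟩
    rw [← isClosed_compl_iff]
    convert hpre false using 1
    ext a
    simp
  have : CompactSpace (repeller δ f₂) := isCompact_iff_compactSpace.1 H.isClosed_repeller.isCompact
  exact ⟨hcont.homeoOfEquivCompactToT2, hcode⟩

/-- Every cylinder that is small in the repeller contains a point with prescribed future. -/
theorem exists_cylinder (H : SecondConsts δ f₂ m M ρ θ q) {a : Circ} (ha : a ∈ repeller δ f₂)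
    {O : Set Circ} (hO : O ∈ 𝓝 a) : ∃ N : ℕ, ∃ ω₀ : ℕ → Bool, ∀ (c : Circ) (ω : ℕ → Bool),
      (∀ n, (inducedCircleMap f₂)^[n] c ∈ halfArc δ (ω n)) → (∀ n < N, ω n = ω₀ n) → c ∈ O := by
  obtain ⟨e, he⟩ := H.exists_coding
  have h1 : (fun ω => (e.symm ω : Circ)) ⁻¹' O ∈ 𝓝 (e ⟨a, ha⟩) := by
    refine (continuous_subtype_val.comp e.symm.continuous).continuousAt.preimage_mem_nhds ?_
    simpa using hO
  rw [nhds_pi, Filter.mem_pi] at h1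
  obtain ⟨I, hI, t, ht, hsub⟩ := h1
  obtain ⟨N, hN⟩ := hI.bddAbove
  refine ⟨N + 1, e ⟨a, ha⟩, fun c ω hc hω => ?_⟩
  have h2 : ω ∈ I.pi t := by
    intro n hn
    rw [hω n (Nat.lt_succ_of_le (hN hn))]
    exact mem_of_mem_nhds (ht n)
  have h3 : (e.symm ω : Circ) = c := by
    refine H.eq_of_itinerary_eq (ω := ω) (fun n => ?_) hc
    have := he (e.symm ω) n
    rwa [e.apply_symm_apply] at this
  exact h3 ▸ hsub h2

/-- A periodic itinerary belongs to a periodic point, by uniqueness of the coded point. -/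
theorem exists_periodic_mem (H : SecondConsts δ f₂ m M ρ θ q) {a : Circ}
    (ha : a ∈ repeller δ f₂) {O : Set Circ} (hO : O ∈ 𝓝 a) :
    ∃ c ∈ repeller δ f₂ ∩ O, ∃ n, 0 < n ∧ (inducedCircleMap f₂)^[n] c = c := by
  obtain ⟨N, ω₀, h⟩ := H.exists_cylinder ha hO
  -- The period is N + 1 instead of N so that it is positive.
  obtain ⟨c, hc⟩ := H.exists_itinerary fun n => ω₀ (n % (N + 1))
  refine ⟨c, ⟨H.mem_repeller_of_itinerary hc, h c _ hc fun n hn => ?_⟩, N + 1, N.succ_pos, ?_⟩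
  · rw [Nat.mod_eq_of_lt (by omega)]
  · refine H.eq_of_itinerary_eq (fun n => ?_) hc
    rw [← Function.iterate_add_apply]
    simpa using hc (n + (N + 1))

/-- Transitivity of the full shift: the word that enters `O` is followed by the word that enters
`O'`. -/
theorem exists_mem_iterate_mem (H : SecondConsts δ f₂ m M ρ θ q) {a b : Circ}
    (ha : a ∈ repeller δ f₂) (hb : b ∈ repeller δ f₂) {O O' : Set Circ} (hO : O ∈ 𝓝 a)
    (hO' : O' ∈ 𝓝 b) : ∃ c ∈ repeller δ f₂ ∩ O, ∃ n, (inducedCircleMap f₂)^[n] c ∈ O' := by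
  obtain ⟨N, ω₀, h⟩ := H.exists_cylinder ha hO
  obtain ⟨N', ω₁, h'⟩ := H.exists_cylinder hb hO'
  obtain ⟨c, hc⟩ := H.exists_itinerary fun n => if n < N then ω₀ n else ω₁ (n - N)
  refine ⟨c, ⟨H.mem_repeller_of_itinerary hc, h c _ hc fun n hn => if_pos hn⟩, N, ?_⟩
  refine h' _ ω₁ (fun n => ?_) fun _ _ => rfl
  rw [← Function.iterate_add_apply]
  simpa using hc (n + N)

/-- Near the complement of the basin, distances are expanded. -/
theorem mul_dist_le (H : SecondConsts δ f₂ m M ρ θ q) {a b : Circ} (ha : δ ≤ ‖a‖)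
    (hab : dist a b ≤ ρ) (hab' : M * dist a b ≤ Real.pi) :
    3 / 2 * dist a b ≤ dist (inducedCircleMap f₂ a) (inducedCircleMap f₂ b) := by
  obtain ⟨x, rfl⟩ : ∃ x : ℝ, (x : Circ) = a := ⟨_, coe_circRep a⟩
  obtain ⟨y, rfl, hy⟩ := exists_coe_eq_abs_sub b x
  rw [dist_comm, abs_sub_comm] at hy
  rw [← hy] at hab hab' ⊢
  have h1 := H.abs_sub_le x y
  rw [H.circ_coe, H.circ_coe, dist_coe_of_abs_le (h1.trans hab')]
  -- The segment between the lifts stays within ρ of a point at distance at least δ from 0, which is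
  -- the region where f₂' ≥ 3/2.
  refine H.mul_abs_sub_le_of fun t ht => H.expand t ?_
  have h2 : dist (x : Circ) (t : Circ) ≤ ρ := by
    refine (dist_coe_le x t).trans (le_trans ?_ hab)
    rw [abs_sub_comm x t, abs_sub_comm x y]
    exact abs_sub_left_of_mem_uIcc ht
  have h3 : ‖(x : Circ)‖ ≤ dist (x : Circ) (t : Circ) + ‖(t : Circ)‖ := by
    rw [dist_eq_norm]; simpa using norm_add_le ((x : Circ) - (t : Circ)) (t : Circ)
  linarith

/-- Expansivity on the repeller. -/
theorem eq_of_forall_dist_le (H : SecondConsts δ f₂ m M ρ θ q) {a b : Circ}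
    (ha : a ∈ repeller δ f₂) {r : ℝ} (hr : r ≤ ρ) (hr' : M * r ≤ Real.pi)
    (h : ∀ n, dist ((inducedCircleMap f₂)^[n] a) ((inducedCircleMap f₂)^[n] b) ≤ r) : a = b := by
  have hM := H.one_le_M
  have key : ∀ n, (3 / 2 : ℝ) ^ n * dist a b ≤
      dist ((inducedCircleMap f₂)^[n] a) ((inducedCircleMap f₂)^[n] b) := by
    intro n
    induction n with
    | zero => simp
    | succ n ih =>
      have h1 := H.mul_dist_le (ha n) ((h n).trans hr)
        ((mul_le_mul_of_nonneg_left (h n) (by linarith)).trans hr')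
      rw [Function.iterate_succ_apply', Function.iterate_succ_apply']
      calc (3 / 2 : ℝ) ^ (n + 1) * dist a b = 3 / 2 * ((3 / 2) ^ n * dist a b) := by ring
        _ ≤ 3 / 2 * _ := by gcongr
        _ ≤ _ := h1
  by_contra hne
  have hpos : 0 < dist a b := dist_pos.2 hne
  obtain ⟨n, hn⟩ := pow_unbounded_of_one_lt (r / dist a b) (show (1 : ℝ) < 3 / 2 by norm_num)
  rw [div_lt_iff₀ hpos] at hn
  linarith [key n, h n]

/-- Closed balls of radius at most δ around 0 are forward invariant; they show that 0 is the only
nonwandering point attracted by 0. -/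
theorem zero_basis (H : SecondConsts δ f₂ m M ρ θ q) {O : Set Circ} (hO : O ∈ 𝓝 0) :
    ∃ W ∈ 𝓝 (0 : Circ), IsClosed W ∧ MapsTo (inducedCircleMap f₂) W W ∧ W ⊆ O := by
  obtain ⟨r, hr, hrO⟩ := Metric.nhds_basis_closedBall.mem_iff.1 hO
  have hδ := H.δ_pos
  refine ⟨Metric.closedBall 0 (min r δ), Metric.closedBall_mem_nhds _ (lt_min hr hδ),
    Metric.isClosed_closedBall, fun a ha => ?_,
    (Metric.closedBall_subset_closedBall (min_le_left _ _)).trans hrO⟩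
  rw [mem_closedBall_zero_iff] at ha ⊢
  exact (H.norm_circ_le (ha.trans (min_le_right _ _))).trans ha

/-- The nonwandering set of the circle map. -/
theorem nonwanderingSet_circ (H : SecondConsts δ f₂ m M ρ θ q) :
    nonwanderingSet (inducedCircleMap f₂) \ {0} = repeller δ f₂ := by
  ext a
  constructor
  · rintro ⟨ha, ha0⟩
    by_contra hn
    simp only [repeller, mem_ofPred_eq, not_forall, not_le] at hn
    obtain ⟨k, hk⟩ := hn
    exact ha0 (eq_of_mem_nonwanderingSet_of_tendsto H.continuous_circ ha
      (fun O hO => H.zero_basis hO) (H.tendsto_circ hk))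
  · intro ha
    refine ⟨?_, fun h => H.zero_notMem_repeller (h ▸ ha)⟩
    rw [← (isClosed_nonwanderingSet _).closure_eq, mem_closure_iff_nhds]
    intro O hO
    obtain ⟨c, hc, n, hn, hcn⟩ := H.exists_periodic_mem ha hO
    exact ⟨c, hc.2, mem_nonwanderingSet_of_mem_periodicPts ⟨n, hn, hcn⟩⟩

/-- Every point of the circle has exactly two preimages. -/
theorem exists_preimages (H : SecondConsts δ f₂ m M ρ θ q) (b : Circ) :
    ∃ a₁ a₂, a₁ ≠ a₂ ∧ ∀ a, inducedCircleMap f₂ a = b ↔ a = a₁ ∨ a = a₂ := by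
  obtain ⟨y, rfl⟩ : ∃ y : ℝ, (y : Circ) = b := ⟨_, coe_circRep b⟩
  obtain ⟨x₁, hx₁⟩ := H.surjective y
  obtain ⟨x₂, hx₂⟩ := H.surjective (y + 2 * Real.pi)
  -- The two preimages are those of y and y + 2π on the line. Degree two doubles translations, so
  -- the parity of the integer relating the images tells the preimages apart.
  refine ⟨x₁, x₂, fun h => ?_, fun a => ⟨fun h => ?_, ?_⟩⟩
  · obtain ⟨n, rfl⟩ := exists_int_of_coe_eq h
    rw [H.map.map_add_int, hx₂] at hx₁
    have : (1 + 2 * n : ℤ) * (2 * Real.pi) = 0 := by push_cast at *; linarith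
    rcases mul_eq_zero.1 this with h | h
    · have : (1 + 2 * n : ℤ) = 0 := by exact_mod_cast h
      omega
    · exact Real.two_pi_pos.ne' h
  · obtain ⟨x, rfl⟩ : ∃ x : ℝ, (x : Circ) = a := ⟨_, coe_circRep a⟩
    rw [H.circ_coe] at h
    obtain ⟨n, hn⟩ := exists_int_of_coe_eq h
    obtain ⟨k, rfl | rfl⟩ := n.even_or_odd'
    · left
      rw [← hx₁, ← H.map.map_add_int] at hn
      rw [H.map.strictMono.injective hn, coe_add_int_mul]
    · right
      have : f₂ x = f₂ (x₂ + k * (2 * Real.pi)) := by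
        rw [hn, H.map.map_add_int, hx₂]; push_cast; ring
      rw [H.map.strictMono.injective this, coe_add_int_mul]
  · rintro (rfl | rfl)
    · rw [H.circ_coe, hx₁]
    · rw [H.circ_coe, hx₂, AddCircle.coe_add, AddCircle.coe_period, add_zero]

end SecondConsts

theorem norm_eq_pi_iff {a : Circ} : ‖a‖ = Real.pi ↔ a = (Real.pi : ℝ) := by
  constructor
  · intro h
    obtain ⟨y, rfl, hy⟩ := exists_coe_eq_abs a
    rw [h] at hy
    rcases abs_choice y with h1 | h1
    · rw [← h1, hy]
    · rw [show y = Real.pi + (-1 : ℤ) * (2 * Real.pi) by push_cast; linarith, coe_add_int_mul]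
  · rintro rfl
    rw [norm_coe_of_abs_le (abs_of_pos Real.pi_pos).le, abs_of_pos Real.pi_pos]

theorem norm_lt_pi {a : Circ} (h : a ≠ (Real.pi : ℝ)) : ‖a‖ < Real.pi :=
  lt_of_le_of_ne (norm_circ_le_pi a) fun h' => h (norm_eq_pi_iff.1 h')

/-! ### The parameters; fibre maps and preimages -/

/-- The standing assumptions on the parameters of Przytycki's map: `ε` is small with respect to
`s₀` and `η`, and `lam` is small with respect to `ε`, `s₀` and `f₂`. -/
structure Params (δ s₀ η ε lam : ℝ) (f₁ f₂ φ : ℝ → ℝ) (m M ρ θ q : ℝ) : Prop where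
  H : SecondConsts δ f₂ m M ρ θ q
  h₁ : IsFirstMap s₀ η lam f₁
  hφ : IsBump s₀ ε φ
  deriv_lt : ∀ s, |deriv φ s| < |deriv f₁ s|
  s₀_pos : 0 < s₀
  η_pos : 0 < η
  ε_pos : 0 < ε
  ε_lt_s₀ : 2 * ε < s₀
  ε_le_η : 2 * ε ≤ η
  ε_lt : 2 * ε < 1
  lam_pos : 0 < lam
  lam_le : 4 * lam ≤ 1
  lam_mul_s₀ : lam * s₀ ≤ ε
  lam_le_m : 4 * lam ≤ m
  lam_lt_sin : ∀ t ∈ Icc δ (Real.pi - δ / 3), 2 * lam < Real.sin t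
  lam_le_ρ : 8 * lam ≤ ρ
  lam_mul_M : M * (16 * lam) ≤ 1
  lam_small : 1000 * lam ≤ (1 - θ) * m * Real.sin q

theorem IsFirstMap.map_zero {s₀ η lam : ℝ} {f₁ : ℝ → ℝ} (h : IsFirstMap s₀ η lam f₁) :
    f₁ 0 = 0 := by
  have := h.odd 0
  rw [neg_zero] at this
  linarith

theorem IsFirstMap.map_pi {s₀ η lam : ℝ} {f₁ : ℝ → ℝ} (h : IsFirstMap s₀ η lam f₁) :
    f₁ Real.pi = Real.pi := by
  have h1 := h.add_period (-Real.pi)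
  rw [h.odd, show -Real.pi + 2 * Real.pi = Real.pi by ring] at h1
  linarith

theorem IsFirstMap.strictMono {s₀ η lam : ℝ} {f₁ : ℝ → ℝ} (h : IsFirstMap s₀ η lam f₁) :
    StrictMono f₁ := strictMono_of_deriv_pos h.deriv_pos

theorem IsFirstMap.abs_map {s₀ η lam : ℝ} {f₁ : ℝ → ℝ} (h : IsFirstMap s₀ η lam f₁) (s : ℝ) :
    |f₁ s| = f₁ |s| := by
  have h0 := h.map_zero
  rcases le_total 0 s with hs | hs
  · have := h.strictMono.monotone hs
    rw [abs_of_nonneg hs, abs_of_nonneg (by linarith)]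
  · have := h.strictMono.monotone hs
    rw [abs_of_nonpos hs, h.odd, abs_of_nonpos (by linarith)]

namespace Params

variable {δ s₀ η ε lam : ℝ} {f₁ f₂ φ : ℝ → ℝ} {m M ρ θ q : ℝ}

/-- Przytycki's map with the given parameters. -/
noncomputable def map (P : Params δ s₀ η ε lam f₁ f₂ φ m M ρ θ q) : TorusEndo :=
  przytyckiMap P.h₁ P.H.map P.hφ

theorem map_proj (P : Params δ s₀ η ε lam f₁ f₂ φ m M ρ θ q) (x y : ℝ) :
    P.map ((x : Circ), (y : Circ)) =
      (((f₁ x + Real.sin y * φ x : ℝ) : Circ), ((f₂ y : ℝ) : Circ)) :=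
  P.map.toFun_torusProj (x, y)

theorem map_snd (P : Params δ s₀ η ε lam f₁ f₂ φ m M ρ θ q) (z : T2) :
    (P.map z).2 = inducedCircleMap f₂ z.2 := rfl

theorem iterate_snd (P : Params δ s₀ η ε lam f₁ f₂ φ m M ρ θ q) (n : ℕ) (z : T2) :
    (P.map.toFun^[n] z).2 = (inducedCircleMap f₂)^[n] z.2 :=
  (Function.Semiconj.iterate_right (f := Prod.snd) (ga := P.map.toFun) (gb := inducedCircleMap f₂)
    (fun z => P.map_snd z) n) z

theorem differentiable_f₁ (P : Params δ s₀ η ε lam f₁ f₂ φ m M ρ θ q) : Differentiable ℝ f₁ :=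
  P.h₁.contDiff.differentiable one_ne_zero

theorem differentiable_φ (P : Params δ s₀ η ε lam f₁ f₂ φ m M ρ θ q) : Differentiable ℝ φ :=
  P.hφ.contDiff.differentiable one_ne_zero

theorem abs_sin_mul_φ_le (P : Params δ s₀ η ε lam f₁ f₂ φ m M ρ θ q) (x y : ℝ) :
    |Real.sin y * φ x| ≤ ε := by
  rw [abs_mul, abs_of_nonneg (P.hφ.nonneg x)]
  calc |Real.sin y| * φ x ≤ 1 * ε :=
        mul_le_mul (Real.abs_sin_le_one y) (P.hφ.le x) (P.hφ.nonneg x) zero_le_one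
    _ = ε := one_mul ε

theorem hasDerivAt_fibre (P : Params δ s₀ η ε lam f₁ f₂ φ m M ρ θ q) (x y : ℝ) :
    HasDerivAt (fun x => f₁ x + Real.sin y * φ x) (deriv f₁ x + Real.sin y * deriv φ x) x :=
  (P.differentiable_f₁ x).hasDerivAt.add ((P.differentiable_φ x).hasDerivAt.const_mul _)

/-- This is where |φ'| < |f₁'| enters: it keeps every fibre map strictly increasing, which gives
both the preimage count and the absence of critical points. -/
theorem fibre_deriv_pos (P : Params δ s₀ η ε lam f₁ f₂ φ m M ρ θ q) (x y : ℝ) :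
    0 < deriv f₁ x + Real.sin y * deriv φ x := by
  have h1 := P.deriv_lt x
  rw [abs_of_pos (P.h₁.deriv_pos x)] at h1
  have h2 : |Real.sin y * deriv φ x| ≤ |deriv φ x| := by
    rw [abs_mul]
    exact mul_le_of_le_one_left (abs_nonneg _) (Real.abs_sin_le_one y)
  linarith [neg_abs_le (Real.sin y * deriv φ x)]

theorem fibre_strictMono (P : Params δ s₀ η ε lam f₁ f₂ φ m M ρ θ q) (y : ℝ) :
    StrictMono fun x => f₁ x + Real.sin y * φ x :=
  strictMono_of_deriv_pos fun x => by
    rw [(P.hasDerivAt_fibre x y).deriv]; exact P.fibre_deriv_pos x y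

theorem fibre_add_int (P : Params δ s₀ η ε lam f₁ f₂ φ m M ρ θ q) (y x : ℝ) (n : ℤ) :
    f₁ (x + n * (2 * Real.pi)) + Real.sin y * φ (x + n * (2 * Real.pi)) =
      f₁ x + Real.sin y * φ x + n * (2 * Real.pi) :=
  map_add_int_mul (g := fun x => f₁ x + Real.sin y * φ x)
    (fun s => by simp only [P.h₁.add_period, P.hφ.add_period]; ring) n x

theorem fibre_surjective (P : Params δ s₀ η ε lam f₁ f₂ φ m M ρ θ q) (y : ℝ) :
    Function.Surjective fun x => f₁ x + Real.sin y * φ x := by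
  intro b
  have hc : Continuous fun x => f₁ x + Real.sin y * φ x :=
    P.differentiable_f₁.continuous.add (continuous_const.mul P.differentiable_φ.continuous)
  have e : ∀ n : ℤ, f₁ (n * (2 * Real.pi)) + Real.sin y * φ (n * (2 * Real.pi)) =
      f₁ 0 + Real.sin y * φ 0 + n * (2 * Real.pi) := by
    intro n
    have := P.fibre_add_int y 0 n
    rwa [zero_add] at this
  set c := f₁ 0 + Real.sin y * φ 0
  set n : ℤ := ⌊(b - c) / (2 * Real.pi)⌋
  have h1 := Int.floor_le ((b - c) / (2 * Real.pi))
  have h2 := (Int.lt_floor_add_one ((b - c) / (2 * Real.pi))).le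
  rw [le_div_iff₀ Real.two_pi_pos] at h1
  rw [div_le_iff₀ Real.two_pi_pos] at h2
  have e1 := e n
  have e2 := e (n + 1)
  push_cast at e2
  have hle : (n : ℝ) * (2 * Real.pi) ≤ (n + 1) * (2 * Real.pi) := by nlinarith [Real.two_pi_pos]
  obtain ⟨x, -, hx⟩ := intermediate_value_Icc hle hc.continuousOn
    (show b ∈ Icc _ _ from ⟨by rw [e1]; linarith, by rw [e2]; linarith⟩)
  exact ⟨x, hx⟩

/-- The map is injective on the circles `{t = const}`. -/
theorem eq_of_map_eq (P : Params δ s₀ η ε lam f₁ f₂ φ m M ρ θ q) {z w : T2} (h2 : z.2 = w.2)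
    (h : P.map z = P.map w) : z = w := by
  obtain ⟨⟨x, y⟩, rfl⟩ := surjective_torusProj z
  obtain ⟨⟨x', y'⟩, rfl⟩ := surjective_torusProj w
  have h2' : (y : Circ) = (y' : Circ) := h2
  change P.map ((x : Circ), (y : Circ)) = P.map ((x' : Circ), (y' : Circ)) at h
  rw [← h2', P.map_proj, P.map_proj] at h
  obtain ⟨n, hn⟩ := exists_int_of_coe_eq (congrArg Prod.fst h)
  rw [← P.fibre_add_int] at hn
  have := (P.fibre_strictMono y).injective hn
  refine Prod.ext ?_ h2'
  change (x : Circ) = x'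
  rw [this, coe_add_int_mul]

theorem exists_map_fst_eq (P : Params δ s₀ η ε lam f₁ f₂ φ m M ρ θ q) (b : Circ) (t : Circ) :
    ∃ a, (P.map (a, t)).1 = b := by
  obtain ⟨y, rfl⟩ : ∃ y : ℝ, (y : Circ) = t := ⟨_, coe_circRep t⟩
  obtain ⟨x, hx⟩ := P.fibre_surjective y (circRep b)
  refine ⟨x, ?_⟩
  rw [P.map_proj]
  simp only at hx
  rw [hx, coe_circRep]

/-- Fibre maps are bijections of the circle, so preimages correspond to those of the base map of
degree two. -/
theorem exists_preimages (P : Params δ s₀ η ε lam f₁ f₂ φ m M ρ θ q) (z : T2) :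
    ∃ w₁ w₂, w₁ ≠ w₂ ∧ ∀ w, P.map w = z ↔ w = w₁ ∨ w = w₂ := by
  obtain ⟨t₁, t₂, hne, ht⟩ := P.H.exists_preimages z.2
  obtain ⟨a₁, ha₁⟩ := P.exists_map_fst_eq z.1 t₁
  obtain ⟨a₂, ha₂⟩ := P.exists_map_fst_eq z.1 t₂
  have e₁ : P.map (a₁, t₁) = z := Prod.ext ha₁ ((ht t₁).2 (Or.inl rfl))
  have e₂ : P.map (a₂, t₂) = z := Prod.ext ha₂ ((ht t₂).2 (Or.inr rfl))
  refine ⟨(a₁, t₁), (a₂, t₂), fun h => hne (congrArg Prod.snd h), fun w => ⟨fun h => ?_, ?_⟩⟩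
  · rcases (ht w.2).1 (by rw [← P.map_snd, h]) with h2 | h2
    · exact Or.inl (P.eq_of_map_eq h2 (h.trans e₁.symm))
    · exact Or.inr (P.eq_of_map_eq h2 (h.trans e₂.symm))
  · rintro (rfl | rfl)
    · exact e₁
    · exact e₂

theorem ncard_preimage (P : Params δ s₀ η ε lam f₁ f₂ φ m M ρ θ q) (z : T2) :
    (P.map.toFun ⁻¹' {z}).ncard = 2 := by
  obtain ⟨w₁, w₂, hne, h⟩ := P.exists_preimages z
  rw [← ncard_pair hne]
  congr 1
  ext w
  exact h w

theorem not_injective (P : Params δ s₀ η ε lam f₁ f₂ φ m M ρ θ q) :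
    ¬ Function.Injective P.map.toFun := by
  intro hi
  obtain ⟨w₁, w₂, hne, h⟩ := P.exists_preimages 0
  exact hne (hi (((h w₁).2 (Or.inl rfl)).trans ((h w₂).2 (Or.inr rfl)).symm))

/-! ### The differential -/

theorem hasFDerivAt_lift (P : Params δ s₀ η ε lam f₁ f₂ φ m M ρ θ q) (x y : ℝ) :
    HasFDerivAt P.map.lift
      (((ContinuousLinearMap.fst ℝ ℝ ℝ).smulRight (deriv f₁ x + Real.sin y * deriv φ x) +
        (ContinuousLinearMap.snd ℝ ℝ ℝ).smulRight (Real.cos y * φ x)).prod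
        ((ContinuousLinearMap.snd ℝ ℝ ℝ).smulRight (deriv f₂ y))) (x, y) := by
  have e1 : HasFDerivAt (fun z : ℝ × ℝ => f₁ z.1) _ (x, y) :=
    HasFDerivAt.comp (x, y) ((P.differentiable_f₁ x).hasDerivAt.hasFDerivAt :) hasFDerivAt_fst
  have e2 : HasFDerivAt (fun z : ℝ × ℝ => φ z.1) _ (x, y) :=
    HasFDerivAt.comp (x, y) ((P.differentiable_φ x).hasDerivAt.hasFDerivAt :) hasFDerivAt_fst
  have e3 : HasFDerivAt (fun z : ℝ × ℝ => Real.sin z.2) _ (x, y) :=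
    HasFDerivAt.comp (g := Real.sin) (x, y) ((Real.hasDerivAt_sin y).hasFDerivAt :) hasFDerivAt_snd
  have e4 : HasFDerivAt (fun z : ℝ × ℝ => f₂ z.2) _ (x, y) :=
    HasFDerivAt.comp (x, y) ((P.H.map.differentiable y).hasDerivAt.hasFDerivAt :) hasFDerivAt_snd
  have e5 := (e1.add (e3.mul e2)).prodMk e4
  refine e5.congr_fderiv ?_
  ext
  all_goals simp
  all_goals ring

theorem diff_one_apply (P : Params δ s₀ η ε lam f₁ f₂ φ m M ρ θ q) (x y : ℝ) (v : ℝ × ℝ) :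
    P.map.diff 1 ((x : Circ), (y : Circ)) v =
      ((deriv f₁ x + Real.sin y * deriv φ x) * v.1 + Real.cos y * φ x * v.2,
        deriv f₂ y * v.2) := by
  have h := P.map.diff_torusProj 1 (x, y)
  rw [Function.iterate_one, (P.hasFDerivAt_lift x y).fderiv] at h
  change P.map.diff 1 (torusProj (x, y)) v = _
  rw [h]
  ext <;> simp <;> ring

/-- The differential is triangular with positive diagonal entries. -/
theorem injective_diff_one (P : Params δ s₀ η ε lam f₁ f₂ φ m M ρ θ q) (z : T2) :
    Function.Injective (P.map.diff 1 z) := by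
  obtain ⟨⟨x, y⟩, rfl⟩ := surjective_torusProj z
  rw [injective_iff_map_eq_zero]
  intro v hv
  change P.map.diff 1 ((x : Circ), (y : Circ)) v = 0 at hv
  rw [P.diff_one_apply] at hv
  have h2 : v.2 = 0 := by
    have := congrArg Prod.snd hv
    exact (mul_eq_zero.1 this).resolve_left (P.H.map.deriv_pos y).ne'
  have h1 := congrArg Prod.fst hv
  simp only [h2, mul_zero, add_zero, Prod.fst_zero] at h1
  exact Prod.ext ((mul_eq_zero.1 h1).resolve_left (P.fibre_deriv_pos x y).ne') h2

theorem injective_diff (P : Params δ s₀ η ε lam f₁ f₂ φ m M ρ θ q) (n : ℕ) (z : T2) :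
    Function.Injective (P.map.diff n z) := by
  induction n with
  | zero =>
    intro v w h
    rwa [TorusEndo.diff_zero_apply, TorusEndo.diff_zero_apply] at h
  | succ n ih =>
    intro v w h
    rw [TorusEndo.diff_succ_apply _ n, TorusEndo.diff_succ_apply _ n] at h
    exact ih (P.injective_diff_one _ h)

theorem bijective_diff (P : Params δ s₀ η ε lam f₁ f₂ φ m M ρ θ q) (n : ℕ) (z : T2) :
    Function.Bijective (P.map.diff n z) :=
  ⟨P.injective_diff n z,
    (LinearMap.injective_iff_surjective (f := (P.map.diff n z).toLinearMap)).1
      (P.injective_diff n z)⟩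

theorem not_isCritical (P : Params δ s₀ η ε lam f₁ f₂ φ m M ρ θ q) (z : T2) :
    ¬ P.map.IsCritical z := fun h => h (P.bijective_diff 1 z)

/-- The inverse function theorem makes the lift, hence f, a local homeomorphism; on the compact
torus this is the same as a covering map. -/
theorem isCoveringMap (P : Params δ s₀ η ε lam f₁ f₂ φ m M ρ θ q) :
    IsCoveringMap P.map.toFun := by
  rw [← isLocalHomeomorph_iff_isCoveringMap]
  have hl : IsLocalHomeomorph P.map.lift := by
    refine IsLocalHomeomorph.mk _ fun x => ?_
    have hb := P.bijective_diff 1 (torusProj x)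
    have hd := P.map.diff_torusProj 1 x
    rw [Function.iterate_one] at hd
    rw [hd] at hb
    let e : (ℝ × ℝ) ≃L[ℝ] (ℝ × ℝ) :=
      (LinearEquiv.ofBijective (fderiv ℝ P.map.lift x).toLinearMap hb).toContinuousLinearEquiv
    have he : HasFDerivAt P.map.lift (e : (ℝ × ℝ) →L[ℝ] (ℝ × ℝ)) x :=
      ((P.map.contDiff.differentiable one_ne_zero) x).hasFDerivAt
    refine ⟨P.map.contDiff.contDiffAt.toOpenPartialHomeomorph _ he one_ne_zero,
      ContDiffAt.mem_toOpenPartialHomeomorph_source _ he one_ne_zero, fun y _ => rfl⟩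
  have hcomp : IsLocalHomeomorph (P.map.toFun ∘ torusProj) := by
    have : P.map.toFun ∘ torusProj = torusProj ∘ P.map.lift :=
      funext fun x => P.map.toFun_torusProj x
    rw [this]
    exact isLocalHomeomorph_torusProj.comp hl
  have h := IsLocalHomeomorphOn.of_comp_right (s := univ) hcomp.isLocalHomeomorphOn
    isLocalHomeomorph_torusProj.isLocalHomeomorphOn
  rw [image_univ, surjective_torusProj.range_eq] at h
  exact isLocalHomeomorph_iff_isLocalHomeomorphOn_univ.2 h

/-! ### The dynamics in the first coordinate -/

/-- The affine normal form on the annulus, from which injectivity on the strip, the unstable graphs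
and the branching relations are computed. -/
theorem map_proj_of_lt (P : Params δ s₀ η ε lam f₁ f₂ φ m M ρ θ q) {x : ℝ} (hx : |x| < s₀) (y : ℝ) :
    P.map ((x : Circ), (y : Circ)) =
      (((lam * x + ε * Real.sin y : ℝ) : Circ), ((f₂ y : ℝ) : Circ)) := by
  rw [P.map_proj, P.h₁.linear x hx.le, P.hφ.eq_eps x hx, mul_comm ε]

theorem diff_one_apply_of_lt (P : Params δ s₀ η ε lam f₁ f₂ φ m M ρ θ q) {x : ℝ} (hx : |x| < s₀)
    (y : ℝ) (v : ℝ × ℝ) : P.map.diff 1 ((x : Circ), (y : Circ)) v =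
      (lam * v.1 + ε * Real.cos y * v.2, deriv f₂ y * v.2) := by
  have hev : ∀ᶠ s in 𝓝 x, |s| < s₀ := (continuous_abs.tendsto x).eventually (gt_mem_nhds hx)
  have e1 : deriv f₁ x = lam := by
    have : f₁ =ᶠ[𝓝 x] fun s => lam * s := by
      filter_upwards [hev] with s hs using P.h₁.linear s hs.le
    rw [this.deriv_eq]
    simp
  have e2 : deriv φ x = 0 := by
    have : φ =ᶠ[𝓝 x] fun _ => ε := by
      filter_upwards [hev] with s hs using P.hφ.eq_eps s hs
    rw [this.deriv_eq, deriv_const]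
  rw [P.diff_one_apply, e1, e2, P.hφ.eq_eps x hx, mul_zero, add_zero, mul_comm ε]

theorem map_pi_fst (P : Params δ s₀ η ε lam f₁ f₂ φ m M ρ θ q) (t : Circ) :
    P.map (((Real.pi : ℝ) : Circ), t) = (((Real.pi : ℝ) : Circ), inducedCircleMap f₂ t) := by
  obtain ⟨y, rfl⟩ : ∃ y : ℝ, (y : Circ) = t := ⟨_, coe_circRep t⟩
  rw [P.map_proj, P.hφ.eq_zero _ (by simpa using P.s₀_pos), P.h₁.map_pi, mul_zero, add_zero,
    P.H.circ_coe]

theorem diff_one_apply_pi (P : Params δ s₀ η ε lam f₁ f₂ φ m M ρ θ q) (y : ℝ) (v : ℝ × ℝ) :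
    P.map.diff 1 (((Real.pi : ℝ) : Circ), (y : Circ)) v =
      (deriv f₁ Real.pi * v.1, deriv f₂ y * v.2) := by
  have hev : ∀ᶠ s in 𝓝 Real.pi, |s - Real.pi| < s₀ := by
    have : Continuous fun s : ℝ => |s - Real.pi| := by fun_prop
    exact (this.tendsto _).eventually (gt_mem_nhds (by simpa using P.s₀_pos))
  have e2 : deriv φ Real.pi = 0 := by
    have : φ =ᶠ[𝓝 Real.pi] fun _ => 0 := by
      filter_upwards [hev] with s hs using P.hφ.eq_zero s hs
    rw [this.deriv_eq, deriv_const]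
  rw [P.diff_one_apply, e2, P.hφ.eq_zero _ hev.self_of_nhds]
  ext <;> simp

theorem map_fst_eq_pi_iff (P : Params δ s₀ η ε lam f₁ f₂ φ m M ρ θ q) (z : T2) :
    (P.map z).1 = ((Real.pi : ℝ) : Circ) ↔ z.1 = ((Real.pi : ℝ) : Circ) := by
  constructor
  · intro h
    have h1 : P.map z = P.map (((Real.pi : ℝ) : Circ), z.2) := by
      rw [P.map_pi_fst]
      exact Prod.ext h (P.map_snd z)
    have h0 : z.2 = (((Real.pi : ℝ) : Circ), z.2).2 := rfl
    exact congrArg Prod.fst (P.eq_of_map_eq h0 h1)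
  · intro h
    have : z = (((Real.pi : ℝ) : Circ), z.2) := Prod.ext h rfl
    rw [this, P.map_pi_fst]

/-- The circle `{s = 0}` has a neighbourhood that is mapped into a much smaller one. -/
theorem norm_map_fst_le (P : Params δ s₀ η ε lam f₁ f₂ φ m M ρ θ q) {z : T2} (hz : ‖z.1‖ < s₀) :
    ‖(P.map z).1‖ ≤ 2 * ε := by
  obtain ⟨a, t⟩ := z
  obtain ⟨x, rfl, hx⟩ := exists_coe_eq_abs a
  obtain ⟨y, rfl⟩ : ∃ y : ℝ, (y : Circ) = t := ⟨_, coe_circRep t⟩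
  simp only at hz
  rw [← hx] at hz
  rw [P.map_proj_of_lt hz]
  refine (norm_coe_le_abs _).trans ((abs_add_le _ _).trans ?_)
  rw [abs_mul, abs_mul, abs_of_pos P.lam_pos, abs_of_pos P.ε_pos]
  have h1 : lam * |x| ≤ lam * s₀ := mul_le_mul_of_nonneg_left hz.le P.lam_pos.le
  have h2 : ε * |Real.sin y| ≤ ε := mul_le_of_le_one_right P.ε_pos.le (Real.abs_sin_le_one y)
  linarith [P.lam_mul_s₀]

/-- For |s| ≤ π - s₀ the drift η beats the perturbation, which is at most ε ≤ η/2. Closer to π the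
perturbation vanishes, and compactness of [s₀, c] makes f₁(s) < s uniform. -/
theorem exists_drift (P : Params δ s₀ η ε lam f₁ f₂ φ m M ρ θ q) {c : ℝ} (hc : c < Real.pi) :
    ∃ κ > 0, ∀ z : T2, s₀ ≤ ‖z.1‖ → ‖z.1‖ ≤ c → ‖(P.map z).1‖ ≤ ‖z.1‖ - κ := by
  have hmin : ∃ κ > 0, ∀ s ∈ Icc s₀ c, f₁ s ≤ s - κ := by
    by_cases hne : (Icc s₀ c).Nonempty
    · obtain ⟨a, ha, hmin⟩ := isCompact_Icc.exists_isMinOn hne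
        (continuous_id.sub P.differentiable_f₁.continuous).continuousOn
      refine ⟨a - f₁ a, sub_pos.2 (P.h₁.lt_self a (P.s₀_pos.trans_le ha.1) (ha.2.trans_lt hc)),
        fun s hs => ?_⟩
      have : a - f₁ a ≤ s - f₁ s := hmin hs
      linarith
    · exact ⟨1, one_pos, fun s hs => absurd ⟨s, hs⟩ hne⟩
  obtain ⟨κ, hκ, h⟩ := hmin
  refine ⟨min κ (η / 2), lt_min hκ (half_pos P.η_pos), ?_⟩
  rintro ⟨a, t⟩ h1 h2
  obtain ⟨x, rfl, hx⟩ := exists_coe_eq_abs a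
  obtain ⟨y, rfl⟩ : ∃ y : ℝ, (y : Circ) = t := ⟨_, coe_circRep t⟩
  simp only at h1 h2 ⊢
  rw [← hx] at h1 h2 ⊢
  rw [P.map_proj]
  by_cases hle : |x| ≤ Real.pi - s₀
  · refine (norm_coe_le_abs _).trans ((abs_add_le _ _).trans ?_)
    rw [P.h₁.abs_map]
    have h3 := P.h₁.drift _ h1 hle
    have h4 := P.abs_sin_mul_φ_le x y
    linarith [min_le_right κ (η / 2), P.ε_le_η]
  · have h5 : φ x = 0 := by
      rcases abs_cases x with h6 | h6
      · exact P.hφ.eq_zero x (by rw [abs_lt]; constructor <;> linarith [P.s₀_pos])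
      · rw [← P.hφ.add_period]
        exact P.hφ.eq_zero _ (by rw [abs_lt]; constructor <;> linarith [P.s₀_pos])
    rw [h5, mul_zero, add_zero]
    refine (norm_coe_le_abs _).trans ?_
    rw [P.h₁.abs_map]
    linarith [h |x| ⟨h1, h2⟩, min_le_left κ (η / 2)]

theorem norm_iterate_fst_le (P : Params δ s₀ η ε lam f₁ f₂ φ m M ρ θ q) {z : T2}
    (hz : ‖z.1‖ ≤ 2 * ε) (n : ℕ) : ‖(P.map.toFun^[n] z).1‖ ≤ 2 * ε := by
  induction n with
  | zero => exact hz
  | succ n ih =>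
    rw [Function.iterate_succ_apply']
    exact P.norm_map_fst_le (ih.trans_lt P.ε_lt_s₀)

/-- With c = ‖z.1‖ < π the drift applies at every step spent outside |s| < s₀, so such steps cannot
go on forever. -/
theorem exists_norm_iterate_lt (P : Params δ s₀ η ε lam f₁ f₂ φ m M ρ θ q) {z : T2}
    (hz : z.1 ≠ ((Real.pi : ℝ) : Circ)) : ∃ n, ‖(P.map.toFun^[n] z).1‖ < s₀ := by
  by_contra! hall
  obtain ⟨κ, hκ, h⟩ := P.exists_drift (norm_lt_pi hz)
  have key : ∀ n : ℕ, ‖(P.map.toFun^[n] z).1‖ ≤ ‖z.1‖ - n * κ := by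
    intro n
    induction n with
    | zero => simp
    | succ n ih =>
      rw [Function.iterate_succ_apply']
      have h0 : (0 : ℝ) ≤ n * κ := by positivity
      have := h _ (hall n) (by linarith)
      push_cast
      linarith
  obtain ⟨n, hn⟩ := exists_nat_gt (‖z.1‖ / κ)
  rw [div_lt_iff₀ hκ] at hn
  linarith [key n, norm_nonneg (P.map.toFun^[n] z).1]

end Params

theorem tendsto_zero_of_le_mul_add {a b : ℕ → ℝ} {c : ℝ} (hc0 : 0 ≤ c) (hc1 : c < 1)
    (ha : ∀ n, 0 ≤ a n) (hb : Tendsto b atTop (𝓝 0)) (h : ∀ n, a (n + 1) ≤ c * a n + b n) :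
    Tendsto a atTop (𝓝 0) := by
  rw [Metric.tendsto_atTop]
  intro r hr
  have hr' : 0 < (1 - c) * (r / 2) := mul_pos (by linarith) (by linarith)
  obtain ⟨N, hN⟩ := eventually_atTop.1 (hb.eventually (gt_mem_nhds hr'))
  have key : ∀ k : ℕ, a (N + k) ≤ c ^ k * a N + r / 2 := by
    intro k
    induction k with
    | zero => simp; linarith
    | succ k ih =>
      have h1 := h (N + k)
      have h2 := hN (N + k) (by omega)
      have h3 := mul_le_mul_of_nonneg_left ih hc0
      rw [← add_assoc, pow_succ]
      linarith
  have hlim : Tendsto (fun k : ℕ => c ^ k * a N) atTop (𝓝 0) := by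
    simpa using (tendsto_pow_atTop_nhds_zero_of_lt_one hc0 hc1).mul_const (a N)
  obtain ⟨K, hK⟩ := eventually_atTop.1 (hlim.eventually (gt_mem_nhds (half_pos hr)))
  refine ⟨N + K, fun n hn => ?_⟩
  obtain ⟨j, rfl⟩ := Nat.exists_eq_add_of_le hn
  rw [Real.dist_eq, sub_zero, abs_of_nonneg (ha _), add_assoc]
  linarith [key (K + j), hK (K + j) (by omega)]

/-! ### The four pieces, and the set Γ₀ over the repeller -/

/-- The fixed point that will be attracting. -/
noncomputable def sinkPt : T2 := ((0 : Circ), (0 : Circ))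

/-- The fixed point of saddle type. -/
noncomputable def saddlePt : T2 := (((Real.pi : ℝ) : Circ), (0 : Circ))

/-- The expanding basic piece. -/
noncomputable def expandingPiece (δ : ℝ) (f₂ : ℝ → ℝ) : Set T2 :=
  {((Real.pi : ℝ) : Circ)} ×ˢ repeller δ f₂

/-- The part of the annulus `|s| ≤ 2ε` that lies over the repeller of `f₂`. -/
def strip (δ ε : ℝ) (f₂ : ℝ → ℝ) : Set T2 := {z | ‖z.1‖ ≤ 2 * ε ∧ z.2 ∈ repeller δ f₂}

namespace Params

variable {δ s₀ η ε lam : ℝ} {f₁ f₂ φ : ℝ → ℝ} {m M ρ θ q : ℝ}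

theorem continuous_map (P : Params δ s₀ η ε lam f₁ f₂ φ m M ρ θ q) : Continuous P.map.toFun :=
  P.map.continuous

theorem isClosed_strip (P : Params δ s₀ η ε lam f₁ f₂ φ m M ρ θ q) :
    IsClosed (strip δ ε f₂) :=
  (isClosed_le continuous_fst.norm continuous_const).inter
    (P.H.isClosed_repeller.preimage continuous_snd)

theorem mapsTo_strip (P : Params δ s₀ η ε lam f₁ f₂ φ m M ρ θ q) :
    MapsTo P.map.toFun (strip δ ε f₂) (strip δ ε f₂) := fun z hz =>
  ⟨P.norm_map_fst_le (hz.1.trans_lt P.ε_lt_s₀), P.map_snd z ▸ SecondConsts.map_mem_repeller hz.2⟩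

/-- The lift of a point of the annulus `|s| ≤ 2ε`. -/
theorem exists_lift (P : Params δ s₀ η ε lam f₁ f₂ φ m M ρ θ q) {z : T2} (hz : ‖z.1‖ ≤ 2 * ε) :
    ∃ x y : ℝ, |x| ≤ 2 * ε ∧ |x| < s₀ ∧ z = ((x : Circ), (y : Circ)) ∧ y = circRep z.2 := by
  obtain ⟨x, hx, hx'⟩ := exists_coe_eq_abs z.1
  exact ⟨x, circRep z.2, hx' ▸ hz, (hx' ▸ hz).trans_lt P.ε_lt_s₀,
    Prod.ext hx.symm (coe_circRep _).symm, rfl⟩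

/-- Points of the annulus `|s| ≤ 2ε` over different points with the same image satisfy a relation
on the sines. -/
theorem sin_relation (P : Params δ s₀ η ε lam f₁ f₂ φ m M ρ θ q) {x x' y y' : ℝ}
    (hx : |x| ≤ 2 * ε) (hx' : |x'| ≤ 2 * ε)
    (h : P.map ((x : Circ), (y : Circ)) = P.map ((x' : Circ), (y' : Circ))) :
    lam * x + ε * Real.sin y = lam * x' + ε * Real.sin y' := by
  rw [P.map_proj_of_lt (hx.trans_lt P.ε_lt_s₀), P.map_proj_of_lt (hx'.trans_lt P.ε_lt_s₀)] at h
  refine eq_of_coe_eq (congrArg Prod.fst h) ?_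
  have hb : ∀ x y : ℝ, |x| ≤ 2 * ε → |lam * x + ε * Real.sin y| ≤ 1 := by
    intro x y hx
    refine (abs_add_le _ _).trans ?_
    rw [abs_mul, abs_mul, abs_of_pos P.lam_pos, abs_of_pos P.ε_pos]
    have h1 : ε * |Real.sin y| ≤ ε := mul_le_of_le_one_right P.ε_pos.le (Real.abs_sin_le_one y)
    have h2 : lam * |x| ≤ lam * 1 := by gcongr; exacts [P.lam_pos.le, hx.trans P.ε_lt.le]
    linarith [P.lam_le, P.ε_lt]
  have h1 := hb x y hx
  have h2 := hb x' y' hx'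
  rw [abs_le] at h1 h2
  rw [abs_lt]
  constructor <;> linarith [Real.pi_gt_three]

/-- Over one arc `f₂` is injective and so are the fibre maps. Over different arcs, a common image
would need ε(sin y - sin y') = λ(x' - x) ≤ 4λε, whereas sin y > 2λ and sin y' < -2λ. -/
theorem injOn_strip (P : Params δ s₀ η ε lam f₁ f₂ φ m M ρ θ q) :
    InjOn P.map.toFun (strip δ ε f₂) := by
  have key : ∀ z ∈ strip δ ε f₂, ∀ w ∈ strip δ ε f₂, z.2 ∈ halfArc δ true →
      w.2 ∈ halfArc δ false → P.map z ≠ P.map w := by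
    rintro ⟨a, t⟩ ⟨hz, -⟩ ⟨b, u⟩ ⟨hw, -⟩ ⟨y, hy, hyt⟩ ⟨y', hy', hyu⟩ he
    obtain ⟨x, rfl, hx⟩ := exists_coe_eq_abs a
    obtain ⟨x', rfl, hx'⟩ := exists_coe_eq_abs b
    simp only at hz hw hyt hyu
    subst hyt hyu
    rw [← hx] at hz
    rw [← hx'] at hw
    have h1 := P.sin_relation hz hw he
    have h2 := P.lam_lt_sin y hy
    have h3 := P.lam_lt_sin (-y') ⟨by linarith [hy'.2], by linarith [hy'.1]⟩
    rw [Real.sin_neg] at h3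
    rw [abs_le] at hz hw
    have h4 : lam * (x' - x) ≤ lam * (4 * ε) := by
      gcongr
      · exact P.lam_pos.le
      · linarith
    nlinarith [P.ε_pos]
  intro z hz w hw he
  refine P.eq_of_map_eq ?_ he
  have h2 : inducedCircleMap f₂ z.2 = inducedCircleMap f₂ w.2 := by
    rw [← P.map_snd, ← P.map_snd, he]
  rcases P.H.mem_halfArc hz.2 with hz' | hz' <;> rcases P.H.mem_halfArc hw.2 with hw' | hw'
  · exact P.H.injOn_halfArc _ hz' hw' h2
  · exact absurd he (key z hz w hw hz' hw')
  · exact absurd he.symm (key w hw z hz hw' hz')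
  · exact P.H.injOn_halfArc _ hz' hw' h2

/-- The basic piece of saddle type, a solenoid-like attractor over the repeller of `f₂`. -/
def solenoid (P : Params δ s₀ η ε lam f₁ f₂ φ m M ρ θ q) : Set T2 :=
  ⋂ n : ℕ, P.map.toFun^[n] '' strip δ ε f₂

theorem solenoid_subset (P : Params δ s₀ η ε lam f₁ f₂ φ m M ρ θ q) :
    P.solenoid ⊆ strip δ ε f₂ := fun z hz => by
  simpa using mem_iInter.1 hz 0

theorem isCompact_solenoid (P : Params δ s₀ η ε lam f₁ f₂ φ m M ρ θ q) :
    IsCompact P.solenoid :=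
  (isClosed_iInter fun n =>
    (P.isClosed_strip.isCompact.image (P.continuous_map.iterate n)).isClosed).isCompact

/-- Injectivity lets the image commute with the intersection; the shifted intersection is unchanged
because the images of the strip are nested. -/
theorem image_solenoid (P : Params δ s₀ η ε lam f₁ f₂ φ m M ρ θ q) :
    P.map.toFun '' P.solenoid = P.solenoid := by
  have hsub : ∀ n, P.map.toFun^[n] '' strip δ ε f₂ ⊆ strip δ ε f₂ := fun n =>
    (P.mapsTo_strip.iterate n).image_subset
  have h1 : P.map.toFun '' P.solenoid = ⋂ n : ℕ, P.map.toFun^[n + 1] '' strip δ ε f₂ := by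
    unfold solenoid
    rw [(P.injOn_strip.mono (iUnion_subset hsub)).image_iInter_eq]
    refine iInter_congr fun n => ?_
    rw [Function.iterate_succ', image_comp]
  rw [h1]
  refine Subset.antisymm (subset_iInter fun n => ?_) (subset_iInter fun n => iInter_subset _ _)
  refine (iInter_subset _ n).trans ?_
  rw [Function.iterate_succ, image_comp]
  exact image_mono P.mapsTo_strip.image_subset

theorem mem_solenoid_of_preorbit (P : Params δ s₀ η ε lam f₁ f₂ φ m M ρ θ q) {w : ℕ → T2}
    (hw : IsPreorbit P.map w) (h : ∀ n, w n ∈ strip δ ε f₂) : w 0 ∈ P.solenoid := by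
  have hit : ∀ n, P.map.toFun^[n] (w n) = w 0 := by
    intro n
    induction n with
    | zero => rfl
    | succ n ih => rw [Function.iterate_succ_apply, hw n, ih]
  exact mem_iInter.2 fun n => ⟨w n, h n, hit n⟩

theorem mem_solenoid_of_periodic (P : Params δ s₀ η ε lam f₁ f₂ φ m M ρ θ q) {w : T2}
    (hw : w ∈ strip δ ε f₂) {n : ℕ} (hn : 0 < n) (h : P.map.toFun^[n] w = w) :
    w ∈ P.solenoid := by
  refine mem_iInter.2 fun k => ?_
  have h1 : P.map.toFun^[n * k] w = w :=
    (show Function.IsPeriodicPt P.map.toFun n w from h).mul_const k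
  obtain ⟨j, hj⟩ := Nat.exists_eq_add_of_le (Nat.le_mul_of_pos_left k hn)
  rw [hj, Function.iterate_add_apply] at h1
  refine ⟨P.map.toFun^[j] w, P.mapsTo_strip.iterate j hw, h1⟩

/-- The fibres `{t = const}` are contracted. -/
theorem dist_map_le (P : Params δ s₀ η ε lam f₁ f₂ φ m M ρ θ q) {z w : T2} (hz : ‖z.1‖ ≤ 2 * ε)
    (hw : ‖w.1‖ ≤ 2 * ε) (h : z.2 = w.2) : dist (P.map z) (P.map w) ≤ lam * dist z w := by
  obtain ⟨a, t⟩ := z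
  obtain ⟨b, u⟩ := w
  obtain ⟨x, rfl, hx⟩ := exists_coe_eq_abs a
  obtain ⟨x', rfl, hx'⟩ := exists_coe_eq_abs b
  obtain ⟨y, rfl⟩ : ∃ y : ℝ, (y : Circ) = t := ⟨_, coe_circRep t⟩
  simp only at hz hw h
  subst h
  rw [← hx] at hz
  rw [← hx'] at hw
  rw [P.map_proj_of_lt (hz.trans_lt P.ε_lt_s₀), P.map_proj_of_lt (hw.trans_lt P.ε_lt_s₀),
    Prod.dist_eq, Prod.dist_eq, dist_self, dist_self]
  simp only
  rw [max_eq_left dist_nonneg, max_eq_left dist_nonneg]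
  refine (dist_coe_le _ _).trans ?_
  have hle : |x - x'| ≤ Real.pi := by
    rw [abs_le] at *
    constructor <;> linarith [P.ε_lt, Real.pi_gt_three]
  rw [dist_coe_of_abs_le hle, add_sub_add_right_eq_sub, ← mul_sub, abs_mul, abs_of_pos P.lam_pos]

theorem dist_iterate_le (P : Params δ s₀ η ε lam f₁ f₂ φ m M ρ θ q) {z w : T2}
    (hz : ‖z.1‖ ≤ 2 * ε) (hw : ‖w.1‖ ≤ 2 * ε) (h : z.2 = w.2) (n : ℕ) :
    dist (P.map.toFun^[n] z) (P.map.toFun^[n] w) ≤ lam ^ n * dist z w := by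
  induction n with
  | zero => simp
  | succ n ih =>
    rw [Function.iterate_succ_apply', Function.iterate_succ_apply', pow_succ']
    refine (P.dist_map_le (P.norm_iterate_fst_le hz n) (P.norm_iterate_fst_le hw n) ?_).trans ?_
    · rw [P.iterate_snd, P.iterate_snd, h]
    · rw [mul_assoc]
      exact mul_le_mul_of_nonneg_left ih P.lam_pos.le

theorem lam_lt_one (P : Params δ s₀ η ε lam f₁ f₂ φ m M ρ θ q) : lam < 1 := by
  linarith [P.lam_le, P.lam_pos]

/-- Over a periodic point of the circle map there is a periodic point of `f`. -/
theorem exists_periodic_over (P : Params δ s₀ η ε lam f₁ f₂ φ m M ρ θ q) {c : Circ} {n : ℕ}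
    (hn : 0 < n) (hc : (inducedCircleMap f₂)^[n] c = c) :
    ∃ w : T2, ‖w.1‖ ≤ 2 * ε ∧ w.2 = c ∧ P.map.toFun^[n] w = w := by
  let s : Set T2 := {w | ‖w.1‖ ≤ 2 * ε ∧ w.2 = c}
  have hs : IsClosed s := (isClosed_le continuous_fst.norm continuous_const).inter
    (isClosed_singleton.preimage continuous_snd)
  have hmaps : MapsTo P.map.toFun^[n] s s := fun w hw =>
    ⟨P.norm_iterate_fst_le hw.1 n, by rw [P.iterate_snd, hw.2, hc]⟩
  -- Over a point of period n, the n-th iterate maps the fibre |s| ≤ 2ε into itself and contracts it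
  -- by λⁿ ≤ λ; the wanted periodic point is its fixed point.
  have hcontr : ContractingWith ⟨lam, P.lam_pos.le⟩ (MapsTo.restrict _ s s hmaps) := by
    refine ⟨P.lam_lt_one, LipschitzWith.of_dist_le_mul fun z w => ?_⟩
    refine (P.dist_iterate_le z.2.1 w.2.1 (z.2.2.trans w.2.2.symm) n).trans ?_
    refine mul_le_mul_of_nonneg_right ?_ dist_nonneg
    exact pow_le_of_le_one P.lam_pos.le P.lam_lt_one.le hn.ne'
  obtain ⟨w, hw, hfix, -⟩ := ContractingWith.exists_fixedPoint' hs.isComplete hmaps hcontr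
    (x := ((0 : Circ), c)) ⟨by simpa using P.ε_pos.le, rfl⟩ (edist_ne_top _ _)
  exact ⟨w, hw.1, hw.2, hfix⟩

/-- Every neighbourhood of a point of the solenoid contains the iterated image of a full
strip. -/
theorem exists_strip_subset (P : Params δ s₀ η ε lam f₁ f₂ φ m M ρ θ q) {z : T2}
    (hz : z ∈ P.solenoid) {U : Set T2} (hU : U ∈ 𝓝 z) :
    ∃ k : ℕ, ∃ t ∈ repeller δ f₂, ∃ O ∈ 𝓝 t,
      ∀ w : T2, ‖w.1‖ ≤ 2 * ε → w.2 ∈ O → P.map.toFun^[k] w ∈ U := by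
  obtain ⟨V, hVU, hV, hzV⟩ := mem_nhds_iff.1 hU
  obtain ⟨r, hr, hrV⟩ := Metric.isOpen_iff.1 hV z hzV
  obtain ⟨k, hk⟩ := exists_pow_lt_of_lt_one (show 0 < r / 2 by linarith) P.lam_lt_one
  obtain ⟨y, hy, rfl⟩ := mem_iInter.1 hz k
  -- The k-th iterate shrinks the whole fibre through `y` to within r of z; the tube lemma then
  -- extends this to nearby fibres.
  have hfib : Metric.closedBall (0 : Circ) (2 * ε) ×ˢ {y.2} ⊆ P.map.toFun^[k] ⁻¹' V := by
    rintro w ⟨hw1, hw2⟩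
    rw [mem_closedBall_zero_iff] at hw1
    apply hrV
    rw [Metric.mem_ball]
    refine (P.dist_iterate_le hw1 hy.1 hw2 k).trans_lt ?_
    have hd : dist w y ≤ 2 := by
      rw [Prod.dist_eq, mem_singleton_iff.1 hw2, dist_self, max_eq_left dist_nonneg]
      rw [dist_eq_norm]
      refine (norm_sub_le _ _).trans ?_
      linarith [hy.1, P.ε_lt]
    calc lam ^ k * dist w y ≤ lam ^ k * 2 :=
          mul_le_mul_of_nonneg_left hd (pow_nonneg P.lam_pos.le k)
      _ < r / 2 * 2 := by gcongr
      _ = r := by ring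
  obtain ⟨A, B, -, hB, hA', hB', hAB⟩ := generalized_tube_lemma
    (isCompact_closedBall (0 : Circ) (2 * ε)) (isCompact_singleton (x := y.2))
    (hV.preimage (P.continuous_map.iterate k)) hfib
  refine ⟨k, y.2, hy.2, B, hB.mem_nhds (hB' rfl), fun w hw1 hw2 => hVU ?_⟩
  exact hAB ⟨hA' (mem_closedBall_zero_iff.2 hw1), hw2⟩

theorem iterate_mem_solenoid (P : Params δ s₀ η ε lam f₁ f₂ φ m M ρ θ q) {z : T2}
    (hz : z ∈ P.solenoid) (n : ℕ) : P.map.toFun^[n] z ∈ P.solenoid :=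
  MapsTo.iterate (fun w hw => by rw [← P.image_solenoid]; exact ⟨w, hw, rfl⟩) n hz

theorem exists_periodic_mem_solenoid (P : Params δ s₀ η ε lam f₁ f₂ φ m M ρ θ q) {z : T2}
    (hz : z ∈ P.solenoid) {U : Set T2} (hU : U ∈ 𝓝 z) :
    ∃ w ∈ P.solenoid ∩ U, w ∈ Function.periodicPts P.map.toFun := by
  obtain ⟨k, t, ht, O, hO, h⟩ := P.exists_strip_subset hz hU
  obtain ⟨c, ⟨hcA, hcO⟩, n, hn, hc⟩ := P.H.exists_periodic_mem ht hO
  obtain ⟨w, hw1, rfl, hw⟩ := P.exists_periodic_over hn hc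
  have hws : w ∈ P.solenoid := P.mem_solenoid_of_periodic ⟨hw1, hcA⟩ hn hw
  refine ⟨P.map.toFun^[k] w, ⟨P.iterate_mem_solenoid hws k, h w hw1 hcO⟩, n, hn, ?_⟩
  exact Function.IsPeriodicPt.apply_iterate hw k

/-- Open sets meeting Γ₀ contain iterates of full strips, so it suffices to move one base arc to
another. A periodic base point doing this lifts to a periodic point of Γ₀. -/
theorem isTransitiveOn_solenoid (P : Params δ s₀ η ε lam f₁ f₂ φ m M ρ θ q) :
    IsTransitiveOn P.map.toFun P.solenoid := by
  rintro U V hU hV ⟨z, hzU, hz⟩ ⟨z', hzV, hz'⟩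
  obtain ⟨k, t, ht, O, hO, h⟩ := P.exists_strip_subset hz (hU.mem_nhds hzU)
  obtain ⟨k', t', ht', O', hO', h'⟩ := P.exists_strip_subset hz' (hV.mem_nhds hzV)
  obtain ⟨a, ⟨haA, haO⟩, n, hn⟩ := P.H.exists_mem_iterate_mem ht ht'
    (interior_mem_nhds.2 hO) (interior_mem_nhds.2 hO')
  have hW : interior O ∩ (inducedCircleMap f₂)^[n] ⁻¹' interior O' ∈ 𝓝 a :=
    (isOpen_interior.inter (isOpen_interior.preimage (P.H.continuous_circ.iterate n))).mem_nhds
      ⟨haO, hn⟩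
  obtain ⟨c, ⟨hcA, hcO, hcO'⟩, l, hl, hc⟩ := P.H.exists_periodic_mem haA hW
  obtain ⟨w, hw1, rfl, hw⟩ := P.exists_periodic_over hl hc
  have hws : w ∈ P.solenoid := P.mem_solenoid_of_periodic ⟨hw1, hcA⟩ hl hw
  have h1 : P.map.toFun^[l * k] w = w :=
    (show Function.IsPeriodicPt P.map.toFun l w from hw).mul_const k
  obtain ⟨j, hj⟩ := Nat.exists_eq_add_of_le (Nat.le_mul_of_pos_left k hl)
  -- Here j = l * k - k completes a multiple of the period: from the k-th iterate of `w` the orbit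
  -- first returns to `w`, and then takes the n + k' steps leading to `V`.
  refine ⟨k' + (n + j), _, ⟨P.map.toFun^[k] w, ⟨h w hw1 (interior_subset hcO),
    P.iterate_mem_solenoid hws k⟩, rfl⟩, ?_⟩
  have h2 : P.map.toFun^[k' + (n + j)] (P.map.toFun^[k] w) =
      P.map.toFun^[k'] (P.map.toFun^[n] w) := by
    rw [← Function.iterate_add_apply, show k' + (n + j) + k = k' + n + l * k by rw [hj]; ring,
      Function.iterate_add_apply, h1, Function.iterate_add_apply]
  rw [h2]
  refine h' _ (P.norm_iterate_fst_le hw1 n) ?_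
  rw [P.iterate_snd]
  exact interior_subset hcO'

theorem solenoid_nonempty (P : Params δ s₀ η ε lam f₁ f₂ φ m M ρ θ q) : P.solenoid.Nonempty := by
  have hδ := P.H.fixed_mem_repeller
  have h1 : inducedCircleMap f₂ (δ : Circ) = δ := by
    rw [P.H.circ_coe, P.H.map.map_fixed P.H.δ_pos P.H.δ_lt]
  obtain ⟨w, hw1, hw2, hw⟩ := P.exists_periodic_over one_pos (c := (δ : Circ)) h1
  exact ⟨w, P.mem_solenoid_of_periodic ⟨hw1, hw2 ▸ hδ⟩ one_pos hw⟩

/-! ### The sink -/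

theorem map_sinkPt (P : Params δ s₀ η ε lam f₁ f₂ φ m M ρ θ q) : P.map sinkPt = sinkPt := by
  have := P.map_proj_of_lt (x := 0) (by simpa using P.s₀_pos) 0
  simpa [sinkPt, P.H.map.map_zero] using this

theorem map_saddlePt (P : Params δ s₀ η ε lam f₁ f₂ φ m M ρ θ q) :
    P.map saddlePt = saddlePt := by
  unfold saddlePt
  rw [P.map_pi_fst, P.H.circ_zero]

/-- The first coordinate is contracted towards a multiple of the second one. -/
theorem norm_map_fst_le_add (P : Params δ s₀ η ε lam f₁ f₂ φ m M ρ θ q) {z : T2}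
    (hz : ‖z.1‖ < s₀) : ‖(P.map z).1‖ ≤ 1 / 4 * ‖z.1‖ + 1 / 2 * ‖z.2‖ := by
  obtain ⟨a, t⟩ := z
  obtain ⟨x, rfl, hx⟩ := exists_coe_eq_abs a
  obtain ⟨y, rfl, hy⟩ := exists_coe_eq_abs t
  simp only at hz ⊢
  rw [← hx] at hz ⊢
  rw [P.map_proj_of_lt hz, ← hy]
  refine (norm_coe_le_abs _).trans ((abs_add_le _ _).trans ?_)
  rw [abs_mul, abs_mul, abs_of_pos P.lam_pos, abs_of_pos P.ε_pos]
  have h1 : |Real.sin y| ≤ |y| := Real.abs_sin_le_abs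
  have h2 := P.lam_le
  have h3 := P.ε_lt
  gcongr <;> linarith

theorem mapsTo_closedBall (P : Params δ s₀ η ε lam f₁ f₂ φ m M ρ θ q) {r : ℝ} (hr : r < s₀)
    (hrδ : r ≤ δ) : MapsTo P.map.toFun (Metric.closedBall sinkPt r) (Metric.closedBall sinkPt r) := by
  intro z hz
  have hs : sinkPt = 0 := rfl
  rw [hs, mem_closedBall_zero_iff, Prod.norm_def, max_le_iff] at hz ⊢
  refine ⟨(P.norm_map_fst_le_add (hz.1.trans_lt hr)).trans ?_, ?_⟩
  · have := hz.1.trans' (norm_nonneg _)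
    linarith [hz.1, hz.2]
  · rw [show (P.map.toFun z).2 = _ from P.map_snd z]
    exact (P.H.norm_circ_le (hz.2.trans hrδ)).trans hz.2

theorem sinkPt_basis (P : Params δ s₀ η ε lam f₁ f₂ φ m M ρ θ q) {O : Set T2}
    (hO : O ∈ 𝓝 sinkPt) : ∃ W ∈ 𝓝 sinkPt, IsClosed W ∧ MapsTo P.map.toFun W W ∧ W ⊆ O := by
  obtain ⟨r, hr, hrO⟩ := Metric.nhds_basis_closedBall.mem_iff.1 hO
  have hδ := P.H.δ_pos
  have hs := P.s₀_pos
  refine ⟨Metric.closedBall sinkPt (min r (min (s₀ / 2) δ)), Metric.closedBall_mem_nhds _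
    (by positivity), Metric.isClosed_closedBall, P.mapsTo_closedBall ?_ ?_,
    (Metric.closedBall_subset_closedBall (min_le_left _ _)).trans hrO⟩
  · exact ((min_le_right _ _).trans (min_le_left _ _)).trans_lt (by linarith)
  · exact (min_le_right _ _).trans (min_le_right _ _)

theorem exists_iterate_circ_lt {t : Circ}
    (ht : t ∉ repeller δ f₂) : ∃ k, ‖(inducedCircleMap f₂)^[k] t‖ < δ := by
  simpa [repeller] using ht

/-- The basin of the sink. -/
theorem tendsto_sinkPt (P : Params δ s₀ η ε lam f₁ f₂ φ m M ρ θ q) {z : T2}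
    (h1 : z.1 ≠ ((Real.pi : ℝ) : Circ)) (h2 : z.2 ∉ repeller δ f₂) :
    Tendsto (fun n => P.map.toFun^[n] z) atTop (𝓝 sinkPt) := by
  obtain ⟨k, hk⟩ := exists_iterate_circ_lt h2
  have ht := P.H.tendsto_circ hk
  obtain ⟨N, hN⟩ := P.exists_norm_iterate_lt h1
  have hlt : ∀ n, ‖(P.map.toFun^[n + N] z).1‖ < s₀ := by
    intro n
    cases n with
    | zero => rwa [zero_add]
    | succ n =>
      rw [show n + 1 + N = n + (1 + N) by ring, Function.iterate_add_apply,
        Function.iterate_add_apply _ 1]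
      exact (P.norm_iterate_fst_le (P.norm_map_fst_le hN) n).trans_lt P.ε_lt_s₀
  have hb : Tendsto (fun n => (P.map.toFun^[n] z).2) atTop (𝓝 (0 : Circ)) :=
    ht.congr fun n => (P.iterate_snd n z).symm
  have ha : Tendsto (fun n => (P.map.toFun^[n] z).1) atTop (𝓝 (0 : Circ)) := by
    rw [← tendsto_add_atTop_iff_nat N, tendsto_zero_iff_norm_tendsto_zero]
    refine tendsto_zero_of_le_mul_add (c := 1 / 4)
      (b := fun n => 1 / 2 * ‖(P.map.toFun^[n + N] z).2‖) (by norm_num) (by norm_num)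
      (fun n => norm_nonneg _) ?_ fun n => ?_
    · have h3 := ((tendsto_add_atTop_iff_nat N).2 ht).norm.const_mul (1 / 2 : ℝ)
      simp only [norm_zero, mul_zero] at h3
      exact h3.congr fun n => by rw [P.iterate_snd]
    · rw [show n + 1 + N = (n + N) + 1 by ring, Function.iterate_succ_apply']
      exact P.norm_map_fst_le_add (hlt n)
  exact ha.prodMk_nhds hb

/-- A ball of radius r goes into the ball of radius max(3r/4, f₂(r)) < r. In the intersection of the
images, t is squeezed to 0 first; the orbits leading there then lie exactly on t = 0, where s
contracts by 1/4. -/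
theorem isAttractingSet_sinkPt (P : Params δ s₀ η ε lam f₁ f₂ φ m M ρ θ q) :
    IsAttractingSet P.map.toFun {sinkPt} := by
  have hδ := P.H.δ_pos
  have hs := P.s₀_pos
  obtain ⟨r, hr, hr'⟩ := exists_between (show 0 < min s₀ δ by positivity)
  rw [lt_min_iff] at hr'
  have hsink : sinkPt = 0 := rfl
  have hb := P.H.iterate_bounds hr.le hr'.2.le
  refine ⟨Metric.ball sinkPt r, Metric.isOpen_ball, by simpa using hr, ?_, ?_⟩
  · have hr2 : f₂ r < r := P.H.map.map_lt_self P.H.δ_lt hr hr'.2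
    have hsub : P.map.toFun '' Metric.ball sinkPt r ⊆
        Metric.closedBall sinkPt (max (3 / 4 * r) (f₂ r)) := by
      rintro _ ⟨z, hz, rfl⟩
      rw [hsink, mem_ball_zero_iff, Prod.norm_def, max_lt_iff] at hz
      rw [hsink, mem_closedBall_zero_iff, Prod.norm_def]
      refine max_le_max ?_ ?_
      · have := P.norm_map_fst_le_add (hz.1.trans hr'.1)
        exact this.trans (by linarith [hz.1, hz.2])
      · rw [show (P.map.toFun z).2 = _ from P.map_snd z, P.H.norm_circ (hz.2.trans hr'.2).le]
        exact P.H.map.strictMono.monotone hz.2.le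
    refine (closure_minimal hsub Metric.isClosed_closedBall).trans
      (Metric.closedBall_subset_ball (max_lt (by linarith) hr2))
  · refine Subset.antisymm (fun z hz => ?_) ?_
    · have hpre : ∀ n, ∃ w : T2, ‖w.1‖ < r ∧ ‖w.2‖ < r ∧ P.map.toFun^[n] w = z := by
        intro n
        obtain ⟨w, hw, hwz⟩ := mem_iInter.1 hz n
        rw [hsink, mem_ball_zero_iff, Prod.norm_def, max_lt_iff] at hw
        exact ⟨w, hw.1, hw.2, hwz⟩
      have hz2 : z.2 = 0 := by
        have hle : ∀ n, ‖z.2‖ ≤ f₂^[n] r := by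
          intro n
          obtain ⟨w, -, hw2, rfl⟩ := hpre n
          rw [P.iterate_snd, P.H.norm_circ_iterate (hw2.trans hr'.2).le]
          exact P.H.map.strictMono.monotone.iterate n hw2.le
        exact norm_le_zero_iff.1 (ge_of_tendsto' (P.H.tendsto_iterate hr.le hr'.2) hle)
      have hz1 : z.1 = 0 := by
        have hle : ∀ n, ‖z.1‖ ≤ (1 / 4) ^ n * r := by
          intro n
          obtain ⟨w, hw1, hw2, rfl⟩ := hpre n
          have hw0 : w.2 = 0 := by
            rw [P.iterate_snd, ← norm_eq_zero, P.H.norm_circ_iterate (hw2.trans hr'.2).le] at hz2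
            have h0 : f₂^[n] 0 = 0 := Function.iterate_fixed P.H.map.map_zero n
            have := (P.H.map.strictMono.iterate n).injective (hz2.trans h0.symm)
            exact norm_eq_zero.1 this
          have hall : ∀ j, (P.map.toFun^[j] w).2 = 0 := by
            intro j
            rw [P.iterate_snd, hw0]
            exact Function.iterate_fixed P.H.circ_zero j
          have key : ∀ j, ‖(P.map.toFun^[j] w).1‖ ≤ (1 / 4) ^ j * r := by
            intro j
            induction j with
            | zero => simpa using hw1.le
            | succ j ih =>
              rw [Function.iterate_succ_apply']
              have h1 : (1 / 4 : ℝ) ^ j * r ≤ r :=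
                mul_le_of_le_one_left hr.le (pow_le_one₀ (by norm_num) (by norm_num))
              have := P.norm_map_fst_le_add (ih.trans_lt (h1.trans_lt hr'.1))
              rw [hall, norm_zero] at this
              rw [pow_succ]
              linarith
          exact key n
        have hlim : Tendsto (fun n : ℕ => (1 / 4 : ℝ) ^ n * r) atTop (𝓝 0) := by
          simpa using (tendsto_pow_atTop_nhds_zero_of_lt_one (by norm_num : (0 : ℝ) ≤ 1 / 4)
            (by norm_num)).mul_const r
        exact norm_le_zero_iff.1 (ge_of_tendsto' hlim hle)
      exact Prod.ext hz1 hz2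
    · rintro _ rfl
      exact mem_iInter.2 fun n => ⟨sinkPt, by simpa using hr,
        Function.iterate_fixed (show P.map.toFun sinkPt = sinkPt from P.map_sinkPt) n⟩

/-! ### The nonwandering set -/

theorem snd_mem_of_mem_Om (P : Params δ s₀ η ε lam f₁ f₂ φ m M ρ θ q) {z : T2}
    (hz : z ∈ P.map.Om) : z.2 = 0 ∨ z.2 ∈ repeller δ f₂ := by
  have h := map_mem_nonwanderingSet_of_semiconj (h := inducedCircleMap f₂) continuous_snd
    (fun z => P.map_snd z) hz
  rw [← P.H.nonwanderingSet_circ]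
  by_cases h0 : z.2 = 0
  · exact Or.inl h0
  · exact Or.inr ⟨h, h0⟩

/-- Each forward image of the annulus |s| ≤ 2ε is closed and forward invariant and absorbs a
neighbourhood of z, so it contains z. The preimage found in the annulus lies over the repeller by
backward invariance. -/
theorem mem_solenoid_of_mem_Om (P : Params δ s₀ η ε lam f₁ f₂ φ m M ρ θ q) {z : T2}
    (hz : z ∈ P.map.Om) (h1 : z.1 ≠ ((Real.pi : ℝ) : Circ)) (h2 : z.2 ∈ repeller δ f₂) :
    z ∈ P.solenoid := by
  obtain ⟨N, hN⟩ := P.exists_norm_iterate_lt h1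
  refine mem_iInter.2 fun n => ?_
  let R : Set T2 := {w | ‖w.1‖ ≤ 2 * ε}
  have hR : IsClosed R := isClosed_le continuous_fst.norm continuous_const
  have hev : ∀ᶠ y in 𝓝 z, P.map.toFun^[n + (1 + N)] y ∈ P.map.toFun^[n] '' R := by
    have hc : Continuous fun y => ‖(P.map.toFun^[N] y).1‖ :=
      (continuous_fst.comp (P.continuous_map.iterate N)).norm
    filter_upwards [(hc.tendsto z).eventually (gt_mem_nhds hN)] with y hy
    rw [Function.iterate_add_apply, Function.iterate_add_apply _ 1]
    exact ⟨_, P.norm_map_fst_le hy, rfl⟩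
  have hmem := mem_of_mem_nonwanderingSet P.continuous_map hz
    (hR.isCompact.image (P.continuous_map.iterate n)).isClosed (by
      rintro _ ⟨w, hw, rfl⟩
      refine ⟨P.map.toFun w, P.norm_iterate_fst_le hw 1, ?_⟩
      rw [← Function.iterate_succ_apply, Function.iterate_succ_apply']) _ hev
  obtain ⟨w, hw, rfl⟩ := hmem
  refine ⟨w, ⟨hw, P.H.mem_repeller_of_iterate_mem n ?_⟩, rfl⟩
  rwa [← P.iterate_snd]

theorem mem_closure_periodicPts (P : Params δ s₀ η ε lam f₁ f₂ φ m M ρ θ q) {z : T2}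
    (hz : z ∈ {sinkPt} ∪ {saddlePt} ∪ expandingPiece δ f₂ ∪ P.solenoid) :
    z ∈ closure (Function.periodicPts P.map.toFun) := by
  rcases hz with ((rfl | rfl) | hz) | hz
  · exact subset_closure ⟨1, one_pos, P.map_sinkPt⟩
  · exact subset_closure ⟨1, one_pos, P.map_saddlePt⟩
  · obtain ⟨a, t⟩ := z
    obtain ⟨rfl : a = _, ht : t ∈ _⟩ := hz
    rw [mem_closure_iff_nhds]
    intro U hU
    have hO : (fun t => (((Real.pi : ℝ) : Circ), t)) ⁻¹' U ∈ 𝓝 t :=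
      (Continuous.prodMk_right _).continuousAt.preimage_mem_nhds hU
    obtain ⟨c, ⟨-, hcU⟩, n, hn, hc⟩ := P.H.exists_periodic_mem ht hO
    refine ⟨_, hcU, n, hn, ?_⟩
    have hsemi := (Function.Semiconj.iterate_right (f := fun t => (((Real.pi : ℝ) : Circ), t))
      (ga := inducedCircleMap f₂) (gb := P.map.toFun) (fun t => (P.map_pi_fst t).symm) n) c
    simp only [hc] at hsemi
    exact hsemi.symm
  · rw [mem_closure_iff_nhds]
    intro U hU
    obtain ⟨w, hw, hp⟩ := P.exists_periodic_mem_solenoid hz hU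
    exact ⟨w, hw.2, hp⟩

/-- A point with s ≠ π lies over the repeller or in the basin of the sink. Conversely, all four
pieces are in the closure of the periodic points. -/
theorem Om_eq (P : Params δ s₀ η ε lam f₁ f₂ φ m M ρ θ q) :
    P.map.Om = {sinkPt} ∪ {saddlePt} ∪ expandingPiece δ f₂ ∪ P.solenoid := by
  refine Subset.antisymm (fun z hz => ?_) fun z hz => ?_
  · by_cases h1 : z.1 = ((Real.pi : ℝ) : Circ)
    · rcases P.snd_mem_of_mem_Om hz with h2 | h2
      · exact Or.inl (Or.inl (Or.inr (Prod.ext h1 h2)))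
      · exact Or.inl (Or.inr ⟨h1, h2⟩)
    · by_cases h2 : z.2 ∈ repeller δ f₂
      · exact Or.inr (P.mem_solenoid_of_mem_Om hz h1 h2)
      · exact Or.inl (Or.inl (Or.inl (eq_of_mem_nonwanderingSet_of_tendsto P.continuous_map hz
          (fun O hO => P.sinkPt_basis hO) (P.tendsto_sinkPt h1 h2))))
  · exact closure_minimal (fun w hw => mem_nonwanderingSet_of_mem_periodicPts hw)
      (isClosed_nonwanderingSet _) (P.mem_closure_periodicPts hz)

/-! ### The basic pieces -/

theorem pi_ne_zero_circ : ((Real.pi : ℝ) : Circ) ≠ 0 := by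
  rw [← norm_ne_zero_iff, norm_eq_pi_iff.2 rfl]
  exact Real.pi_pos.ne'

theorem fst_ne_pi_of_norm_le (P : Params δ s₀ η ε lam f₁ f₂ φ m M ρ θ q) {z : T2}
    (hz : ‖z.1‖ ≤ 2 * ε) : z.1 ≠ ((Real.pi : ℝ) : Circ) := by
  intro h
  rw [norm_eq_pi_iff.2 h] at hz
  linarith [P.ε_lt, Real.pi_gt_three]

theorem sinkPt_ne_saddlePt : sinkPt ≠ saddlePt := fun h =>
  pi_ne_zero_circ (congrArg Prod.fst h).symm

theorem sinkPt_notMem_expandingPiece (f₂ : ℝ → ℝ) : sinkPt ∉ expandingPiece δ f₂ := fun h =>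
  pi_ne_zero_circ (Eq.symm h.1)

theorem saddlePt_notMem_expandingPiece (P : Params δ s₀ η ε lam f₁ f₂ φ m M ρ θ q) :
    saddlePt ∉ expandingPiece δ f₂ := fun h => P.H.zero_notMem_repeller h.2

theorem sinkPt_notMem_solenoid (P : Params δ s₀ η ε lam f₁ f₂ φ m M ρ θ q) :
    sinkPt ∉ P.solenoid := fun h => P.H.zero_notMem_repeller (P.solenoid_subset h).2

theorem saddlePt_notMem_solenoid (P : Params δ s₀ η ε lam f₁ f₂ φ m M ρ θ q) :
    saddlePt ∉ P.solenoid := fun h => P.H.zero_notMem_repeller (P.solenoid_subset h).2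

theorem disjoint_expandingPiece_solenoid (P : Params δ s₀ η ε lam f₁ f₂ φ m M ρ θ q) :
    Disjoint (expandingPiece δ f₂) P.solenoid :=
  disjoint_left.2 fun _ h h' => P.fst_ne_pi_of_norm_le (P.solenoid_subset h').1 h.1

theorem pairwise_disjoint (P : Params δ s₀ η ε lam f₁ f₂ φ m M ρ θ q) :
    [{sinkPt}, {saddlePt}, expandingPiece δ f₂, P.solenoid].Pairwise Disjoint := by
  simp only [List.pairwise_cons, List.mem_cons, List.not_mem_nil, or_false, forall_eq_or_imp,
    forall_eq, disjoint_singleton_left, mem_singleton_iff]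
  exact ⟨⟨sinkPt_ne_saddlePt, sinkPt_notMem_expandingPiece f₂, P.sinkPt_notMem_solenoid⟩,
    ⟨P.saddlePt_notMem_expandingPiece, P.saddlePt_notMem_solenoid⟩,
    P.disjoint_expandingPiece_solenoid, by simp⟩

theorem isClosed_expandingPiece (P : Params δ s₀ η ε lam f₁ f₂ φ m M ρ θ q) :
    IsClosed (expandingPiece δ f₂) := isClosed_singleton.prod P.H.isClosed_repeller

theorem image_expandingPiece (P : Params δ s₀ η ε lam f₁ f₂ φ m M ρ θ q) :
    P.map.toFun '' expandingPiece δ f₂ = expandingPiece δ f₂ := by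
  refine Subset.antisymm ?_ ?_
  · rintro _ ⟨⟨a, t⟩, ⟨rfl : a = _, ht : t ∈ _⟩, rfl⟩
    rw [show P.map.toFun (_, t) = _ from P.map_pi_fst t]
    exact ⟨rfl, SecondConsts.map_mem_repeller ht⟩
  · rintro ⟨a, t⟩ ⟨rfl : a = _, ht : t ∈ _⟩
    obtain ⟨u, rfl⟩ := P.H.surjective_circ t
    exact ⟨(((Real.pi : ℝ) : Circ), u), ⟨rfl, P.H.mem_repeller_of_map_mem ht⟩, P.map_pi_fst u⟩

theorem isTransitiveOn_singleton {X : Type*} [TopologicalSpace X] {g : X → X} {x : X} :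
    IsTransitiveOn g {x} := by
  rintro U V - - ⟨y, hyU, rfl⟩ ⟨y', hyV, rfl⟩
  exact ⟨0, y', ⟨y', ⟨hyU, rfl⟩, rfl⟩, hyV⟩

theorem isTransitiveOn_expandingPiece (P : Params δ s₀ η ε lam f₁ f₂ φ m M ρ θ q) :
    IsTransitiveOn P.map.toFun (expandingPiece δ f₂) := by
  rintro U V hU hV ⟨⟨a, t⟩, hzU, ⟨rfl : a = _, ht : t ∈ _⟩⟩ ⟨⟨b, u⟩, hzV, ⟨rfl : b = _, hu : u ∈ _⟩⟩
  have hc : Continuous fun t : Circ => (((Real.pi : ℝ) : Circ), t) := Continuous.prodMk_right _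
  obtain ⟨c, ⟨hcA, hcU⟩, n, hn⟩ := P.H.exists_mem_iterate_mem ht hu
    ((hU.preimage hc).mem_nhds hzU) ((hV.preimage hc).mem_nhds hzV)
  refine ⟨n, _, ⟨_, ⟨hcU, rfl, hcA⟩, rfl⟩, ?_⟩
  have hsemi := (Function.Semiconj.iterate_right (f := fun t => (((Real.pi : ℝ) : Circ), t))
    (ga := inducedCircleMap f₂) (gb := P.map.toFun) (fun t => (P.map_pi_fst t).symm) n) c
  rw [← hsemi]
  exact hn

theorem isolated_of_pieces {X : Type*} [TopologicalSpace X] {L R Ω : Set X} (hR : IsClosed R)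
    (hd : Disjoint L R) (h : Ω = L ∪ R) : ∃ U : Set X, IsOpen U ∧ U ∩ Ω = L := by
  refine ⟨Rᶜ, hR.isOpen_compl, ?_⟩
  rw [h, inter_union_distrib_left, compl_inter_self, union_empty]
  exact inter_eq_right.2 (disjoint_left.1 hd)

theorem isBasicPiece_sinkPt (P : Params δ s₀ η ε lam f₁ f₂ φ m M ρ θ q) :
    IsBasicPiece P.map.toFun {sinkPt} where
  nonempty := singleton_nonempty _
  isCompact := isCompact_singleton
  image_eq := by rw [image_singleton]; exact congrArg _ P.map_sinkPt
  transitive := isTransitiveOn_singleton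
  subset := by
    change _ ⊆ P.map.Om
    rw [P.Om_eq]; exact fun x hx => Or.inl (Or.inl (Or.inl hx))
  isolated := isolated_of_pieces (R := {saddlePt} ∪ expandingPiece δ f₂ ∪ P.solenoid)
    ((isClosed_singleton.union P.isClosed_expandingPiece).union P.isCompact_solenoid.isClosed)
    (by
      rw [disjoint_singleton_left]
      rintro ((h | h) | h)
      exacts [sinkPt_ne_saddlePt h, sinkPt_notMem_expandingPiece f₂ h, P.sinkPt_notMem_solenoid h])
    (by change P.map.Om = _; rw [P.Om_eq, union_assoc, union_assoc, union_assoc])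

theorem isBasicPiece_saddlePt (P : Params δ s₀ η ε lam f₁ f₂ φ m M ρ θ q) :
    IsBasicPiece P.map.toFun {saddlePt} where
  nonempty := singleton_nonempty _
  isCompact := isCompact_singleton
  image_eq := by rw [image_singleton]; exact congrArg _ P.map_saddlePt
  transitive := isTransitiveOn_singleton
  subset := by
    change _ ⊆ P.map.Om
    rw [P.Om_eq]; exact fun x hx => Or.inl (Or.inl (Or.inr hx))
  isolated := isolated_of_pieces (R := {sinkPt} ∪ expandingPiece δ f₂ ∪ P.solenoid)
    ((isClosed_singleton.union P.isClosed_expandingPiece).union P.isCompact_solenoid.isClosed)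
    (by
      rw [disjoint_singleton_left]
      rintro ((h | h) | h)
      exacts [sinkPt_ne_saddlePt h.symm, P.saddlePt_notMem_expandingPiece h,
        P.saddlePt_notMem_solenoid h])
    (by
      change P.map.Om = _
      rw [P.Om_eq, union_comm {sinkPt} {saddlePt}, union_assoc, union_assoc, union_assoc])

theorem isBasicPiece_expandingPiece (P : Params δ s₀ η ε lam f₁ f₂ φ m M ρ θ q) :
    IsBasicPiece P.map.toFun (expandingPiece δ f₂) where
  nonempty := ⟨(((Real.pi : ℝ) : Circ), (δ : Circ)), mem_prod.2 ⟨mem_singleton _, P.H.fixed_mem_repeller⟩⟩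
  isCompact := P.isClosed_expandingPiece.isCompact
  image_eq := P.image_expandingPiece
  transitive := P.isTransitiveOn_expandingPiece
  subset := by
    change _ ⊆ P.map.Om
    rw [P.Om_eq]; exact fun x hx => Or.inl (Or.inr hx)
  isolated := isolated_of_pieces (R := {sinkPt} ∪ {saddlePt} ∪ P.solenoid)
    ((isClosed_singleton.union isClosed_singleton).union P.isCompact_solenoid.isClosed)
    (by
      rw [disjoint_union_right, disjoint_union_right, disjoint_singleton_right,
        disjoint_singleton_right]
      exact ⟨⟨sinkPt_notMem_expandingPiece f₂, P.saddlePt_notMem_expandingPiece⟩,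
        P.disjoint_expandingPiece_solenoid⟩)
    (by
      change P.map.Om = _
      rw [P.Om_eq, union_right_comm, union_comm])

theorem isBasicPiece_solenoid (P : Params δ s₀ η ε lam f₁ f₂ φ m M ρ θ q) :
    IsBasicPiece P.map.toFun P.solenoid where
  nonempty := P.solenoid_nonempty
  isCompact := P.isCompact_solenoid
  image_eq := P.image_solenoid
  transitive := P.isTransitiveOn_solenoid
  subset := by
    change _ ⊆ P.map.Om
    rw [P.Om_eq]; exact subset_union_right
  isolated := isolated_of_pieces (R := {sinkPt} ∪ {saddlePt} ∪ expandingPiece δ f₂)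
    ((isClosed_singleton.union isClosed_singleton).union P.isClosed_expandingPiece)
    (by
      rw [disjoint_union_right, disjoint_union_right, disjoint_singleton_right,
        disjoint_singleton_right]
      exact ⟨⟨P.sinkPt_notMem_solenoid, P.saddlePt_notMem_solenoid⟩,
        P.disjoint_expandingPiece_solenoid.symm⟩)
    (by
      change P.map.Om = _
      rw [P.Om_eq, union_comm])

end Params

/-! ### Hyperbolic splittings, Axiom A and the set Γ -/

/-- A bounded solution of a contracting affine recurrence. -/
theorem exists_bounded_solution {α β : ℤ → ℝ} {b : ℝ} (hα : ∀ n, |α n| ≤ 1 / 2)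
    (hβ : ∀ n, |β n| ≤ b) :
    ∃ u : ℤ → ℝ, (∀ n, |u n| ≤ 2 * b) ∧ ∀ n, u (n + 1) = α n * u n + β n := by
  -- The contribution at time n of the forcing term j + 1 steps earlier; the solution is the sum
  -- over the whole past.
  set T : ℤ → ℕ → ℝ := fun n j => β (n - 1 - j) * ∏ i ∈ Finset.range j, α (n - 1 - i) with hT
  have hb : 0 ≤ b := (abs_nonneg _).trans (hβ 0)
  have hbound : ∀ n j, ‖T n j‖ ≤ b * (1 / 2) ^ j := by
    intro n j
    rw [hT, norm_mul, norm_prod]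
    refine mul_le_mul (hβ _) ?_ (Finset.prod_nonneg fun _ _ => norm_nonneg _) hb
    calc ∏ i ∈ Finset.range j, ‖α (n - 1 - i)‖ ≤ ∏ _i ∈ Finset.range j, (1 / 2 : ℝ) :=
          Finset.prod_le_prod (fun _ _ => norm_nonneg _) fun _ _ => hα _
      _ = (1 / 2) ^ j := by simp
  have hsum : HasSum (fun j : ℕ => b * (1 / 2 : ℝ) ^ j) (2 * b) := by
    have := hasSum_geometric_two.mul_left b
    rwa [mul_comm b 2] at this
  have hs : ∀ n, Summable (T n) := fun n => Summable.of_norm_bounded hsum.summable (hbound n)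
  refine ⟨fun n => ∑' j, T n j, fun n => tsum_of_norm_bounded hsum (hbound n), fun n => ?_⟩
  change ∑' j, T (n + 1) j = α n * ∑' j, T n j + β n
  rw [(hs (n + 1)).tsum_eq_zero_add, ← tsum_mul_left, add_comm]
  congr 1
  · refine tsum_congr fun j => ?_
    simp only [hT]
    rw [Finset.prod_range_succ']
    have e : ∀ i : ℕ, n + 1 - 1 - ((i + 1 : ℕ) : ℤ) = n - 1 - i := fun i => by push_cast; ring
    simp only [e]
    rw [show n + 1 - 1 - ((0 : ℕ) : ℤ) = n by push_cast; ring]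
    ring
  · simp [hT]

/-- Axiom A and Γ quantify over all basic pieces; this confines an arbitrary transitive set to one
of the four known pieces. -/
theorem IsTransitiveOn.subset_or_subset {X : Type*} [TopologicalSpace X] [NormalSpace X]
    {g : X → X} {L P Q : Set X} (hL : IsTransitiveOn g L) (hP : IsClosed P) (hQ : IsClosed Q)
    (hPQ : Disjoint P Q) (hgP : MapsTo g P P)(h : L ⊆ P ∪ Q) :
    L ⊆ P ∨ L ⊆ Q := by
  obtain ⟨A, B, hA, hB, hPA, hQB, hAB⟩ := normal_separation hP hQ hPQ
  have h1 : Disjoint A Q := hAB.mono_right hQB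
  have h2 : Disjoint B P := hAB.symm.mono_right hPA
  by_cases hz : ∃ z ∈ L, z ∈ P
  · obtain ⟨z, hz, hzP⟩ := hz
    exact Or.inl (hL.subset_of_mem h hgP hA hB hPA hQB h1 h2 hz hzP)
  · exact Or.inr fun z hzL => (h hzL).resolve_left fun hzP => hz ⟨z, hzL, hzP⟩

/-- A trapping neighbourhood of `L` contains a point of the basin of p, hence p itself, and a fixed
point survives in all images. With p the sink, this shows that neither the saddle point nor a piece
inside Γ₀ is attracting. -/
theorem IsAttractingSet.mem_of_tendsto {X : Type*} [TopologicalSpace X] {g : X → X} {L : Set X}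
    (hL : IsAttractingSet g L) {p : X} (hp : g p = p) {z : X} (hz : z ∈ L)
    (h : ∀ O ∈ 𝓝 z, ∃ y ∈ O, Tendsto (fun n => g^[n] y) atTop (𝓝 p)) : p ∈ L := by
  obtain ⟨N, hN, hLN, hcl, hint⟩ := hL
  obtain ⟨y, hy, hyp⟩ := h N (hN.mem_nhds (hLN hz))
  have hmaps : MapsTo g N N := fun x hx => hcl (subset_closure (mem_image_of_mem g hx))
  have hpN : p ∈ N := by
    refine hcl (mem_closure_of_tendsto hyp (eventually_atTop.2 ⟨1, fun n hn => ?_⟩))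
    obtain ⟨k, rfl⟩ := Nat.exists_eq_add_of_le' hn
    rw [Function.iterate_succ_apply']
    exact mem_image_of_mem g (hmaps.iterate k hy)
  rw [← hint]
  exact mem_iInter.2 fun n => ⟨p, hpN, Function.iterate_fixed hp n⟩

namespace TorusEndo

theorem IsFullOrbit.iterate {f : TorusEndo} {x : ℤ → T2} (hx : f.IsFullOrbit x) (n : ℤ) (k : ℕ) :
    f.toFun^[k] (x n) = x (n + k) := by
  induction k with
  | zero => simp
  | succ k ih =>
    rw [Function.iterate_succ_apply', ih]
    have := hx (n + k)
    push_cast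
    rw [← add_assoc]
    exact this

/-- If the orbit visited both forward invariant sets, it would be in both at the later of the two
times. -/
theorem IsFullOrbit.forall_mem_or {f : TorusEndo} {x : ℤ → T2} (hx : f.IsFullOrbit x)
    {A B : Set T2} (hA : MapsTo f.toFun A A) (hB : MapsTo f.toFun B B) (hAB : Disjoint A B)
    (h : ∀ n, x n ∈ A ∪ B) : (∀ n, x n ∈ A) ∨ ∀ n, x n ∈ B := by
  have key : ∀ {C : Set T2}, MapsTo f.toFun C C → ∀ {n m : ℤ}, n ≤ m → x n ∈ C → x m ∈ C := by
    intro C hC n m hnm hn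
    obtain ⟨k, rfl⟩ := Int.le.dest hnm
    rw [← hx.iterate]
    exact hC.iterate k hn
  by_contra! hne
  obtain ⟨⟨n, hn⟩, ⟨k, hk⟩⟩ := hne
  exact disjoint_left.1 hAB (key hA (le_max_right n k) ((h k).resolve_right hk))
    (key hB (le_max_left n k) ((h n).resolve_left hn))

/-- A splitting that is contracted and expanded at every single step. -/
theorem isHyperbolicSplitting_of_step {f : TorusEndo} {x : ℤ → T2} (hx : f.IsFullOrbit x)
    {Es Eu : ℤ → Submodule ℝ (ℝ × ℝ)} {μ : ℝ} (hμ : 0 < μ) (h : ∀ n, IsCompl (Es n) (Eu n))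
    (hs : ∀ n, ∀ v ∈ Es n, f.diff 1 (x n) v ∈ Es (n + 1))
    (hu : ∀ n, (Eu n).map (f.diff 1 (x n)).toLinearMap = Eu (n + 1))
    (hs' : ∀ n, ∀ v ∈ Es n, ‖f.diff 1 (x n) v‖ ≤ μ * ‖v‖)
    (hu' : ∀ n, ∀ v ∈ Eu n, ‖v‖ ≤ μ * ‖f.diff 1 (x n) v‖) :
    f.IsHyperbolicSplitting x Es Eu 1 μ := by
  refine ⟨h, fun n => Submodule.map_le_iff_le_comap.2 (hs n), hu, fun n v hv k => ?_,
    fun n v hv k => ?_⟩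
  · have key : f.diff k (x n) v ∈ Es (n + k) ∧ ‖f.diff k (x n) v‖ ≤ μ ^ k * ‖v‖ := by
      induction k with
      | zero => simpa [diff_zero_apply] using hv
      | succ k ih =>
        rw [diff_succ_apply, hx.iterate]
        refine ⟨?_, (hs' _ _ ih.1).trans ?_⟩
        · have := hs _ _ ih.1
          push_cast
          rwa [← add_assoc]
        · rw [pow_succ', mul_assoc]
          exact mul_le_mul_of_nonneg_left ih.2 hμ.le
    rw [one_mul]
    exact key.2
  · have key : f.diff k (x n) v ∈ Eu (n + k) ∧ ‖v‖ ≤ μ ^ k * ‖f.diff k (x n) v‖ := by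
      induction k with
      | zero => simpa [diff_zero_apply] using hv
      | succ k ih =>
        rw [diff_succ_apply, hx.iterate]
        refine ⟨?_, ih.2.trans ?_⟩
        · have := hu (n + k)
          push_cast
          rw [← add_assoc, ← this]
          exact Submodule.mem_map_of_mem (f := (f.diff 1 (x (n + k))).toLinearMap) ih.1
        · rw [pow_succ, mul_assoc]
          exact mul_le_mul_of_nonneg_left (hu' _ _ ih.1) (pow_nonneg hμ.le _)
    rw [one_mul]
    exact key.2

theorem isExpandingOn_of_step {f : TorusEndo} {L : Set T2} {μ : ℝ} (hμ : 1 < μ)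
    (hL : MapsTo f.toFun L L) (h : ∀ z ∈ L, ∀ v, μ * ‖v‖ ≤ ‖f.diff 1 z v‖) :
    f.IsExpandingOn L := by
  refine ⟨1, μ, one_pos, hμ, fun z hz n v => ?_⟩
  rw [one_mul]
  induction n with
  | zero => simp [diff_zero_apply]
  | succ n ih =>
    rw [diff_succ_apply, pow_succ', mul_assoc]
    exact (mul_le_mul_of_nonneg_left ih (by linarith)).trans (h _ (hL.iterate n hz) _)

theorem IsExpandingOn.mono {f : TorusEndo} {L L' : Set T2} (h : f.IsExpandingOn L) (hL : L' ⊆ L) :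
    f.IsExpandingOn L' := by
  obtain ⟨c, μ, hc, hμ, h⟩ := h
  exact ⟨c, μ, hc, hμ, fun z hz => h z (hL hz)⟩

theorem not_isExpandingOn_of_bounded {f : TorusEndo} {L : Set T2} {z : T2} (hz : z ∈ L)
    {v : ℝ × ℝ} (hv : v ≠ 0) {b : ℝ} (h : ∀ n, ‖f.diff n z v‖ ≤ b) : ¬ f.IsExpandingOn L := by
  rintro ⟨c, μ, hc, hμ, H⟩
  obtain ⟨n, hn⟩ := pow_unbounded_of_one_lt (b / (c * ‖v‖)) hμ
  have hv' := norm_pos_iff.2 hv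
  rw [div_lt_iff₀ (by positivity)] at hn
  have := (H z hz n v).trans (h n)
  linarith [mul_comm (μ ^ n) (c * ‖v‖), mul_right_comm c (μ ^ n) ‖v‖]

end TorusEndo

theorem isCompl_horizontal_span (u : ℝ) :
    IsCompl (Submodule.span ℝ {((1, 0) : ℝ × ℝ)}) (Submodule.span ℝ {((u, 1) : ℝ × ℝ)}) := by
  constructor
  · rw [Submodule.disjoint_def]
    intro v h1 h2
    obtain ⟨a, rfl⟩ := Submodule.mem_span_singleton.1 h1
    obtain ⟨b, hb⟩ := Submodule.mem_span_singleton.1 h2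
    simp only [Prod.smul_mk, smul_eq_mul, mul_one, mul_zero, Prod.mk.injEq] at hb ⊢
    obtain ⟨hb1, hb2⟩ := hb
    subst hb2
    simp at hb1
    simp [hb1.symm]
  · rw [codisjoint_iff, eq_top_iff]
    rintro ⟨a, b⟩ -
    refine Submodule.mem_sup.2 ⟨(a - b * u) • (1, 0),
      Submodule.smul_mem _ _ (Submodule.mem_span_singleton_self _), b • (u, 1),
      Submodule.smul_mem _ _ (Submodule.mem_span_singleton_self _), ?_⟩
    simp

namespace SecondConsts

variable {δ : ℝ} {f₂ : ℝ → ℝ} {m M ρ θ q : ℝ}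

theorem le_deriv_circRep (H : SecondConsts δ f₂ m M ρ θ q) {t : Circ} (ht : δ - ρ ≤ ‖t‖) :
    3 / 2 ≤ deriv f₂ (circRep t) :=
  H.expand _ (by rwa [coe_circRep])

theorem norm_le_of_mem_repeller {t : Circ} (ht : t ∈ repeller δ f₂) : δ ≤ ‖t‖ := ht 0

/-- The repeller has empty interior. -/
theorem exists_notMem_repeller (H : SecondConsts δ f₂ m M ρ θ q) {t : Circ} {O : Set Circ}
    (hO : O ∈ 𝓝 t) : ∃ u ∈ O, u ∉ repeller δ f₂ := by
  by_contra! hsub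
  obtain ⟨e, -⟩ := H.exists_coding
  -- The coding makes the repeller totally disconnected, so it cannot contain the image of a
  -- nondegenerate interval.
  have htd : IsTotallyDisconnected (repeller δ f₂) := by
    have : TotallyDisconnectedSpace (repeller δ f₂) := by
      refine ⟨fun s _ hs => ?_⟩
      have h1 : (e '' s).Subsingleton := (hs.image e e.continuous.continuousOn).subsingleton
      intro a ha b hb
      exact e.injective (h1 (mem_image_of_mem e ha) (mem_image_of_mem e hb))
    exact totallyDisconnectedSpace_subtype_iff.1 this
  have hev : ∀ᶠ x : ℝ in 𝓝 (circRep t), ((x : ℝ) : Circ) ∈ O :=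
    continuous_coe_circ.continuousAt.eventually_mem (by rwa [coe_circRep])
  obtain ⟨r, hr, hrO⟩ := Metric.nhds_basis_closedBall.mem_iff.1 hev
  set r' := min r 1
  have hr' : 0 < r' := lt_min hr one_pos
  have hpre : IsPreconnected (((↑) : ℝ → Circ) '' Icc (circRep t) (circRep t + r')) :=
    isPreconnected_Icc.image _ continuous_coe_circ.continuousOn
  have hss := htd _ (by
    rintro _ ⟨x, hx, rfl⟩
    refine hsub _ (hrO ?_)
    rw [Metric.mem_closedBall, Real.dist_eq, abs_le]
    constructor <;> linarith [hx.1, hx.2, min_le_left r 1]) hpre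
  have heq := hss (mem_image_of_mem _ (left_mem_Icc.2 (by linarith)))
    (mem_image_of_mem _ (right_mem_Icc.2 (by linarith)))
  have := eq_of_coe_eq heq (by
    rw [show circRep t - (circRep t + r') = -r' by ring, abs_neg, abs_of_pos hr']
    linarith [min_le_right r 1, Real.pi_gt_three])
  linarith

end SecondConsts

namespace Params

variable {δ s₀ η ε lam : ℝ} {f₁ f₂ φ : ℝ → ℝ} {m M ρ θ q : ℝ}

theorem diff_one_apply_annulus (P : Params δ s₀ η ε lam f₁ f₂ φ m M ρ θ q) {z : T2}
    (hz : ‖z.1‖ < s₀) (v : ℝ × ℝ) : P.map.diff 1 z v =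
      (lam * v.1 + ε * Real.cos (circRep z.2) * v.2, deriv f₂ (circRep z.2) * v.2) := by
  obtain ⟨x, hx, hx'⟩ := exists_coe_eq_abs z.1
  have h := P.diff_one_apply_of_lt (hx' ▸ hz : |x| < s₀) (circRep z.2) v
  rwa [hx, coe_circRep] at h

theorem diff_apply_horizontal (P : Params δ s₀ η ε lam f₁ f₂ φ m M ρ θ q) {z : T2}
    (hz : ‖z.1‖ ≤ 2 * ε) (n : ℕ) (a : ℝ) : P.map.diff n z (a, 0) = (lam ^ n * a, 0) := by
  induction n with
  | zero => simp [TorusEndo.diff_zero_apply]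
  | succ n ih =>
    rw [TorusEndo.diff_succ_apply, ih,
      P.diff_one_apply_annulus ((P.norm_iterate_fst_le hz n).trans_lt P.ε_lt_s₀)]
    simp [pow_succ', mul_assoc]

/-- A bound for the hyperbolicity of all basic pieces. -/
noncomputable def rate (_P : Params δ s₀ η ε lam f₁ f₂ φ m M ρ θ q) : ℝ :=
  max (max (3 / 4) (deriv f₂ 0)) (deriv f₁ Real.pi)⁻¹

theorem three_quarters_le_rate (P : Params δ s₀ η ε lam f₁ f₂ φ m M ρ θ q) : 3 / 4 ≤ P.rate :=
  (le_max_left _ _).trans (le_max_left _ _)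

theorem deriv_le_rate (P : Params δ s₀ η ε lam f₁ f₂ φ m M ρ θ q) : deriv f₂ 0 ≤ P.rate :=
  (le_max_right _ _).trans (le_max_left _ _)

theorem inv_deriv_le_rate (P : Params δ s₀ η ε lam f₁ f₂ φ m M ρ θ q) :
    (deriv f₁ Real.pi)⁻¹ ≤ P.rate := le_max_right _ _

theorem rate_pos (P : Params δ s₀ η ε lam f₁ f₂ φ m M ρ θ q) : 0 < P.rate :=
  lt_of_lt_of_le (by norm_num) P.three_quarters_le_rate

theorem rate_lt_one (P : Params δ s₀ η ε lam f₁ f₂ φ m M ρ θ q) : P.rate < 1 :=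
  max_lt (max_lt (by norm_num) P.H.map.attracting) (inv_lt_one_of_one_lt₀ P.h₁.repelling)

theorem abs_le_rate_mul_deriv (P : Params δ s₀ η ε lam f₁ f₂ φ m M ρ θ q) (a : ℝ) :
    |a| ≤ P.rate * |deriv f₁ Real.pi * a| := by
  have h := P.h₁.deriv_pos Real.pi
  rw [abs_mul, abs_of_pos h, ← mul_assoc]
  refine le_mul_of_one_le_left (abs_nonneg a) ?_
  have := mul_le_mul_of_nonneg_right P.inv_deriv_le_rate h.le
  rwa [inv_mul_cancel₀ h.ne'] at this

theorem abs_le_rate_mul (P : Params δ s₀ η ε lam f₁ f₂ φ m M ρ θ q) {d : ℝ} (hd : 3 / 2 ≤ d)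
    (a : ℝ) : |a| ≤ P.rate * |d * a| := by
  rw [abs_mul, abs_of_pos (show 0 < d by linarith), ← mul_assoc]
  refine le_mul_of_one_le_left (abs_nonneg a) ?_
  nlinarith [P.three_quarters_le_rate]

theorem map_top_diff (P : Params δ s₀ η ε lam f₁ f₂ φ m M ρ θ q) (n : ℕ) (z : T2) :
    (⊤ : Submodule ℝ (ℝ × ℝ)).map (P.map.diff n z).toLinearMap = ⊤ := by
  rw [Submodule.map_top, LinearMap.range_eq_top]
  exact (P.bijective_diff n z).2

theorem splitting_sinkPt (P : Params δ s₀ η ε lam f₁ f₂ φ m M ρ θ q) {x : ℤ → T2}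
    (hx : P.map.IsFullOrbit x) (h : ∀ n, x n ∈ ({sinkPt} : Set T2)) :
    P.map.IsHyperbolicSplitting x (fun _ => ⊤) (fun _ => ⊥) 1 P.rate := by
  refine TorusEndo.isHyperbolicSplitting_of_step hx P.rate_pos (fun n => isCompl_top_bot)
    (fun n v _ => Submodule.mem_top) (fun n => Submodule.map_bot _) (fun n v _ => ?_)
    fun n v hv => ?_
  · have hn : x n = (((0 : ℝ) : Circ), ((0 : ℝ) : Circ)) := h n
    rw [hn, P.diff_one_apply_of_lt (by simpa using P.s₀_pos), Prod.norm_def, Real.cos_zero]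
    have h1 : |v.1| ≤ ‖v‖ := le_max_left _ _
    have h2 : |v.2| ≤ ‖v‖ := le_max_right _ _
    refine max_le ?_ ?_
    · calc ‖lam * v.1 + ε * 1 * v.2‖ ≤ ‖lam * v.1‖ + ‖ε * 1 * v.2‖ := norm_add_le _ _
        _ = lam * |v.1| + ε * |v.2| := by
          rw [norm_mul, norm_mul, mul_one, Real.norm_of_nonneg P.lam_pos.le,
            Real.norm_of_nonneg P.ε_pos.le]; rfl
        _ ≤ lam * ‖v‖ + ε * ‖v‖ := by
          gcongr
          exacts [P.lam_pos.le, P.ε_pos.le]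
        _ ≤ P.rate * ‖v‖ := by
          rw [← add_mul]
          gcongr
          linarith [P.lam_le, P.ε_lt, P.three_quarters_le_rate]
    · rw [norm_mul, Real.norm_of_nonneg (P.H.map.deriv_pos 0).le]
      exact mul_le_mul P.deriv_le_rate h2 (norm_nonneg _) P.rate_pos.le
  · rw [(Submodule.mem_bot ℝ).1 hv]
    simp

theorem splitting_saddlePt (P : Params δ s₀ η ε lam f₁ f₂ φ m M ρ θ q) {x : ℤ → T2}
    (hx : P.map.IsFullOrbit x) (h : ∀ n, x n ∈ ({saddlePt} : Set T2)) :
    P.map.IsHyperbolicSplitting x (fun _ => Submodule.span ℝ {(0, 1)})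
      (fun _ => Submodule.span ℝ {(1, 0)}) 1 P.rate := by
  have hD : ∀ n v, P.map.diff 1 (x n) v = (deriv f₁ Real.pi * v.1, deriv f₂ 0 * v.2) := by
    intro n v
    have hn : x n = (((Real.pi : ℝ) : Circ), ((0 : ℝ) : Circ)) := h n
    rw [hn, P.diff_one_apply_pi]
  refine TorusEndo.isHyperbolicSplitting_of_step hx P.rate_pos
    (fun n => (isCompl_horizontal_span 0).symm) (fun n v hv => ?_) (fun n => ?_) (fun n v hv => ?_)
    fun n v hv => ?_
  · obtain ⟨a, rfl⟩ := Submodule.mem_span_singleton.1 hv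
    rw [hD]
    exact Submodule.mem_span_singleton.2 ⟨deriv f₂ 0 * a, by simp⟩
  · rw [Submodule.map_span, image_singleton]
    have e : (P.map.diff 1 (x n)).toLinearMap (1, 0) = deriv f₁ Real.pi • ((1, 0) : ℝ × ℝ) := by
      have := hD n (1, 0)
      simpa using this
    rw [e]
    exact Submodule.span_singleton_smul_eq (P.h₁.deriv_pos _).ne'.isUnit _
  · obtain ⟨a, rfl⟩ := Submodule.mem_span_singleton.1 hv
    rw [hD, Prod.norm_def, Prod.norm_def]
    simp only [Prod.smul_mk, smul_eq_mul, mul_zero, mul_one, norm_zero]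
    rw [max_eq_right (norm_nonneg _), max_eq_right (norm_nonneg _), norm_mul,
      Real.norm_of_nonneg (P.H.map.deriv_pos 0).le]
    exact mul_le_mul_of_nonneg_right P.deriv_le_rate (norm_nonneg _)
  · obtain ⟨a, rfl⟩ := Submodule.mem_span_singleton.1 hv
    rw [hD, Prod.norm_def, Prod.norm_def]
    simp only [Prod.smul_mk, smul_eq_mul, mul_zero, mul_one, norm_zero]
    rw [max_eq_left (norm_nonneg _), max_eq_left (norm_nonneg _)]
    exact P.abs_le_rate_mul_deriv a

theorem norm_le_rate_mul_expandingPiece (P : Params δ s₀ η ε lam f₁ f₂ φ m M ρ θ q) {z : T2}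
    (hz : z ∈ expandingPiece δ f₂) (v : ℝ × ℝ) : ‖v‖ ≤ P.rate * ‖P.map.diff 1 z v‖ := by
  have hz' : z = (((Real.pi : ℝ) : Circ), ((circRep z.2 : ℝ) : Circ)) :=
    Prod.ext hz.1 (coe_circRep _).symm
  have hd : 3 / 2 ≤ deriv f₂ (circRep z.2) := P.H.le_deriv_circRep
    (by linarith [SecondConsts.norm_le_of_mem_repeller hz.2, P.H.ρ_pos])
  have e := P.diff_one_apply_pi (circRep z.2) v
  rw [← hz'] at e
  rw [e, Prod.norm_def, Prod.norm_def, mul_max_of_nonneg _ _ P.rate_pos.le]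
  exact max_le_max (P.abs_le_rate_mul_deriv _) (P.abs_le_rate_mul hd _)

theorem mapsTo_sinkPt (P : Params δ s₀ η ε lam f₁ f₂ φ m M ρ θ q) :
    MapsTo P.map.toFun {sinkPt} {sinkPt} := by
  rintro _ rfl
  exact P.map_sinkPt

theorem mapsTo_saddlePt (P : Params δ s₀ η ε lam f₁ f₂ φ m M ρ θ q) :
    MapsTo P.map.toFun {saddlePt} {saddlePt} := by
  rintro _ rfl
  exact P.map_saddlePt

theorem mapsTo_expandingPiece (P : Params δ s₀ η ε lam f₁ f₂ φ m M ρ θ q) :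
    MapsTo P.map.toFun (expandingPiece δ f₂) (expandingPiece δ f₂) :=
  mapsTo_iff_image_subset.2 P.image_expandingPiece.subset

theorem mapsTo_solenoid (P : Params δ s₀ η ε lam f₁ f₂ φ m M ρ θ q) :
    MapsTo P.map.toFun P.solenoid P.solenoid :=
  mapsTo_iff_image_subset.2 P.image_solenoid.subset

theorem isExpandingOn_expandingPiece (P : Params δ s₀ η ε lam f₁ f₂ φ m M ρ θ q) :
    P.map.IsExpandingOn (expandingPiece δ f₂) := by
  refine TorusEndo.isExpandingOn_of_step (one_lt_inv₀ P.rate_pos |>.2 P.rate_lt_one)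
    P.mapsTo_expandingPiece fun z hz v => ?_
  rw [inv_mul_le_iff₀ P.rate_pos]
  exact P.norm_le_rate_mul_expandingPiece hz v

theorem splitting_expandingPiece (P : Params δ s₀ η ε lam f₁ f₂ φ m M ρ θ q) {x : ℤ → T2}
    (hx : P.map.IsFullOrbit x) (h : ∀ n, x n ∈ expandingPiece δ f₂) :
    P.map.IsHyperbolicSplitting x (fun _ => ⊥) (fun _ => ⊤) 1 P.rate := by
  refine TorusEndo.isHyperbolicSplitting_of_step hx P.rate_pos (fun n => isCompl_bot_top)
    (fun n v hv => ?_) (fun n => P.map_top_diff _ _) (fun n v hv => ?_)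
    fun n v _ => P.norm_le_rate_mul_expandingPiece (h n) v
  · rw [(Submodule.mem_bot ℝ).1 hv, map_zero]
    exact Submodule.zero_mem _
  · rw [(Submodule.mem_bot ℝ).1 hv]
    simp

/-- The action on non-horizontal lines: slopes ds/dt follow f₂'(t) u' = λu + ε cos t. -/
theorem map_span_slope (P : Params δ s₀ η ε lam f₁ f₂ φ m M ρ θ q) {z : T2} (hz : ‖z.1‖ < s₀)
    {u u' : ℝ} (h : deriv f₂ (circRep z.2) * u' = lam * u + ε * Real.cos (circRep z.2)) :
    (Submodule.span ℝ {((u, 1) : ℝ × ℝ)}).map (P.map.diff 1 z).toLinearMap =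
      Submodule.span ℝ {((u', 1) : ℝ × ℝ)} := by
  rw [Submodule.map_span, image_singleton]
  have e : (P.map.diff 1 z).toLinearMap (u, 1) =
      deriv f₂ (circRep z.2) • ((u', 1) : ℝ × ℝ) := by
    refine (P.diff_one_apply_annulus hz (u, 1)).trans ?_
    simp [h]
  rw [e]
  exact Submodule.span_singleton_smul_eq (P.H.map.deriv_pos _).ne'.isUnit _

/-- The unstable slopes are the bounded solution of the slope recurrence along the orbit. The bound
|u| ≤ 1 gives (u, 1) sup norm 1, so the growth of such vectors is read off from f₂' ≥ 3/2. -/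
theorem splitting_solenoid (P : Params δ s₀ η ε lam f₁ f₂ φ m M ρ θ q) {x : ℤ → T2}
    (hx : P.map.IsFullOrbit x) (h : ∀ n, x n ∈ P.solenoid) :
    ∃ u : ℤ → ℝ, P.map.IsHyperbolicSplitting x (fun _ => Submodule.span ℝ {(1, 0)})
      (fun n => Submodule.span ℝ {(u n, 1)}) 1 P.rate := by
  have hs : ∀ n, ‖(x n).1‖ < s₀ := fun n => (P.solenoid_subset (h n)).1.trans_lt P.ε_lt_s₀
  have hd : ∀ n, 3 / 2 ≤ deriv f₂ (circRep (x n).2) := fun n => P.H.le_deriv_circRep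
    (by linarith [SecondConsts.norm_le_of_mem_repeller (P.solenoid_subset (h n)).2, P.H.ρ_pos])
  obtain ⟨u, hu, hu'⟩ := exists_bounded_solution
    (α := fun n => lam / deriv f₂ (circRep (x n).2))
    (β := fun n => ε * Real.cos (circRep (x n).2) / deriv f₂ (circRep (x n).2)) (b := 1 / 2)
    (fun n => by
      rw [abs_of_nonneg (div_nonneg P.lam_pos.le (by linarith [hd n])),
        div_le_iff₀ (by linarith [hd n])]
      linarith [hd n, P.lam_le])
    (fun n => by
      rw [abs_div, abs_of_pos (show 0 < deriv f₂ (circRep (x n).2) by linarith [hd n]),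
        div_le_iff₀ (by linarith [hd n]), abs_mul, abs_of_pos P.ε_pos]
      have := mul_le_of_le_one_right P.ε_pos.le (Real.abs_cos_le_one (circRep (x n).2))
      linarith [hd n, P.ε_lt])
  have hD := fun n => P.diff_one_apply_annulus (hs n)
  have hnorm : ∀ n (c : ℝ), ‖c • ((u n, 1) : ℝ × ℝ)‖ = |c| := by
    intro n c
    rw [norm_smul, Prod.norm_def, norm_one, Real.norm_eq_abs, max_eq_right, mul_one]
    have := hu n
    rw [Real.norm_eq_abs]
    linarith
  refine ⟨u, TorusEndo.isHyperbolicSplitting_of_step hx P.rate_pos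
    (fun n => isCompl_horizontal_span (u n)) (fun n v hv => ?_)
    (fun n => P.map_span_slope (hs n) ?_) (fun n v hv => ?_) fun n v hv => ?_⟩
  · obtain ⟨a, rfl⟩ := Submodule.mem_span_singleton.1 hv
    rw [hD]
    exact Submodule.mem_span_singleton.2 ⟨lam * a, by simp⟩
  · rw [hu']
    have : deriv f₂ (circRep (x n).2) ≠ 0 := by linarith [hd n]
    field_simp
  · obtain ⟨a, rfl⟩ := Submodule.mem_span_singleton.1 hv
    rw [hD, Prod.norm_def, Prod.norm_def]
    simp only [Prod.smul_mk, smul_eq_mul, mul_zero, mul_one, norm_zero, add_zero]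
    rw [max_eq_left (norm_nonneg _), max_eq_left (norm_nonneg _), norm_mul,
      Real.norm_of_nonneg P.lam_pos.le]
    exact mul_le_mul_of_nonneg_right (by linarith [P.lam_le, P.three_quarters_le_rate])
      (norm_nonneg _)
  · obtain ⟨a, rfl⟩ := Submodule.mem_span_singleton.1 hv
    rw [hnorm]
    refine (P.abs_le_rate_mul (hd n) a).trans (mul_le_mul_of_nonneg_left ?_ P.rate_pos.le)
    rw [hD]
    simp only [Prod.smul_mk, smul_eq_mul, mul_one]
    exact le_max_right _ _

theorem span_singleton_ne_bot {v : ℝ × ℝ} (hv : v ≠ 0) : Submodule.span ℝ {v} ≠ ⊥ := by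
  rwa [Ne, Submodule.span_singleton_eq_bot]

theorem isSaddleSet_saddlePt (P : Params δ s₀ η ε lam f₁ f₂ φ m M ρ θ q) :
    P.map.IsSaddleSet {saddlePt} :=
  ⟨isCompact_singleton, P.isBasicPiece_saddlePt.image_eq, 1, P.rate, one_pos, P.rate_pos,
    P.rate_lt_one, fun _ hx h => ⟨_, _, P.splitting_saddlePt hx h, fun _ =>
      ⟨span_singleton_ne_bot (by simp), span_singleton_ne_bot (by simp)⟩⟩⟩

theorem isSaddleSet_solenoid (P : Params δ s₀ η ε lam f₁ f₂ φ m M ρ θ q) :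
    P.map.IsSaddleSet P.solenoid :=
  ⟨P.isCompact_solenoid, P.image_solenoid, 1, P.rate, one_pos, P.rate_pos,
    P.rate_lt_one, fun _ hx h => by
      obtain ⟨u, hu⟩ := P.splitting_solenoid hx h
      exact ⟨_, _, hu, fun _ => ⟨span_singleton_ne_bot (by simp), span_singleton_ne_bot (by simp)⟩⟩⟩

theorem isHyperbolicSet_Om (P : Params δ s₀ η ε lam f₁ f₂ φ m M ρ θ q) :
    P.map.IsHyperbolicSet P.map.Om := by
  refine ⟨(isClosed_nonwanderingSet _).isCompact, ?_, 1, P.rate, one_pos, P.rate_pos,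
    P.rate_lt_one, fun x hx h => ?_⟩
  · rw [P.Om_eq, image_union, image_union, image_union, P.isBasicPiece_sinkPt.image_eq,
      P.isBasicPiece_saddlePt.image_eq, P.image_expandingPiece, P.image_solenoid]
  · rw [P.Om_eq] at h
    have hd := P.pairwise_disjoint
    simp only [List.pairwise_cons, List.mem_cons, List.not_mem_nil, or_false, forall_eq_or_imp,
      forall_eq] at hd
    obtain ⟨⟨h12, h13, h14⟩, ⟨h23, h24⟩, h34, -⟩ := hd
    have hm12 := P.mapsTo_sinkPt.union_union P.mapsTo_saddlePt
    have hm123 := hm12.union_union P.mapsTo_expandingPiece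
    rcases hx.forall_mem_or hm123 P.mapsTo_solenoid
      (disjoint_union_left.2 ⟨disjoint_union_left.2 ⟨h14, h24⟩, h34⟩) h with h | h
    · rcases hx.forall_mem_or hm12 P.mapsTo_expandingPiece
        (disjoint_union_left.2 ⟨h13, h23⟩) h with h | h
      · rcases hx.forall_mem_or P.mapsTo_sinkPt P.mapsTo_saddlePt h12 h with h | h
        · exact ⟨_, _, P.splitting_sinkPt hx h⟩
        · exact ⟨_, _, P.splitting_saddlePt hx h⟩
      · exact ⟨_, _, P.splitting_expandingPiece hx h⟩
    · obtain ⟨u, hu⟩ := P.splitting_solenoid hx h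
      exact ⟨_, _, hu⟩

theorem subset_of_isBasicPiece (P : Params δ s₀ η ε lam f₁ f₂ φ m M ρ θ q) {L : Set T2}
    (hL : IsBasicPiece P.map.toFun L) :
    L ⊆ {sinkPt} ∨ L ⊆ {saddlePt} ∨ L ⊆ expandingPiece δ f₂ ∨ L ⊆ P.solenoid := by
  have h : L ⊆ P.map.Om := hL.subset
  rw [P.Om_eq] at h
  have hd := P.pairwise_disjoint
  simp only [List.pairwise_cons, List.mem_cons, List.not_mem_nil, or_false, forall_eq_or_imp,
    forall_eq] at hd
  obtain ⟨⟨h12, h13, h14⟩, ⟨h23, h24⟩, h34, -⟩ := hd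
  have hm12 := P.mapsTo_sinkPt.union_union P.mapsTo_saddlePt
  have hc12 : IsClosed (({sinkPt} : Set T2) ∪ {saddlePt}) := isClosed_singleton.union isClosed_singleton
  rcases hL.transitive.subset_or_subset (hc12.union P.isClosed_expandingPiece)
    P.isCompact_solenoid.isClosed (disjoint_union_left.2 ⟨disjoint_union_left.2 ⟨h14, h24⟩, h34⟩)
    (hm12.union_union P.mapsTo_expandingPiece) h with h | h
  · rcases hL.transitive.subset_or_subset hc12 P.isClosed_expandingPiece
      (disjoint_union_left.2 ⟨h13, h23⟩) hm12 h with h | h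
    · rcases hL.transitive.subset_or_subset isClosed_singleton isClosed_singleton h12
        P.mapsTo_sinkPt h with h | h
      exacts [Or.inl h, Or.inr (Or.inl h)]
    · exact Or.inr (Or.inr (Or.inl h))
  · exact Or.inr (Or.inr (Or.inr h))

theorem axiomA (P : Params δ s₀ η ε lam f₁ f₂ φ m M ρ θ q) : P.map.AxiomA where
  hyperbolic := P.isHyperbolicSet_Om
  dense_periodic := fun z hz => P.mem_closure_periodicPts (P.Om_eq ▸ hz)
  expanding_or_injective := by
    intro L hL
    rcases P.subset_of_isBasicPiece hL with h | h | h | h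
    · exact Or.inr ((injOn_singleton _ _).mono h)
    · exact Or.inr ((injOn_singleton _ _).mono h)
    · exact Or.inl (P.isExpandingOn_expandingPiece.mono h)
    · exact Or.inr (P.injOn_strip.mono (h.trans P.solenoid_subset))

theorem not_isExpandingOn_of_norm_le (P : Params δ s₀ η ε lam f₁ f₂ φ m M ρ θ q) {L : Set T2}
    {z : T2} (hz : z ∈ L) (h : ‖z.1‖ ≤ 2 * ε) : ¬ P.map.IsExpandingOn L := by
  refine TorusEndo.not_isExpandingOn_of_bounded hz (v := (1, 0)) (b := 1) (by simp) fun n => ?_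
  rw [P.diff_apply_horizontal h, Prod.norm_def]
  simp only [mul_one, norm_zero]
  rw [max_eq_left (norm_nonneg _), norm_pow, Real.norm_of_nonneg P.lam_pos.le]
  exact pow_le_one₀ P.lam_pos.le P.lam_lt_one.le

theorem not_isExpandingOn_univ (P : Params δ s₀ η ε lam f₁ f₂ φ m M ρ θ q) :
    ¬ P.map.IsExpandingOn univ :=
  P.not_isExpandingOn_of_norm_le (mem_univ sinkPt)
    (by simpa [sinkPt] using P.ε_pos.le)

theorem not_isExpandingOn_saddlePt (P : Params δ s₀ η ε lam f₁ f₂ φ m M ρ θ q) {L : Set T2}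
    (hL : saddlePt ∈ L) : ¬ P.map.IsExpandingOn L := by
  have hx : P.map.IsFullOrbit fun _ => saddlePt := fun _ => P.map_saddlePt
  have hs := P.splitting_saddlePt hx fun _ => rfl
  refine TorusEndo.not_isExpandingOn_of_bounded hL (v := (0, 1)) (b := 1) (by simp) fun n => ?_
  refine (hs.contract 0 (0, 1) (Submodule.mem_span_singleton_self _) n).trans ?_
  rw [one_mul, Prod.norm_def]
  simp only [norm_zero, norm_one]
  rw [max_eq_right zero_le_one, mul_one]
  exact pow_le_one₀ P.rate_pos.le P.rate_lt_one.le

theorem not_isAttractingSet_saddlePt (P : Params δ s₀ η ε lam f₁ f₂ φ m M ρ θ q) :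
    ¬ IsAttractingSet P.map.toFun {saddlePt} := by
  intro h
  refine sinkPt_ne_saddlePt (h.mem_of_tendsto P.map_sinkPt (z := saddlePt) rfl fun O hO => ?_)
  have hc : Continuous fun x : ℝ => (((Real.pi - x : ℝ) : Circ), (0 : Circ)) :=
    (continuous_coe_circ.comp (continuous_const.sub continuous_id)).prodMk continuous_const
  have hev : ∀ᶠ x in 𝓝 (0 : ℝ), (((Real.pi - x : ℝ) : Circ), (0 : Circ)) ∈ O :=
    hc.continuousAt.eventually_mem (by simpa [saddlePt] using hO)
  obtain ⟨r, hr, hrO⟩ := Metric.nhds_basis_closedBall.mem_iff.1 hev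
  set r' := min r 1
  have hr' : 0 < r' := lt_min hr one_pos
  have hmem : r' ∈ Metric.closedBall (0 : ℝ) r := by
    rw [Metric.mem_closedBall, Real.dist_eq, sub_zero, abs_of_pos hr']
    exact min_le_left _ _
  refine ⟨(((Real.pi - r' : ℝ) : Circ), (0 : Circ)), hrO hmem,
    P.tendsto_sinkPt (fun he => ?_) P.H.zero_notMem_repeller⟩
  · replace he : ((Real.pi - r' : ℝ) : Circ) = ((Real.pi : ℝ) : Circ) := he
    have := eq_of_coe_eq he (by
      rw [show Real.pi - r' - Real.pi = -r' by ring, abs_neg, abs_of_pos hr']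
      linarith [min_le_right r 1, Real.pi_gt_three])
    linarith

/-- The repeller has empty interior, so an arbitrarily small change of t moves a point of Γ₀ into
the basin of the sink. -/
theorem not_isAttractingSet_of_subset_solenoid (P : Params δ s₀ η ε lam f₁ f₂ φ m M ρ θ q)
    {L : Set T2} (hne : L.Nonempty) (hL : L ⊆ P.solenoid) : ¬ IsAttractingSet P.map.toFun L := by
  intro h
  obtain ⟨z, hz⟩ := hne
  refine P.sinkPt_notMem_solenoid (hL (h.mem_of_tendsto P.map_sinkPt hz fun O hO => ?_))
  have hc : Continuous fun t : Circ => (z.1, t) := by fun_prop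
  obtain ⟨t, ht, ht'⟩ := P.H.exists_notMem_repeller (t := z.2)
    (hc.continuousAt.preimage_mem_nhds (t := O) hO)
  exact ⟨(z.1, t), ht, P.tendsto_sinkPt
    (P.fst_ne_pi_of_norm_le (P.solenoid_subset (hL hz)).1) ht'⟩

theorem gammaSet_eq (P : Params δ s₀ η ε lam f₁ f₂ φ m M ρ θ q) :
    P.map.gammaSet = {saddlePt} ∪ P.solenoid := by
  have hd := P.pairwise_disjoint
  simp only [List.pairwise_cons, List.mem_cons, List.not_mem_nil, or_false, forall_eq_or_imp,
    forall_eq] at hd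
  obtain ⟨⟨h12, h13, h14⟩, ⟨h23, h24⟩, h34, -⟩ := hd
  ext z
  constructor
  · rintro ⟨hz, h⟩
    rw [P.Om_eq] at hz
    rcases hz with ((hz | hz) | hz) | hz
    · exact absurd (hz ▸ P.isAttractingSet_sinkPt) (h _ P.isBasicPiece_sinkPt hz).1
    · exact Or.inl hz
    · exact absurd P.isExpandingOn_expandingPiece (h _ P.isBasicPiece_expandingPiece hz).2
    · exact Or.inr hz
  · rintro (hz | hz)
    · refine ⟨P.isBasicPiece_saddlePt.subset hz, fun L hL hzL => ?_⟩
      obtain rfl : z = saddlePt := hz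
      refine ⟨?_, P.not_isExpandingOn_saddlePt hzL⟩
      have : L = {saddlePt} := by
        refine Subset.antisymm ?_ (singleton_subset_iff.2 hzL)
        rcases P.subset_of_isBasicPiece hL with h | h | h | h
        · exact absurd (h hzL).symm sinkPt_ne_saddlePt
        · exact h
        · exact absurd (h hzL) P.saddlePt_notMem_expandingPiece
        · exact absurd (h hzL) P.saddlePt_notMem_solenoid
      rw [this]
      exact P.not_isAttractingSet_saddlePt
    · refine ⟨P.isBasicPiece_solenoid.subset hz, fun L hL hzL => ?_⟩
      refine ⟨P.not_isAttractingSet_of_subset_solenoid ⟨z, hzL⟩ ?_,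
        P.not_isExpandingOn_of_norm_le hzL (P.solenoid_subset hz).1⟩
      rcases P.subset_of_isBasicPiece hL with h | h | h | h
      · exact absurd hz (disjoint_left.1 h14 (h hzL))
      · exact absurd hz (disjoint_left.1 h24 (h hzL))
      · exact absurd hz (disjoint_left.1 h34 (h hzL))
      · exact h

end Params

/-! ### Inverse branches, unstable slopes and unstable graphs -/

/-- A bounded sequence that is contracted in the past vanishes. -/
theorem eq_zero_of_eq_mul_succ {D : ℕ → ℝ} {c B : ℝ} (hc : 0 ≤ c) (hc1 : c < 1)
    (hB : ∀ n, |D n| ≤ B) (h : ∀ n, D n = c * D (n + 1)) (n : ℕ) : D n = 0 := by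
  have key : ∀ k, |D n| ≤ c ^ k * B := by
    intro k
    have e : D n = c ^ k * D (n + k) := by
      induction k with
      | zero => simp
      | succ k ih => rw [ih, h (n + k), pow_succ, ← add_assoc, mul_assoc]
    rw [e, abs_mul, abs_of_nonneg (pow_nonneg hc k)]
    exact mul_le_mul_of_nonneg_left (hB _) (pow_nonneg hc k)
  have hlim : Tendsto (fun k : ℕ => c ^ k * B) atTop (𝓝 0) := by
    simpa using (tendsto_pow_atTop_nhds_zero_of_lt_one hc hc1).mul_const B
  exact abs_eq_zero.1 (le_antisymm (ge_of_tendsto' hlim key) (abs_nonneg _))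

/-- The branches of `f₂⁻ⁿ` on the line, for given translations by multiples of the period. -/
noncomputable def invBranch (f₂ : ℝ → ℝ) (k : ℕ → ℤ) : ℕ → ℝ → ℝ
  | 0, t => t
  | n + 1, t => Function.invFun f₂ (invBranch f₂ k n t + k n * (2 * Real.pi))

namespace SecondConsts

variable {δ : ℝ} {f₂ : ℝ → ℝ} {m M ρ θ q : ℝ}

theorem map_invBranch_succ (H : SecondConsts δ f₂ m M ρ θ q) (k : ℕ → ℤ) (n : ℕ) (t : ℝ) :
    f₂ (invBranch f₂ k (n + 1) t) = invBranch f₂ k n t + k n * (2 * Real.pi) :=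
  H.map_invFun _

theorem eq_invBranch (H : SecondConsts δ f₂ m M ρ θ q) {k : ℕ → ℤ} {T : ℕ → ℝ}
    (h : ∀ n, f₂ (T (n + 1)) = T n + k n * (2 * Real.pi)) (n : ℕ) :
    T n = invBranch f₂ k n (T 0) := by
  induction n with
  | zero => rfl
  | succ n ih =>
    refine H.map.strictMono.injective ?_
    rw [h, H.map_invBranch_succ, ih]

theorem hasDerivAt_invBranch (H : SecondConsts δ f₂ m M ρ θ q) (k : ℕ → ℤ) (n : ℕ) (t : ℝ) :
    HasDerivAt (invBranch f₂ k n)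
      (∏ i ∈ Finset.range n, (deriv f₂ (invBranch f₂ k (i + 1) t))⁻¹) t := by
  induction n with
  | zero => simpa [invBranch] using hasDerivAt_id' t
  | succ n ih =>
    rw [Finset.prod_range_succ, mul_comm]
    have h1 := H.hasDerivAt_invFun (invBranch f₂ k n t + k n * (2 * Real.pi))
    exact h1.comp t (ih.add_const _)

theorem abs_prod_inv_deriv_le (H : SecondConsts δ f₂ m M ρ θ q) (T : ℕ → ℝ) (n : ℕ) :
    |∏ i ∈ Finset.range n, (deriv f₂ (T i))⁻¹| ≤ m⁻¹ ^ n := by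
  rw [Finset.abs_prod]
  calc ∏ i ∈ Finset.range n, |(deriv f₂ (T i))⁻¹| ≤ ∏ _i ∈ Finset.range n, m⁻¹ := by
        refine Finset.prod_le_prod (fun _ _ => abs_nonneg _) fun i _ => ?_
        rw [abs_of_pos (inv_pos.2 (H.map.deriv_pos _))]
        exact inv_anti₀ H.m_pos (H.le_deriv _)
    _ = m⁻¹ ^ n := by simp

/-- Inverse branches along preorbits that stay away from the attracting region contract. -/
theorem abs_invBranch_sub_le (H : SecondConsts δ f₂ m M ρ θ q) {k : ℕ → ℤ} {T : ℕ → ℝ}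
    (h : ∀ n, f₂ (T (n + 1)) = T n + k n * (2 * Real.pi))
    (hT : ∀ n, δ - ρ / 2 ≤ ‖(T n : Circ)‖) {t : ℝ} (ht : |t - T 0| ≤ m * (ρ / 2)) (n : ℕ) :
    |invBranch f₂ k n t - T n| ≤ |t - T 0| := by
  induction n with
  | zero => rfl
  | succ n ih =>
    have e : f₂ (invBranch f₂ k (n + 1) t) - f₂ (T (n + 1)) = invBranch f₂ k n t - T n := by
      rw [H.map_invBranch_succ, h]; ring
    have h1 := H.mul_abs_sub_le (invBranch f₂ k (n + 1) t) (T (n + 1))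
    rw [e] at h1
    -- The crude bound through `m` first keeps the segment in the expanding region; only then does
    -- the factor 3/2 apply and prevent the distance from growing.
    have h2 : |invBranch f₂ k (n + 1) t - T (n + 1)| ≤ ρ / 2 :=
      le_of_mul_le_mul_left (h1.trans (ih.trans ht)) H.m_pos
    have h3 := H.mul_abs_sub_le_of (c := 3 / 2) (x := invBranch f₂ k (n + 1) t) (y := T (n + 1))
      fun s hs => by
        refine H.expand s ?_
        have h4 : |T (n + 1) - s| ≤ |invBranch f₂ k (n + 1) t - T (n + 1)| := by
          rw [uIcc_comm] at hs
          rw [abs_sub_comm]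
          exact abs_sub_left_of_mem_uIcc hs
        have h5 := hT (n + 1)
        have h6 : ‖(T (n + 1) : Circ)‖ ≤ ‖(s : Circ)‖ + |T (n + 1) - s| := by
          have := norm_add_le (s : Circ) ((T (n + 1) - s : ℝ) : Circ)
          rw [← AddCircle.coe_add, add_sub_cancel] at this
          linarith [norm_coe_le_abs (T (n + 1) - s)]
        linarith
    rw [e] at h3
    linarith [abs_nonneg (invBranch f₂ k (n + 1) t - T (n + 1))]

end SecondConsts

namespace Params

variable {δ s₀ η ε lam : ℝ} {f₁ f₂ φ : ℝ → ℝ} {m M ρ θ q : ℝ}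

/-- The slope `ds/dt` of the unstable direction along a preorbit with second coordinates `T`. -/
noncomputable def slope (_P : Params δ s₀ η ε lam f₁ f₂ φ m M ρ θ q) (T : ℕ → ℝ) : ℝ :=
  ∑' j : ℕ, ε * lam ^ j *
    (Real.cos (T (j + 1)) * ∏ i ∈ Finset.range (j + 1), (deriv f₂ (T (i + 1)))⁻¹)

theorem hasSum_bound (c : ℝ) : HasSum (fun j : ℕ => c * (1 / 4 : ℝ) ^ j) (4 / 3 * c) := by
  have := (hasSum_geometric_of_lt_one (r := 1 / 4) (by norm_num) (by norm_num)).mul_left c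
  rwa [show c * (1 - 1 / 4 : ℝ)⁻¹ = 4 / 3 * c by norm_num [mul_comm]] at this

/-- Near t = 0 inverse branches expand, but by at most 1/m per step; λ ≤ m/4 still makes the series
geometric, without restriction on T. -/
theorem norm_slope_term_le (P : Params δ s₀ η ε lam f₁ f₂ φ m M ρ θ q) (T : ℕ → ℝ) (x : ℝ)
    (j : ℕ) :
    ‖ε * lam ^ j * (Real.cos x * ∏ i ∈ Finset.range (j + 1), (deriv f₂ (T i))⁻¹)‖ ≤
      ε / m * (1 / 4) ^ j := by
  have hm := P.H.m_pos
  rw [norm_mul, norm_mul, norm_mul, norm_pow, Real.norm_of_nonneg P.ε_pos.le,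
    Real.norm_of_nonneg P.lam_pos.le]
  calc ε * lam ^ j * (‖Real.cos x‖ * ‖∏ i ∈ Finset.range (j + 1), (deriv f₂ (T i))⁻¹‖)
      ≤ ε * lam ^ j * (1 * m⁻¹ ^ (j + 1)) := by
        refine mul_le_mul_of_nonneg_left ?_ (mul_nonneg P.ε_pos.le (pow_nonneg P.lam_pos.le _))
        exact mul_le_mul (Real.abs_cos_le_one x) (P.H.abs_prod_inv_deriv_le _ _) (norm_nonneg _)
          zero_le_one
    _ = ε / m * (lam / m) ^ j := by
        rw [div_pow, pow_succ, inv_pow]; field_simp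
    _ ≤ ε / m * (1 / 4) ^ j := by
        refine mul_le_mul_of_nonneg_left ?_ (div_nonneg P.ε_pos.le hm.le)
        refine pow_le_pow_left₀ (div_nonneg P.lam_pos.le hm.le) ?_ j
        rw [div_le_iff₀ hm]
        linarith [P.lam_le_m]

theorem summable_slope (P : Params δ s₀ η ε lam f₁ f₂ φ m M ρ θ q) (T : ℕ → ℝ) :
    Summable fun j : ℕ => ε * lam ^ j *
      (Real.cos (T (j + 1)) * ∏ i ∈ Finset.range (j + 1), (deriv f₂ (T (i + 1)))⁻¹) :=
  Summable.of_norm_bounded (hasSum_bound (ε / m)).summable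
    fun j => P.norm_slope_term_le (fun i => T (i + 1)) _ j

theorem abs_slope_le (P : Params δ s₀ η ε lam f₁ f₂ φ m M ρ θ q) (T : ℕ → ℝ) :
    |P.slope T| ≤ 4 / 3 * (ε / m) :=
  tsum_of_norm_bounded (hasSum_bound (ε / m)) fun j => P.norm_slope_term_le (fun i => T (i + 1)) _ j

/-- Splitting off the first term of the series gives the transformation rule of slopes, so the lines
of slope `slope` are invariant along preorbits in the annulus. -/
theorem slope_succ (P : Params δ s₀ η ε lam f₁ f₂ φ m M ρ θ q) (T : ℕ → ℝ) :
    deriv f₂ (T 1) * P.slope T =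
      lam * P.slope (fun n => T (n + 1)) + ε * Real.cos (T 1) := by
  have hd := (P.H.map.deriv_pos (T 1)).ne'
  rw [slope, (P.summable_slope T).tsum_eq_zero_add, slope, ← tsum_mul_left, mul_add, add_comm,
    ← tsum_mul_left]
  congr 1
  · refine tsum_congr fun j => ?_
    rw [Finset.prod_range_succ' _ (j + 1), pow_succ]
    simp only [zero_add]
    field_simp
  · simp
    field_simp

/-- The function whose graph is the unstable manifold along a preorbit. -/
noncomputable def unstableFun (_P : Params δ s₀ η ε lam f₁ f₂ φ m M ρ θ q) (k : ℕ → ℤ) (n : ℕ)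
    (t : ℝ) : ℝ :=
  ∑' j : ℕ, ε * lam ^ j * Real.sin (invBranch f₂ k (n + j + 1) t)

theorem norm_unstableFun_term_le (P : Params δ s₀ η ε lam f₁ f₂ φ m M ρ θ q) (x : ℝ) (j : ℕ) :
    ‖ε * lam ^ j * Real.sin x‖ ≤ ε * (1 / 4) ^ j := by
  rw [norm_mul, norm_mul, norm_pow, Real.norm_of_nonneg P.ε_pos.le,
    Real.norm_of_nonneg P.lam_pos.le]
  calc ε * lam ^ j * ‖Real.sin x‖ ≤ ε * lam ^ j * 1 :=
        mul_le_mul_of_nonneg_left (Real.abs_sin_le_one x)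
          (mul_nonneg P.ε_pos.le (pow_nonneg P.lam_pos.le _))
    _ ≤ ε * (1 / 4) ^ j := by
        rw [mul_one]
        refine mul_le_mul_of_nonneg_left (pow_le_pow_left₀ P.lam_pos.le ?_ j) P.ε_pos.le
        linarith [P.lam_le]

theorem summable_unstableFun (P : Params δ s₀ η ε lam f₁ f₂ φ m M ρ θ q) (k : ℕ → ℤ) (n : ℕ)
    (t : ℝ) : Summable fun j : ℕ => ε * lam ^ j * Real.sin (invBranch f₂ k (n + j + 1) t) :=
  Summable.of_norm_bounded (hasSum_bound ε).summable fun j => P.norm_unstableFun_term_le _ j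

theorem abs_unstableFun_le (P : Params δ s₀ η ε lam f₁ f₂ φ m M ρ θ q) (k : ℕ → ℤ) (n : ℕ)
    (t : ℝ) : |P.unstableFun k n t| ≤ 2 * ε :=
  (tsum_of_norm_bounded (hasSum_bound ε) fun j => P.norm_unstableFun_term_le _ j).trans
    (by linarith [P.ε_pos])

theorem unstableFun_succ (P : Params δ s₀ η ε lam f₁ f₂ φ m M ρ θ q) (k : ℕ → ℤ) (n : ℕ)
    (t : ℝ) : P.unstableFun k n t =
      lam * P.unstableFun k (n + 1) t + ε * Real.sin (invBranch f₂ k (n + 1) t) := by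
  rw [unstableFun, (P.summable_unstableFun k n t).tsum_eq_zero_add, unstableFun, ← tsum_mul_left,
    add_comm]
  congr 1
  · refine tsum_congr fun j => ?_
    rw [show n + (j + 1) + 1 = n + 1 + j + 1 by ring, pow_succ]
    ring
  · simp

/-- Two bounded solutions differ by a sequence with D n = λ D (n + 1), which is zero. Hence the
s-coordinates of a preorbit in the annulus are functions of its t-coordinates, and unstable sets are
graphs. -/
theorem eq_unstableFun (P : Params δ s₀ η ε lam f₁ f₂ φ m M ρ θ q) {k : ℕ → ℤ} {t : ℝ}
    {X : ℕ → ℝ} (hX : ∀ n, |X n| ≤ 2 * ε)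
    (h : ∀ n, X n = lam * X (n + 1) + ε * Real.sin (invBranch f₂ k (n + 1) t)) (n : ℕ) :
    X n = P.unstableFun k n t := by
  refine sub_eq_zero.1 (eq_zero_of_eq_mul_succ (D := fun n => X n - P.unstableFun k n t)
    (B := 4 * ε) P.lam_pos.le P.lam_lt_one (fun n => ?_) (fun n => ?_) n)
  · have h1 := hX n
    have h2 := P.abs_unstableFun_le k n t
    refine (abs_sub _ _).trans ?_
    linarith
  · rw [h n, P.unstableFun_succ]
    ring

/-- Termwise differentiation, with the geometric bound on the slope series as majorant. -/
theorem hasDerivAt_unstableFun (P : Params δ s₀ η ε lam f₁ f₂ φ m M ρ θ q) (k : ℕ → ℤ) (t : ℝ) :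
    HasDerivAt (P.unstableFun k 0) (P.slope fun n => invBranch f₂ k n t) t := by
  have := hasDerivAt_tsum (𝕜 := ℝ) (F := ℝ)
    (g := fun j t => ε * lam ^ j * Real.sin (invBranch f₂ k (0 + j + 1) t))
    (g' := fun j t => ε * lam ^ j * (Real.cos (invBranch f₂ k (j + 1) t) *
      ∏ i ∈ Finset.range (j + 1), (deriv f₂ (invBranch f₂ k (i + 1) t))⁻¹))
    (u := fun j => ε / m * (1 / 4) ^ j) (y₀ := t) (hasSum_bound _).summable
    (fun j y => by
      rw [zero_add]
      exact (P.H.hasDerivAt_invBranch k (j + 1) y).sin.const_mul _)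
    (fun j y => P.norm_slope_term_le (fun i => invBranch f₂ k (i + 1) y) _ j)
    (P.summable_unstableFun k 0 t) t
  exact this

theorem abs_unstableFun_sub_le (P : Params δ s₀ η ε lam f₁ f₂ φ m M ρ θ q) {k : ℕ → ℤ}
    {t t' d : ℝ} (h : ∀ n, |invBranch f₂ k n t - invBranch f₂ k n t'| ≤ d) (n : ℕ) :
    |P.unstableFun k n t - P.unstableFun k n t'| ≤ d := by
  have hd : 0 ≤ d := (abs_nonneg _).trans (h 0)
  rw [unstableFun, unstableFun,
    ← (P.summable_unstableFun k n t).tsum_sub (P.summable_unstableFun k n t')]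
  refine (tsum_of_norm_bounded (E := ℝ) (hasSum_bound (ε * d)) fun j => ?_).trans ?_
  · rw [← mul_sub, norm_mul, norm_mul, norm_pow, Real.norm_of_nonneg P.ε_pos.le,
      Real.norm_of_nonneg P.lam_pos.le, mul_right_comm]
    have h1 : ‖Real.sin (invBranch f₂ k (n + j + 1) t) - Real.sin (invBranch f₂ k (n + j + 1) t')‖
        ≤ d := (Real.abs_sin_sub_sin_le _ _).trans (h _)
    refine mul_le_mul (mul_le_mul_of_nonneg_left h1 P.ε_pos.le)
      (pow_le_pow_left₀ P.lam_pos.le ?_ j) (pow_nonneg P.lam_pos.le _) (mul_nonneg P.ε_pos.le hd)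
    linarith [P.lam_le]
  · nlinarith [P.ε_lt, P.ε_pos]

end Params

theorem IsPreorbit.iterate {X : Type*} {g : X → X} {w : ℕ → X} (hw : IsPreorbit g w) (n k : ℕ) :
    g^[k] (w (n + k)) = w n := by
  induction k with
  | zero => rfl
  | succ k ih => rw [Function.iterate_succ_apply, ← add_assoc, hw, ih]

theorem IsPreorbit.shift {X : Type*} {g : X → X} {w : ℕ → X} (hw : IsPreorbit g w) (k : ℕ) :
    IsPreorbit g fun n => w (n + k) := fun n => by
  have := hw (n + k)
  rwa [add_right_comm] at this

namespace Params

variable {δ s₀ η ε lam : ℝ} {f₁ f₂ φ : ℝ → ℝ} {m M ρ θ q : ℝ}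

/-! ### The differential of the iterates -/

theorem exists_diff_horizontal (P : Params δ s₀ η ε lam f₁ f₂ φ m M ρ θ q) (n : ℕ) (z : T2) :
    ∃ c : ℝ, c ≠ 0 ∧ P.map.diff n z (1, 0) = c • ((1, 0) : ℝ × ℝ) := by
  induction n with
  | zero => exact ⟨1, one_ne_zero, by simp [TorusEndo.diff_zero_apply]⟩
  | succ n ih =>
    obtain ⟨c, hc, h⟩ := ih
    set x := circRep (P.map.toFun^[n] z).1
    set y := circRep (P.map.toFun^[n] z).2
    refine ⟨c * (deriv f₁ x + Real.sin y * deriv φ x), mul_ne_zero hc (P.fibre_deriv_pos x y).ne',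
      ?_⟩
    have e := P.diff_one_apply x y (1, 0)
    rw [coe_circRep, coe_circRep] at e
    rw [TorusEndo.diff_succ_apply, h, map_smul, e]
    simp

theorem map_diff_horizontal (P : Params δ s₀ η ε lam f₁ f₂ φ m M ρ θ q) (n : ℕ) (z : T2) :
    (Submodule.span ℝ {((1, 0) : ℝ × ℝ)}).map (P.map.diff n z).toLinearMap =
      Submodule.span ℝ {((1, 0) : ℝ × ℝ)} := by
  obtain ⟨c, hc, h⟩ := P.exists_diff_horizontal n z
  rw [Submodule.map_span, image_singleton]
  refine (congrArg (fun v => Submodule.span ℝ {v}) h).trans ?_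
  exact Submodule.span_singleton_smul_eq hc.isUnit _

theorem comap_diff_horizontal (P : Params δ s₀ η ε lam f₁ f₂ φ m M ρ θ q) (n : ℕ) (z : T2) :
    (Submodule.span ℝ {((1, 0) : ℝ × ℝ)}).comap (P.map.diff n z).toLinearMap =
      Submodule.span ℝ {((1, 0) : ℝ × ℝ)} := by
  conv_lhs => rw [← P.map_diff_horizontal n z]
  exact Submodule.comap_map_eq_of_injective (P.injective_diff n z) _

theorem diff_saddlePt (P : Params δ s₀ η ε lam f₁ f₂ φ m M ρ θ q) (n : ℕ) (v : ℝ × ℝ) :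
    P.map.diff n saddlePt v = (deriv f₁ Real.pi ^ n * v.1, deriv f₂ 0 ^ n * v.2) := by
  induction n with
  | zero => simp [TorusEndo.diff_zero_apply]
  | succ n ih =>
    have e := P.diff_one_apply_pi 0 (P.map.diff n saddlePt v)
    rw [TorusEndo.diff_succ_apply, Function.iterate_fixed P.map_saddlePt]
    refine e.trans ?_
    rw [ih, pow_succ', pow_succ', mul_assoc, mul_assoc]

/-! ### The two types of preorbits -/

theorem fst_eq (P : Params δ s₀ η ε lam f₁ f₂ φ m M ρ θ q) {x x' y' : ℝ} {t : Circ}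
    (hx : |x| ≤ 2 * ε) (hx' : |x'| ≤ 2 * ε)
    (h : P.map ((x' : Circ), (y' : Circ)) = ((x : Circ), t)) : x = lam * x' + ε * Real.sin y' := by
  rw [P.map_proj_of_lt (hx'.trans_lt P.ε_lt_s₀)] at h
  refine (eq_of_coe_eq (congrArg Prod.fst h) ?_).symm
  have h1 : |lam * x'| ≤ 1 := by
    rw [abs_mul, abs_of_pos P.lam_pos]
    have := mul_le_mul P.lam_lt_one.le (hx'.trans P.ε_lt.le) (abs_nonneg _) zero_le_one
    linarith
  have h2 : |ε * Real.sin y'| ≤ ε := by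
    rw [abs_mul, abs_of_pos P.ε_pos]
    exact mul_le_of_le_one_right P.ε_pos.le (Real.abs_sin_le_one _)
  have h3 := P.ε_lt
  have h4 := Real.pi_gt_three
  rw [abs_le] at hx h1 h2
  rw [abs_lt]
  constructor <;> linarith

/-- Coming from k steps back inside |t| ≤ r < δ, the present t is bounded by the k-th iterate of r,
which tends to 0. -/
theorem snd_eq_zero_of_preorbit (P : Params δ s₀ η ε lam f₁ f₂ φ m M ρ θ q) {w : ℕ → T2}
    (hw : IsPreorbit P.map.toFun w) {r : ℝ} (hr : r < δ) (h : ∀ n, ‖(w n).2‖ ≤ r) :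
    (w 0).2 = 0 := by
  have hr0 : 0 ≤ r := (norm_nonneg _).trans (h 0)
  have key : ∀ k, ‖(w 0).2‖ ≤ f₂^[k] r := by
    intro k
    have e := hw.iterate 0 k
    rw [zero_add] at e
    rw [← e, P.iterate_snd, P.H.norm_circ_iterate ((h k).trans hr.le)]
    exact P.H.map.strictMono.monotone.iterate k (h k)
  exact norm_le_zero_iff.1 (ge_of_tendsto' (P.H.tendsto_iterate hr0 hr) key)

theorem snd_eq_zero_of_tendsto (P : Params δ s₀ η ε lam f₁ f₂ φ m M ρ θ q) {w : ℕ → T2}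
    (hw : IsPreorbit P.map.toFun w)
    (h : Tendsto (fun n => dist saddlePt (w n)) atTop (𝓝 0)) (n : ℕ) : (w n).2 = 0 := by
  obtain ⟨N, hN⟩ := eventually_atTop.1 (h.eventually (gt_mem_nhds (half_pos P.H.δ_pos)))
  have h0 : (w (n + N)).2 = 0 := by
    have := P.snd_eq_zero_of_preorbit (hw.shift (n + N)) (half_lt_self P.H.δ_pos) fun k => by
      have h1 : dist saddlePt.2 (w (k + (n + N))).2 ≤ dist saddlePt (w (k + (n + N))) :=
        le_max_right _ _
      rw [show saddlePt.2 = 0 from rfl, dist_zero_left] at h1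
      exact h1.trans (hN _ (by omega)).le
    simpa using this
  rw [← hw.iterate n N, P.iterate_snd, h0]
  exact Function.iterate_fixed P.H.circ_zero N

theorem exists_lt_norm_of_tendsto (P : Params δ s₀ η ε lam f₁ f₂ φ m M ρ θ q) {w : ℕ → T2}
    (h : Tendsto (fun n => dist saddlePt (w n)) atTop (𝓝 0)) : ∃ n, 2 * ε < ‖(w n).1‖ := by
  obtain ⟨n, hn⟩ := (h.eventually (gt_mem_nhds one_pos)).exists
  refine ⟨n, ?_⟩
  have h1 : dist ((Real.pi : ℝ) : Circ) (w n).1 ≤ dist saddlePt (w n) := le_max_left _ _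
  have h2 := norm_sub_norm_le ((Real.pi : ℝ) : Circ) (w n).1
  rw [norm_eq_pi_iff.2 rfl, ← dist_eq_norm] at h2
  linarith [P.ε_lt, Real.pi_gt_three]

/-- Far in the past the preorbit lies in |s| < s₀; one further step puts it into |s| ≤ 2ε, which it
never leaves. -/
theorem norm_fst_le_of_tendsto (P : Params δ s₀ η ε lam f₁ f₂ φ m M ρ θ q) {x w : ℕ → T2}
    (hw : IsPreorbit P.map.toFun w) (hx : ∀ n, x n ∈ P.solenoid)
    (h : Tendsto (fun n => dist (x n) (w n)) atTop (𝓝 0)) (n : ℕ) : ‖(w n).1‖ ≤ 2 * ε := by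
  obtain ⟨N, hN⟩ := eventually_atTop.1 (h.eventually (gt_mem_nhds (sub_pos.2 P.ε_lt_s₀)))
  have h0 : ‖(w (n + N + 1)).1‖ < s₀ := by
    have h1 : dist (x (n + N + 1)).1 (w (n + N + 1)).1 ≤ dist (x (n + N + 1)) (w (n + N + 1)) :=
      le_max_left _ _
    have h2 := norm_sub_norm_le (w (n + N + 1)).1 (x (n + N + 1)).1
    rw [← dist_eq_norm, dist_comm] at h2
    linarith [hN (n + N + 1) (by omega), (P.solenoid_subset (hx (n + N + 1))).1]
  have h1 := P.norm_map_fst_le h0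
  rw [hw] at h1
  rw [← hw.iterate n N]
  exact P.norm_iterate_fst_le h1 N

/-- Both parts of Γ are forward invariant and larger indices are mapped to smaller ones, so a
preorbit cannot meet both. -/
theorem pastAsymptotic_cases (P : Params δ s₀ η ε lam f₁ f₂ φ m M ρ θ q) {x w : ℕ → T2}
    (h : P.map.IsPastAsymptotic x w) :
    (∀ n, x n = saddlePt) ∨ ∀ n, x n ∈ P.solenoid := by
  obtain ⟨hx, hg, -⟩ := h
  simp only [P.gammaSet_eq] at hg
  have key : ∀ {C : Set T2}, MapsTo P.map.toFun C C → ∀ {n k : ℕ}, n ≤ k → x k ∈ C → x n ∈ C := by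
    intro C hC n k hnk hk
    obtain ⟨j, rfl⟩ := Nat.exists_eq_add_of_le hnk
    rw [← hx.iterate n j]
    exact hC.iterate j hk
  by_contra! hne
  obtain ⟨⟨n, hn⟩, ⟨k, hk⟩⟩ := hne
  have h1 := key P.mapsTo_saddlePt (min_le_right n k) ((hg k).resolve_right hk)
  have h2 := key P.mapsTo_solenoid (min_le_left n k) ((hg n).resolve_left hn)
  rw [mem_singleton_iff.1 h1] at h2
  exact P.saddlePt_notMem_solenoid h2

/-! ### Unstable spaces of the saddle fixed point -/

/-- On t = 0 the sine vanishes and the map reduces to `f₁`, whose inverse does not increase the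
distance to π. -/
theorem exists_preorbit_horizontal (P : Params δ s₀ η ε lam f₁ f₂ φ m M ρ θ q) (a : Circ) :
    ∃ w : ℕ → T2, w 0 = (a, 0) ∧ IsPreorbit P.map.toFun w ∧
      ∀ n, dist saddlePt (w n) ≤ dist ((Real.pi : ℝ) : Circ) a := by
  have step : ∀ a : Circ, ∃ a' : Circ, P.map (a', 0) = (a, 0) ∧
      dist ((Real.pi : ℝ) : Circ) a' ≤ dist ((Real.pi : ℝ) : Circ) a := by
    intro a
    obtain ⟨x, rfl, hx⟩ := exists_coe_eq_abs_sub a Real.pi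
    have hxπ : |x - Real.pi| ≤ Real.pi := by
      rw [hx, dist_eq_norm]
      exact norm_circ_le_pi _
    obtain ⟨y, hy⟩ := P.fibre_surjective 0 x
    simp only [Real.sin_zero, zero_mul, add_zero] at hy
    refine ⟨(y : Circ), ?_, ?_⟩
    · have e := P.map_proj y 0
      rwa [Real.sin_zero, zero_mul, add_zero, hy, P.H.map.map_zero] at e
    · rw [dist_comm, dist_comm _ (x : Circ), ← hx]
      refine (dist_coe_le _ _).trans ?_
      have hm := P.h₁.strictMono
      have h0 := P.h₁.map_zero
      have hπ := P.h₁.map_pi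
      have hle : ∀ s, 0 ≤ s → s ≤ Real.pi → f₁ s ≤ s := by
        intro s hs hs'
        rcases hs.eq_or_lt with rfl | hs
        · exact h0.le
        rcases hs'.eq_or_lt with rfl | hs'
        · exact hπ.le
        exact (P.h₁.lt_self s hs hs').le
      rw [abs_le] at hxπ
      rcases le_total x Real.pi with h | h
      · have h1 : y ≤ Real.pi := hm.le_iff_le.1 (by rw [hy, hπ]; exact h)
        have h2 : 0 ≤ y := hm.le_iff_le.1 (by rw [hy, h0]; linarith)
        have h3 := hle y h2 h1
        rw [abs_of_nonpos (by linarith), abs_of_nonpos (by linarith)]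
        linarith
      -- Reflection in π, a symmetry of `f₁`, reduces to the interval [0, π].
      · have e : f₁ (2 * Real.pi - y) = 2 * Real.pi - x := by
          rw [show 2 * Real.pi - y = -y + 2 * Real.pi by ring, P.h₁.add_period, P.h₁.odd, hy]
          ring
        have h1 : Real.pi ≤ y := hm.le_iff_le.1 (by rw [hy, hπ]; exact h)
        have h2 : 0 ≤ 2 * Real.pi - y := hm.le_iff_le.1 (by rw [e, h0]; linarith)
        have h3 := hle _ h2 (by linarith)
        rw [abs_of_nonneg (by linarith), abs_of_nonneg (by linarith)]
        linarith
  choose F hF hF' using step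
  refine ⟨fun n => (F^[n] a, 0), rfl, fun n => ?_, fun n => ?_⟩
  · simp only [Function.iterate_succ_apply']
    exact hF _
  · rw [Prod.dist_eq, show saddlePt.2 = 0 from rfl, dist_self, max_eq_left dist_nonneg]
    induction n with
    | zero => rfl
    | succ n ih =>
      simp only [Function.iterate_succ_apply']
      exact (hF' _).trans ih

theorem mem_localUnstable_saddlePt (P : Params δ s₀ η ε lam f₁ f₂ φ m M ρ θ q) {r : ℝ}
    (hr : r < δ) {y : T2} : y ∈ P.map.localUnstable r (fun _ => saddlePt) ↔
      y.2 = 0 ∧ dist ((Real.pi : ℝ) : Circ) y.1 < r := by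
  constructor
  · rintro ⟨w, rfl, hw, h⟩
    have h2 : ∀ n, ‖(w n).2‖ ≤ r := fun n => by
      have h1 : dist saddlePt.2 (w n).2 ≤ dist saddlePt (w n) := le_max_right _ _
      rw [show saddlePt.2 = 0 from rfl, dist_zero_left] at h1
      exact h1.trans (h n).le
    exact ⟨P.snd_eq_zero_of_preorbit hw hr h2, (le_max_left _ _).trans_lt (h 0)⟩
  · rintro ⟨h2, h1⟩
    obtain ⟨w, hw0, hw, h⟩ := P.exists_preorbit_horizontal y.1
    exact ⟨w, hw0.trans (Prod.ext rfl h2.symm), hw, fun n => (h n).trans_lt h1⟩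

theorem eventually_eq_of_coe_eq (a : ℝ) :
    ∀ᶠ y : ℝ in 𝓝 a, (y : Circ) = (a : Circ) → y = a := by
  filter_upwards [Metric.ball_mem_nhds a one_pos] with y hy h
  rw [Metric.mem_ball, Real.dist_eq] at hy
  exact eq_of_coe_eq h (by linarith [Real.pi_gt_three])

/-- A single excursion outside |s| ≤ 2ε excludes Γ₀ as the past limit, so the reference preorbit is
the constant one at the saddle point. -/
theorem isUnstableSpace_horizontal (P : Params δ s₀ η ε lam f₁ f₂ φ m M ρ θ q) {w : ℕ → T2}
    (hw : IsPreorbit P.map.toFun w) (hfar : ∃ n, 2 * ε < ‖(w n).1‖) :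
    P.map.IsUnstableSpace w (Submodule.span ℝ {(1, 0)}) := by
  intro x hx
  have hxs : ∀ n, x n = saddlePt := by
    refine (P.pastAsymptotic_cases hx).resolve_right fun h => ?_
    obtain ⟨n, hn⟩ := hfar
    exact (P.norm_fst_le_of_tendsto hw h hx.2.2 n).not_gt hn
  have hlim : Tendsto (fun n => dist saddlePt (w n)) atTop (𝓝 0) := by
    simpa only [hxs] using hx.2.2
  refine ⟨δ, P.H.δ_pos, fun r hr hrδ => ?_⟩
  obtain ⟨N, hN⟩ := eventually_atTop.1 (hlim.eventually (gt_mem_nhds hr))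
  refine eventually_atTop.2 ⟨N, fun k hk => ?_⟩
  have e : (fun n => x (n + k)) = fun _ => saddlePt := funext fun n => hxs _
  have hw2 := P.snd_eq_zero_of_tendsto hw hlim k
  have hw1 : dist ((Real.pi : ℝ) : Circ) (w k).1 < r := (le_max_left _ _).trans_lt (hN k hk)
  have ht : tangentSpaceOf (P.map.localUnstable r fun n => x (n + k)) (w k) =
      Submodule.span ℝ {(1, 0)} := by
    refine tangentSpaceOf_horizontal ?_ ?_
    · have h1 := (continuous_snd.tendsto (torusRep (w k))).eventually
        (eventually_eq_of_coe_eq (circRep (w k).2))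
      filter_upwards [h1] with y hy hyS
      rw [e, P.mem_localUnstable_saddlePt hrδ] at hyS
      refine hy ?_
      rw [coe_circRep, hw2]
      exact hyS.1
    · have hc : Continuous fun s : ℝ => dist ((Real.pi : ℝ) : Circ) (s : Circ) :=
        continuous_const.dist continuous_coe_circ
      have hlt : dist ((Real.pi : ℝ) : Circ) (circRep (w k).1 : Circ) < r := by
        rwa [coe_circRep]
      have := (hc.tendsto (circRep (w k).1)).eventually_lt_const hlt
      filter_upwards [this] with s hs
      rw [e, P.mem_localUnstable_saddlePt hrδ]
      refine ⟨?_, hs⟩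
      rw [hw2]
      exact coe_circRep 0
  rw [ht, P.map_diff_horizontal, e, P.mem_localUnstable_saddlePt hrδ]
  exact ⟨⟨hw2, hw1⟩, rfl⟩

/-! ### Unstable spaces of the solenoid -/

/-- A preorbit staying close to `w` uses the same inverse branches of `f₂`, so its starting point
lies on the graph of the unstable function. Conversely, points of the graph near w 0 have preorbits
along these branches, which stay close because `w` avoids the contracting region. The tangent line
is that of the graph. -/
theorem tangentSpaceOf_localUnstable (P : Params δ s₀ η ε lam f₁ f₂ φ m M ρ θ q) {x w : ℕ → T2}
    (hw : IsPreorbit P.map.toFun w) (hnear : ∀ n, ‖(w n).1‖ ≤ 2 * ε)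
    (hδ : ∀ n, δ - ρ / 2 ≤ ‖(w n).2‖) {r : ℝ} (hr : 0 < r) (hxw : ∀ n, dist (x n) (w n) ≤ r / 2)
    (hr₁ : 2 * ε + 2 * r < s₀) (hr₂ : (M + 1) * (2 * r) ≤ 1) :
    tangentSpaceOf (P.map.localUnstable r x) (w 0) =
      Submodule.span ℝ {(P.slope fun n => circRep (w n).2, 1)} := by
  set T : ℕ → ℝ := fun n => circRep (w n).2 with hTdef
  have hM := P.H.one_le_M
  have hεlt := P.ε_lt
  have hπ := Real.pi_gt_three
  have hr1 : 2 * r ≤ 1 := by nlinarith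
  have hT : ∀ n, ((T n : ℝ) : Circ) = (w n).2 := fun n => coe_circRep _
  have hk : ∀ n, ∃ k : ℤ, f₂ (T (n + 1)) = T n + k * (2 * Real.pi) := fun n => by
    refine exists_int_of_coe_eq ?_
    rw [← P.H.circ_coe, hT, hT, ← P.map_snd]
    exact congrArg Prod.snd (hw n)
  choose k hk using hk
  have hX : ∀ n, |circRep (w n).1| ≤ 2 * ε := fun n => by rw [abs_circRep]; exact hnear n
  have hXΨ : ∀ n, circRep (w n).1 = P.unstableFun k n (T 0) :=
    P.eq_unstableFun hX fun n => by
      rw [← P.H.eq_invBranch hk]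
      refine P.fst_eq (t := (w n).2) (hX n) (hX (n + 1)) ?_
      rw [hT, coe_circRep, coe_circRep]
      exact hw n
  refine tangentSpaceOf_graph (Φ := P.unstableFun k 0) ?_ (hXΨ 0).symm ?_ ?_
  · have := P.hasDerivAt_unstableFun k (T 0)
    rwa [show (fun n => invBranch f₂ k n (T 0)) = T from
      funext fun n => (P.H.eq_invBranch hk n).symm] at this
  · have h1 : ∀ᶠ y : ℝ × ℝ in 𝓝 (torusRep (w 0)), |y.1 - circRep (w 0).1| < 1 :=
      (by fun_prop : Continuous fun y : ℝ × ℝ => |y.1 - circRep (w 0).1|).tendsto _ |>.eventually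
        (gt_mem_nhds (by simp [torusRep]))
    have h2 : ∀ᶠ y : ℝ × ℝ in 𝓝 (torusRep (w 0)), |y.2 - T 0| < 1 :=
      (by fun_prop : Continuous fun y : ℝ × ℝ => |y.2 - T 0|).tendsto _ |>.eventually
        (gt_mem_nhds (by simp [torusRep, hTdef]))
    filter_upwards [h1, h2] with y hy1 hy2
    rintro ⟨w', hw'0, hw', hd⟩
    have hd' : ∀ n, dist (w' n) (w n) < 2 * r := fun n => by
      have := dist_triangle_left (w' n) (w n) (x n)
      linarith [hd n, hxw n]
    have hT' : ∀ n, ∃ t : ℝ, (t : Circ) = (w' n).2 ∧ |t - T n| < 2 * r := fun n => by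
      obtain ⟨t, ht, ht'⟩ := exists_coe_eq_abs_sub (w' n).2 (T n)
      refine ⟨t, ht, ?_⟩
      rw [ht', hT]
      exact (le_max_right _ _).trans_lt (hd' n)
    choose T' hT' hTT' using hT'
    -- The same integers k n serve for both preorbits: the discrepancy is at most (M + 1) · 2r ≤ 1,
    -- less than a period.
    have hk' : ∀ n, f₂ (T' (n + 1)) = T' n + k n * (2 * Real.pi) := fun n => by
      refine eq_of_coe_eq ?_ ?_
      · rw [coe_add_int_mul, ← P.H.circ_coe, hT', hT', ← P.map_snd]
        exact congrArg Prod.snd (hw' n)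
      · have h3 := P.H.abs_sub_le (T' (n + 1)) (T (n + 1))
        have h4 := mul_le_mul_of_nonneg_left (hTT' (n + 1)).le (by linarith : 0 ≤ M)
        have h5 := hTT' n
        have e : f₂ (T' (n + 1)) - (T' n + k n * (2 * Real.pi)) =
            (f₂ (T' (n + 1)) - f₂ (T (n + 1))) - (T' n - T n) := by rw [hk]; ring
        rw [e]
        refine (abs_sub _ _).trans_lt ?_
        nlinarith
    have hnear' : ∀ n, ‖(w' n).1‖ ≤ 2 * ε := fun n => by
      rw [← hw' n]
      refine P.norm_map_fst_le ?_
      have h3 : dist (w' (n + 1)).1 (w (n + 1)).1 ≤ dist (w' (n + 1)) (w (n + 1)) :=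
        le_max_left _ _
      have h4 := norm_sub_norm_le (w' (n + 1)).1 (w (n + 1)).1
      rw [← dist_eq_norm] at h4
      linarith [hd' (n + 1), hnear (n + 1)]
    have hX' : ∀ n, |circRep (w' n).1| ≤ 2 * ε := fun n => by rw [abs_circRep]; exact hnear' n
    have h0 := P.eq_unstableFun (t := T' 0) hX' (fun n => by
      rw [← P.H.eq_invBranch hk']
      refine P.fst_eq (t := (w' n).2) (hX' n) (hX' (n + 1)) ?_
      rw [hT', coe_circRep, coe_circRep]
      exact hw' n) 0
    have e2 : y.2 = T' 0 := by
      refine eq_of_coe_eq ?_ ?_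
      · rw [hT', hw'0]; rfl
      · have := abs_sub_le y.2 (T 0) (T' 0)
        have h6 := hTT' 0
        rw [abs_sub_comm] at h6
        linarith
    have e1 : y.1 = circRep (w' 0).1 := by
      refine eq_of_coe_eq ?_ ?_
      · rw [coe_circRep, hw'0]; rfl
      · have h6 := hX' 0
        have h7 := hX 0
        rw [abs_le] at h6 h7
        rw [abs_lt] at hy1 ⊢
        constructor <;> linarith
    rw [e1, e2, h0]
  · have hpos : 0 < min (m * (ρ / 2)) (r / 2) :=
      lt_min (mul_pos P.H.m_pos (half_pos P.H.ρ_pos)) (half_pos hr)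
    filter_upwards [Metric.ball_mem_nhds (T 0) hpos] with t ht
    rw [Metric.mem_ball, Real.dist_eq, lt_min_iff] at ht
    have hb : ∀ n, |invBranch f₂ k n t - T n| ≤ |t - T 0| :=
      P.H.abs_invBranch_sub_le hk (fun n => by rw [hT]; exact hδ n) ht.1.le
    have hΨ := P.abs_unstableFun_sub_le (k := k) (t := t) (t' := T 0) fun n => by
      rw [← P.H.eq_invBranch hk]; exact hb n
    refine ⟨fun n => ((P.unstableFun k n t : ℝ), (invBranch f₂ k n t : ℝ)), rfl, fun n => ?_,
      fun n => ?_⟩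
    · refine (P.map_proj_of_lt ((P.abs_unstableFun_le k (n + 1) t).trans_lt P.ε_lt_s₀) _).trans ?_
      rw [P.H.map_invBranch_succ, coe_add_int_mul, ← P.unstableFun_succ]
    · have h1 : dist (w n) (((P.unstableFun k n t : ℝ) : Circ), ((invBranch f₂ k n t : ℝ) : Circ))
          ≤ |t - T 0| := by
        rw [dist_comm]
        refine max_le ?_ ?_
        · have := dist_coe_le (P.unstableFun k n t) (circRep (w n).1)
          rw [coe_circRep, hXΨ] at this
          exact this.trans (hΨ n)
        · have := dist_coe_le (invBranch f₂ k n t) (T n)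
          rw [hT] at this
          exact this.trans (hb n)
      refine (dist_triangle _ (w n) _).trans_lt ?_
      linarith [hxw n]

theorem map_diff_slope (P : Params δ s₀ η ε lam f₁ f₂ φ m M ρ θ q) {w : ℕ → T2}
    (hw : IsPreorbit P.map.toFun w) (hnear : ∀ n, ‖(w n).1‖ ≤ 2 * ε) (k : ℕ) :
    (Submodule.span ℝ {(P.slope fun n => circRep (w (n + k)).2, (1 : ℝ))}).map
      (P.map.diff k (w k)).toLinearMap =
      Submodule.span ℝ {(P.slope fun n => circRep (w n).2, (1 : ℝ))} := by
  induction k with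
  | zero =>
    have : (P.map.diff 0 (w 0)).toLinearMap = LinearMap.id :=
      LinearMap.ext fun v => TorusEndo.diff_zero_apply _ _ v
    rw [this, Submodule.map_id]
    rfl
  | succ k ih =>
    have e : (P.map.diff (k + 1) (w (k + 1))).toLinearMap =
        (P.map.diff k (w k)).toLinearMap ∘ₗ (P.map.diff 1 (w (k + 1))).toLinearMap := by
      refine LinearMap.ext fun v => ?_
      have := P.map.diff_add_apply 1 k (w (k + 1)) v
      rw [Function.iterate_one, hw k] at this
      exact this
    have h := P.slope_succ fun n => circRep (w (n + k)).2
    simp only [show 1 + k = k + 1 from add_comm 1 k, add_right_comm _ 1 k] at h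
    rw [e, Submodule.map_comp, P.map_span_slope ((hnear (k + 1)).trans_lt P.ε_lt_s₀)
      (u := P.slope fun n => circRep (w (n + (k + 1))).2)
      (u' := P.slope fun n => circRep (w (n + k)).2) h, ih]

theorem isUnstableSpace_slope (P : Params δ s₀ η ε lam f₁ f₂ φ m M ρ θ q) {w : ℕ → T2}
    (hw : IsPreorbit P.map.toFun w) (hnear : ∀ n, ‖(w n).1‖ ≤ 2 * ε) :
    P.map.IsUnstableSpace w (Submodule.span ℝ {(P.slope fun n => circRep (w n).2, 1)}) := by
  intro x hx
  have hxs : ∀ n, x n ∈ P.solenoid := by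
    refine (P.pastAsymptotic_cases hx).resolve_left fun h => ?_
    obtain ⟨n, hn⟩ := P.exists_lt_norm_of_tendsto (w := w) (by simpa only [h] using hx.2.2)
    exact (hnear n).not_gt hn
  have hM := P.H.one_le_M
  -- The first bound keeps nearby preorbits where the map is affine in s, the second makes the
  -- choice of inverse branches unambiguous.
  refine ⟨min ((s₀ - 2 * ε) / 2) (1 / (2 * (M + 1))),
    lt_min (by linarith [P.ε_lt_s₀]) (by positivity), fun r hr hr' => ?_⟩
  rw [lt_min_iff, lt_div_iff₀ (by positivity), lt_div_iff₀ (by positivity)] at hr'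
  obtain ⟨N, hN⟩ := eventually_atTop.1
    (hx.2.2.eventually (gt_mem_nhds (lt_min (half_pos hr) (half_pos P.H.ρ_pos))))
  refine eventually_atTop.2 ⟨N, fun k hk => ?_⟩
  have hd : ∀ n, dist (x (n + k)) (w (n + k)) < r / 2 ∧ dist (x (n + k)) (w (n + k)) < ρ / 2 :=
    fun n => lt_min_iff.1 (hN (n + k) (by omega))
  refine ⟨⟨fun n => w (n + k), by simp, hw.shift k, fun n => (hd n).1.trans (half_lt_self hr)⟩, ?_⟩
  have ht := P.tangentSpaceOf_localUnstable (x := fun n => x (n + k)) (hw.shift k)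
    (fun n => hnear (n + k)) (fun n => ?_) hr (fun n => (hd n).1.le) (by linarith) (by linarith)
  · rw [zero_add] at ht
    rw [ht, P.map_diff_slope hw hnear]
  · have h1 : dist (x (n + k)).2 (w (n + k)).2 ≤ dist (x (n + k)) (w (n + k)) := le_max_right _ _
    have h2 := norm_sub_norm_le (x (n + k)).2 (w (n + k)).2
    rw [← dist_eq_norm] at h2
    have h3 := SecondConsts.norm_le_of_mem_repeller (P.solenoid_subset (hxs (n + k))).2
    linarith [(hd n).2]

end Params

/-! ### Branching of preorbits in the annulus -/

theorem cos_circRep_coe (x : ℝ) : Real.cos (circRep (x : Circ)) = Real.cos x := by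
  obtain ⟨n, hn⟩ := exists_int_of_coe_eq (coe_circRep (x : Circ))
  rw [hn, Real.cos_add_int_mul_two_pi]

theorem le_two_mul_sin {x : ℝ} (h0 : 0 ≤ x) (h : x ≤ Real.pi / 2) : x ≤ 2 * Real.sin x := by
  have h1 := Real.mul_le_sin h0 h
  have h2 : x / 2 ≤ 2 / Real.pi * x := by
    rw [div_mul_eq_mul_div, div_le_div_iff₀ two_pos Real.pi_pos]
    nlinarith [Real.pi_le_four]
  linarith

theorem le_or_le_of_sin_le {x c : ℝ} (h0 : 0 ≤ x) (hπ : x ≤ Real.pi) (h : Real.sin x ≤ c) :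
    x ≤ 2 * c ∨ Real.pi - x ≤ 2 * c := by
  rcases le_total x (Real.pi / 2) with hx | hx
  · exact Or.inl (by linarith [le_two_mul_sin h0 hx])
  · have := le_two_mul_sin (x := Real.pi - x) (by linarith) (by linarith)
    rw [Real.sin_pi_sub] at this
    exact Or.inr (by linarith)

theorem half_le_cos {x : ℝ} (h : |x| ≤ 1) : 1 / 2 ≤ Real.cos x := by
  have h1 := Real.one_sub_sq_div_two_le_cos (x := x)
  have h2 := (sq_le_one_iff_abs_le_one x).2 h
  linarith

/-- From sin y - sin x = 2 sin((y - x)/2) cos((y + x)/2), where the cosine is at least 1/2. -/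
theorem sub_le_four_mul_sin_sub {x y : ℝ} (hx : 0 ≤ x) (hxy : x ≤ y) (hy : y ≤ 1) :
    y - x ≤ 4 * (Real.sin y - Real.sin x) := by
  have h1 := half_le_cos (x := (y + x) / 2) (by rw [abs_le]; constructor <;> linarith)
  have h2 := le_two_mul_sin (x := (y - x) / 2) (by linarith) (by linarith [Real.pi_gt_three])
  rw [Real.sin_sub_sin]
  nlinarith

namespace SecondConsts

variable {δ : ℝ} {f₂ : ℝ → ℝ} {m M ρ θ q : ℝ}

theorem sin_q_pos (H : SecondConsts δ f₂ m M ρ θ q) : 0 < Real.sin q :=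
  Real.sin_pos_of_pos_of_lt_pi H.q_pos H.q_lt

theorem abs_map_circRep_le (H : SecondConsts δ f₂ m M ρ θ q) (a : Circ) :
    |f₂ (circRep a)| ≤ 2 * Real.pi := by
  rw [H.map.abs_map, ← H.map.map_pi, abs_circRep]
  exact H.map.strictMono.monotone (norm_circ_le_pi a)

/-- Two preimages under the circle map, at points where the sine is almost equal, are close
to `0` and to `π`. -/
theorem exists_close_of_lt (H : SecondConsts δ f₂ m M ρ θ q) {c : ℝ} (hc : M * (4 * c) ≤ 1)
    {y y' : ℝ} (hy : y ∈ Ico (-Real.pi) Real.pi) (hy' : y' ∈ Ico (-Real.pi) Real.pi)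
    (hlt : y < y') (h : ((f₂ y : ℝ) : Circ) = ((f₂ y' : ℝ) : Circ))
    (hs : |Real.sin y - Real.sin y'| ≤ c) : ∃ σ τ : ℝ, |σ| ≤ 2 * c ∧ |τ| ≤ 2 * c ∧
      f₂ (Real.pi + σ) = f₂ τ + 2 * Real.pi ∧
      (((y : Circ) = (Real.pi + σ : ℝ) ∧ (y' : Circ) = (τ : ℝ)) ∨
        ((y' : Circ) = (Real.pi + σ : ℝ) ∧ (y : Circ) = (τ : ℝ))) := by
  have hm := H.map.strictMono
  have hπ := Real.pi_gt_three
  have e0 := H.map.map_zero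
  have eπ := H.map.map_pi
  have eπ' : f₂ (-Real.pi) = -(2 * Real.pi) := by rw [H.map.odd, eπ]
  have hM := H.one_le_M
  have b1 : -(2 * Real.pi) ≤ f₂ y := eπ' ▸ hm.monotone hy.1
  have b2 : f₂ y' < 2 * Real.pi := eπ ▸ hm hy'.2
  have b3 := hm hlt
  obtain ⟨k, hk⟩ := exists_int_of_coe_eq h.symm
  -- The values differ by a positive multiple of 2π that is less than 4π. This places y and y' on
  -- opposite sides of 0, so their sines have opposite signs and, being almost equal, are both at
  -- most c in modulus.
  have hk1 : k = 1 := by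
    have h1 : (0 : ℝ) < k := by
      by_contra! hle
      have := mul_nonpos_of_nonpos_of_nonneg hle Real.two_pi_pos.le
      linarith
    have h2 : (k : ℝ) < 2 := by
      by_contra! hle
      have := mul_le_mul_of_nonneg_right hle Real.two_pi_pos.le
      linarith
    have h1' : (0 : ℤ) < k := by exact_mod_cast h1
    have h2' : k < 2 := by exact_mod_cast h2
    omega
  rw [hk1, Int.cast_one, one_mul] at hk
  have hy0 : y ≤ 0 := hm.le_iff_le.1 (by rw [e0]; linarith)
  have hy'0 : 0 ≤ y' := hm.le_iff_le.1 (by rw [e0]; linarith)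
  have s1 := Real.sin_nonneg_of_nonneg_of_le_pi (x := -y) (by linarith) (by linarith [hy.1])
  have s2 := Real.sin_nonneg_of_nonneg_of_le_pi hy'0 hy'.2.le
  rw [Real.sin_neg] at s1
  rw [abs_le] at hs
  have c1 := le_or_le_of_sin_le (x := -y) (c := c) (by linarith) (by linarith [hy.1])
    (by rw [Real.sin_neg]; linarith)
  have c2 := le_or_le_of_sin_le (x := y') (c := c) hy'0 hy'.2.le (by linarith)
  -- Both points near 0, or both near ±π, would contradict the gap 2π between the values, by the
  -- Lipschitz bound M; the two mixed cases are the claim.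
  rcases c1 with c1 | c1 <;> rcases c2 with c2 | c2
  · have := H.abs_sub_le y' y
    rw [hk, abs_of_nonneg (by linarith : (0 : ℝ) ≤ f₂ y + 2 * Real.pi - f₂ y),
      abs_of_nonneg (by linarith)] at this
    nlinarith
  · refine ⟨y' - Real.pi, y, by rw [abs_le]; constructor <;> linarith [hy'.2],
      by rw [abs_le]; constructor <;> linarith, by rw [add_sub_cancel, hk],
      Or.inr ⟨by rw [add_sub_cancel], rfl⟩⟩
  · refine ⟨y + Real.pi, y', by rw [abs_le]; constructor <;> linarith [hy.1],
      by rw [abs_le]; constructor <;> linarith, ?_, Or.inl ⟨?_, rfl⟩⟩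
    · have := H.map.add_period y
      rw [show Real.pi + (y + Real.pi) = y + 2 * Real.pi by ring, this, hk]
      ring
    · have := coe_add_int_mul y 1
      rw [show Real.pi + (y + Real.pi) = y + (1 : ℤ) * (2 * Real.pi) by push_cast; ring, this]
  · have h1 := H.abs_sub_le Real.pi y'
    have h2 := H.abs_sub_le y (-Real.pi)
    rw [eπ, abs_of_nonneg (by linarith), abs_of_nonneg (by linarith [hy'.2])] at h1
    rw [eπ', abs_of_nonneg (by linarith), abs_of_nonneg (by linarith [hy.1])] at h2
    nlinarith

/-- The preimages of π are ±q, and inverse branches are Lipschitz with constant 1/m. -/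
theorem abs_sin_preimage_of_near_pi (H : SecondConsts δ f₂ m M ρ θ q) {a : Circ} {σ : ℝ}
    (hσ : |σ| ≤ 1) (h : inducedCircleMap f₂ a = ((Real.pi + σ : ℝ) : Circ)) :
    |(|Real.sin (circRep a)|) - Real.sin q| ≤ |σ| / m := by
  have hπ := Real.pi_gt_three
  have hb := abs_le.1 (H.abs_map_circRep_le a)
  have hσ' := abs_le.1 hσ
  obtain ⟨k, hk⟩ : ∃ k : ℤ, f₂ (circRep a) = Real.pi + σ + k * (2 * Real.pi) :=
    exists_int_of_coe_eq h
  have hS := abs_of_pos H.sin_q_pos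
  have hk' : k = 0 ∨ k = -1 := by
    have h1 : (-2 : ℝ) < k := by
      by_contra! hle
      have := mul_le_mul_of_nonneg_right hle Real.two_pi_pos.le
      linarith
    have h2 : (k : ℝ) < 1 := by
      by_contra! hle
      have := mul_le_mul_of_nonneg_right hle Real.two_pi_pos.le
      linarith
    have h1' : (-2 : ℤ) < k := by exact_mod_cast h1
    have h2' : k < 1 := by exact_mod_cast h2
    omega
  rcases hk' with rfl | rfl
  · have h1 := H.mul_abs_sub_le (circRep a) q
    rw [hk, H.map_q] at h1
    rw [le_div_iff₀ H.m_pos, mul_comm]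
    refine (mul_le_mul_of_nonneg_left ?_ H.m_pos.le).trans (h1.trans_eq (by congr 1; simp))
    nth_rw 1 [← hS]
    exact (abs_abs_sub_abs_le _ _).trans (Real.abs_sin_sub_sin_le _ _)
  · have h1 := H.mul_abs_sub_le (circRep a) (-q)
    rw [hk, H.map.odd, H.map_q] at h1
    rw [le_div_iff₀ H.m_pos, mul_comm]
    refine (mul_le_mul_of_nonneg_left ?_ H.m_pos.le).trans
      (h1.trans_eq (by congr 1; push_cast; ring))
    have e : |Real.sin (-q)| = Real.sin q := by rw [Real.sin_neg, abs_neg, hS]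
    nth_rw 1 [← e]
    exact (abs_abs_sub_abs_le _ _).trans (Real.abs_sin_sub_sin_le _ _)

/-- The preimages of 0 are 0 and π, zeros of the sine, and inverse branches are Lipschitz with
constant 1/m. -/
theorem abs_sin_preimage_of_near_zero (H : SecondConsts δ f₂ m M ρ θ q) {a : Circ} {τ : ℝ}
    (hτ : |τ| ≤ 1) (h : inducedCircleMap f₂ a = (τ : Circ)) :
    |Real.sin (circRep a)| ≤ |τ| / m := by
  have hπ := Real.pi_gt_three
  have hb := abs_le.1 (H.abs_map_circRep_le a)
  have hτ' := abs_le.1 hτ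
  obtain ⟨k, hk⟩ : ∃ k : ℤ, f₂ (circRep a) = τ + k * (2 * Real.pi) := exists_int_of_coe_eq h
  have hk' : k = 0 ∨ k = 1 ∨ k = -1 := by
    have h1 : (-2 : ℝ) < k := by
      by_contra! hle
      have := mul_le_mul_of_nonneg_right hle Real.two_pi_pos.le
      linarith
    have h2 : (k : ℝ) < 2 := by
      by_contra! hle
      have := mul_le_mul_of_nonneg_right hle Real.two_pi_pos.le
      linarith
    have h1' : (-2 : ℤ) < k := by exact_mod_cast h1
    have h2' : k < 2 := by exact_mod_cast h2
    omega
  have key : ∀ p : ℝ, Real.sin p = 0 → f₂ (circRep a) - f₂ p = τ →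
      |Real.sin (circRep a)| ≤ |τ| / m := by
    intro p hp hfp
    have h1 := H.mul_abs_sub_le (circRep a) p
    rw [hfp] at h1
    rw [le_div_iff₀ H.m_pos, mul_comm]
    refine (mul_le_mul_of_nonneg_left ?_ H.m_pos.le).trans h1
    have := Real.abs_sin_sub_sin_le (circRep a) p
    rwa [hp, sub_zero] at this
  rcases hk' with rfl | rfl | rfl
  · exact key 0 Real.sin_zero (by rw [hk, H.map.map_zero]; simp)
  · exact key Real.pi Real.sin_pi (by rw [hk, H.map.map_pi]; push_cast; ring)
  · exact key (-Real.pi) (by simp) (by rw [hk, H.map.odd, H.map.map_pi]; push_cast; ring)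

/-- The relation between the two preimages is symmetric. -/
theorem map_pi_add_abs (H : SecondConsts δ f₂ m M ρ θ q) {σ τ : ℝ}
    (h : f₂ (Real.pi + σ) = f₂ τ + 2 * Real.pi) :
    f₂ (Real.pi + |σ|) = f₂ |τ| + 2 * Real.pi ∧ (0 ≤ σ ↔ 0 ≤ τ) := by
  have hm := H.map.strictMono
  have e0 := H.map.map_zero
  have eπ := H.map.map_pi
  have hiff : 0 ≤ σ ↔ 0 ≤ τ := by
    rw [← hm.le_iff_le (a := 0) (b := τ), e0, ← le_add_iff_nonneg_right Real.pi,
      ← hm.le_iff_le (a := Real.pi), eπ, h]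
    constructor <;> intro <;> linarith
  refine ⟨?_, hiff⟩
  by_cases hσ : 0 ≤ σ
  · rw [abs_of_nonneg hσ, abs_of_nonneg (hiff.1 hσ), h]
  · have hτ : ¬ 0 ≤ τ := fun h => hσ (hiff.2 h)
    rw [abs_of_neg (not_le.1 hσ), abs_of_neg (not_le.1 hτ), H.map.odd]
    have e := H.map.add_period (-Real.pi - σ)
    rw [show -Real.pi - σ + 2 * Real.pi = Real.pi + -σ by ring,
      show -Real.pi - σ = -(Real.pi + σ) by ring, H.map.odd, h] at e
    rw [e]
    ring

theorem map_le_mul (H : SecondConsts δ f₂ m M ρ θ q) {r : ℝ} (h0 : 0 ≤ r) (hr : r ≤ ρ) :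
    f₂ r ≤ θ * r := by
  have h := H.abs_sub_le_of (c := θ) (x := r) (y := 0) fun t ht => H.contract t (by
    rw [uIcc_of_ge h0] at ht
    rw [abs_of_nonneg ht.1]
    exact ht.2.trans hr)
  rw [H.map.map_zero, sub_zero, sub_zero, abs_of_nonneg h0] at h
  exact (le_abs_self _).trans h

/-- Expansion at π against contraction at 0: (3/2)σ ≤ f₂(τ) ≤ θτ. -/
theorem le_of_map_pi_add (H : SecondConsts δ f₂ m M ρ θ q) {σ τ : ℝ} (hσ : 0 ≤ σ) (hσρ : σ ≤ ρ)
    (hτ : 0 ≤ τ) (hτρ : τ ≤ ρ) (h : f₂ (Real.pi + σ) = f₂ τ + 2 * Real.pi) : σ ≤ τ := by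
  have h1 := H.mul_sub_le (c := 3 / 2) (x := Real.pi) (y := Real.pi + σ) (by linarith)
    fun t ht => by
      refine H.expand t ?_
      have h2 := norm_sub_norm_le ((Real.pi : ℝ) : Circ) (t : Circ)
      rw [norm_eq_pi_iff.2 rfl, ← dist_eq_norm] at h2
      have h3 := dist_coe_le Real.pi t
      rw [abs_of_nonpos (by linarith [ht.1])] at h3
      linarith [ht.2, H.δ_lt]
  rw [h, H.map.map_pi] at h1
  have h2 := H.map_le_mul hτ hτρ
  nlinarith [H.θ_lt]

end SecondConsts

namespace Params

variable {δ s₀ η ε lam : ℝ} {f₁ f₂ φ : ℝ → ℝ} {m M ρ θ q : ℝ}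

/-- The preorbits `w` and `w'` separate at time `n`, where `w` is close to `t = π` and `w'` is
close to `t = 0`. -/
def IsBranch (_P : Params δ s₀ η ε lam f₁ f₂ φ m M ρ θ q) (w w' : ℕ → T2) (n : ℕ) (σ τ : ℝ) :
    Prop :=
  (∀ i ≤ n, w i = w' i) ∧ |σ| ≤ 8 * lam ∧ |τ| ≤ 8 * lam ∧
    (w (n + 1)).2 = ((Real.pi + σ : ℝ) : Circ) ∧ (w' (n + 1)).2 = (τ : Circ) ∧
    f₂ (Real.pi + σ) = f₂ τ + 2 * Real.pi

/-- At the first index where the preorbits differ, the images agree, so the t-coordinates differ.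
The equality of the s-coordinates of the images bounds the difference of the sines by 4λ, which
yields |σ|, |τ| ≤ 8λ. -/
theorem exists_isBranch (P : Params δ s₀ η ε lam f₁ f₂ φ m M ρ θ q) {w w' : ℕ → T2}
    (hw : IsPreorbit P.map.toFun w) (hw' : IsPreorbit P.map.toFun w')
    (hn : ∀ n, ‖(w n).1‖ ≤ 2 * ε) (hn' : ∀ n, ‖(w' n).1‖ ≤ 2 * ε) (h0 : w 0 = w' 0)
    (hne : w ≠ w') : ∃ n σ τ, P.IsBranch w w' n σ τ ∨ P.IsBranch w' w n σ τ := by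
  classical
  have hex : ∃ n, w n ≠ w' n := Function.ne_iff.1 hne
  obtain ⟨n, hn1⟩ : ∃ n, Nat.find hex = n + 1 :=
    Nat.exists_eq_succ_of_ne_zero fun h => Nat.find_spec hex (h ▸ h0)
  have hdiff : w (n + 1) ≠ w' (n + 1) := hn1 ▸ Nat.find_spec hex
  have heq : ∀ i ≤ n, w i = w' i := fun i hi =>
    not_not.1 (Nat.find_min hex (by omega))
  have hmap : P.map (w (n + 1)) = P.map (w' (n + 1)) := by rw [hw n, hw' n, heq n le_rfl]
  have hsnd : (w (n + 1)).2 ≠ (w' (n + 1)).2 := fun h => hdiff (P.eq_of_map_eq h hmap)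
  set y := circRep (w (n + 1)).2 with hy
  set y' := circRep (w' (n + 1)).2 with hy'
  have ey : (y : Circ) = (w (n + 1)).2 := coe_circRep _
  have ey' : (y' : Circ) = (w' (n + 1)).2 := coe_circRep _
  have hyne : y ≠ y' := fun h => hsnd (by rw [← ey, ← ey', h])
  have hf : ((f₂ y : ℝ) : Circ) = ((f₂ y' : ℝ) : Circ) := by
    rw [← P.H.circ_coe, ← P.H.circ_coe, ey, ey', ← P.map_snd, ← P.map_snd, hmap]
  have hx : |circRep (w (n + 1)).1| ≤ 2 * ε := by rw [abs_circRep]; exact hn _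
  have hx' : |circRep (w' (n + 1)).1| ≤ 2 * ε := by rw [abs_circRep]; exact hn' _
  have hs : |Real.sin y - Real.sin y'| ≤ 4 * lam := by
    have h1 := P.sin_relation (y := y) (y' := y') hx hx' (by
      rw [coe_circRep (w (n + 1)).1, coe_circRep (w' (n + 1)).1, ey, ey']; exact hmap)
    have h2 : ε * (Real.sin y - Real.sin y') =
        lam * (circRep (w' (n + 1)).1 - circRep (w (n + 1)).1) := by linarith
    have h3 : |circRep (w' (n + 1)).1 - circRep (w (n + 1)).1| ≤ 4 * ε :=
      (abs_sub _ _).trans (by linarith)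
    have h4 : ε * |Real.sin y - Real.sin y'| ≤ ε * (4 * lam) := by
      rw [← abs_of_pos P.ε_pos, ← abs_mul, abs_of_pos P.ε_pos, h2, abs_mul, abs_of_pos P.lam_pos]
      nlinarith [P.lam_pos]
    exact le_of_mul_le_mul_left h4 P.ε_pos
  have hc : M * (4 * (4 * lam)) ≤ 1 := by linarith [P.lam_mul_M]
  rcases lt_or_gt_of_ne hyne with hlt | hlt
  · obtain ⟨σ, τ, h1, h2, h3, h4⟩ := P.H.exists_close_of_lt hc (circRep_mem _) (circRep_mem _)
      hlt hf hs
    rw [ey, ey'] at h4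
    refine ⟨n, σ, τ, h4.imp (fun h => ⟨heq, ?_, ?_, h.1, h.2, h3⟩)
      fun h => ⟨fun i hi => (heq i hi).symm, ?_, ?_, h.1, h.2, h3⟩⟩ <;> linarith
  · obtain ⟨σ, τ, h1, h2, h3, h4⟩ := P.H.exists_close_of_lt hc (circRep_mem _) (circRep_mem _)
      hlt hf.symm (by rwa [abs_sub_comm])
    rw [ey, ey'] at h4
    refine ⟨n, σ, τ, h4.symm.imp (fun h => ⟨heq, ?_, ?_, h.1, h.2, h3⟩)
      fun h => ⟨fun i hi => (heq i hi).symm, ?_, ?_, h.1, h.2, h3⟩⟩ <;> linarith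

theorem eight_lam_le_one (P : Params δ s₀ η ε lam f₁ f₂ φ m M ρ θ q) : 8 * lam ≤ 1 :=
  P.lam_le_ρ.trans P.H.ρ_le

/-- At the branch the terms ε cos(π + σ) ≤ -ε/2 and ε cos τ ≥ ε/2 dominate λ times earlier slopes,
which is at most ε/3, so the slopes at index n have opposite signs. Equal slopes at index 0 would
propagate to index n through the common part, since λ ≠ 0. -/
theorem IsBranch.slope_ne {P : Params δ s₀ η ε lam f₁ f₂ φ m M ρ θ q} {w w' : ℕ → T2} {n : ℕ}
    {σ τ : ℝ} (h : P.IsBranch w w' n σ τ) :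
    (P.slope fun i => circRep (w i).2) ≠ P.slope fun i => circRep (w' i).2 := by
  obtain ⟨heq, hσ, hτ, h1, h2, -⟩ := h
  have hrec : ∀ (w : ℕ → T2) k, deriv f₂ (circRep (w (k + 1)).2) *
      (P.slope fun i => circRep (w (i + k)).2) =
      lam * (P.slope fun i => circRep (w (i + (k + 1))).2) +
        ε * Real.cos (circRep (w (k + 1)).2) := by
    intro w k
    have h := P.slope_succ fun n => circRep (w (n + k)).2
    simp only [show 1 + k = k + 1 from add_comm 1 k, add_right_comm _ 1 k] at h
    exact h
  have hsmall : ∀ T, |lam * P.slope T| ≤ ε / 3 := by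
    intro T
    rw [abs_mul, abs_of_pos P.lam_pos]
    have h3 := mul_le_mul_of_nonneg_left (P.abs_slope_le T) P.lam_pos.le
    refine h3.trans ?_
    have h4 : lam * (ε / m) ≤ ε / 4 := by
      rw [← mul_div_assoc, div_le_iff₀ P.H.m_pos]
      nlinarith [P.lam_le_m, P.ε_pos]
    linarith
  have hone := P.eight_lam_le_one
  have hc1 := half_le_cos (hσ.trans hone)
  have hc2 := half_le_cos (hτ.trans hone)
  have key : (P.slope fun i => circRep (w (i + n)).2) ≠
      P.slope fun i => circRep (w' (i + n)).2 := by
    have e1 := hrec w n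
    have e2 := hrec w' n
    rw [h1, cos_circRep_coe, add_comm Real.pi, Real.cos_add_pi] at e1
    rw [h2, cos_circRep_coe] at e2
    have d1 := P.H.map.deriv_pos (circRep ((σ + Real.pi : ℝ) : Circ))
    have d2 := P.H.map.deriv_pos (circRep (τ : Circ))
    have a1 := abs_le.1 (hsmall fun i => circRep (w (i + (n + 1))).2)
    have a2 := abs_le.1 (hsmall fun i => circRep (w' (i + (n + 1))).2)
    have hε := P.ε_pos
    have n1 : (P.slope fun i => circRep (w (i + n)).2) < 0 := by
      by_contra! hge
      have := mul_nonneg d1.le hge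
      rw [e1] at this
      nlinarith
    have n2 : 0 < P.slope fun i => circRep (w' (i + n)).2 := by
      by_contra! hle
      have := mul_nonpos_of_nonneg_of_nonpos d2.le hle
      rw [e2] at this
      nlinarith
    exact (n1.trans n2).ne
  intro h0
  refine key ?_
  have hk : ∀ k ≤ n, (P.slope fun i => circRep (w (i + k)).2) =
      P.slope fun i => circRep (w' (i + k)).2 := by
    intro k
    induction k with
    | zero => exact fun _ => h0
    | succ k ih =>
      intro hk
      have e1 := hrec w k
      have e2 := hrec w' k
      rw [ih (by omega), heq (k + 1) hk] at e1
      exact mul_left_cancel₀ P.lam_pos.ne' (by linarith)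
  exact hk n le_rfl

/-- Equality of the images reads ε(sin τ + sin σ) = λ(X - X'). One step further back, X is ε times a
sine close to ± sin q, whereas X' is ε times a sine close to 0. Since σ and τ have the same sign,
moduli can be taken. -/
theorem IsBranch.estimate {P : Params δ s₀ η ε lam f₁ f₂ φ m M ρ θ q} {w w' : ℕ → T2} {n : ℕ}
    {σ τ : ℝ} (h : P.IsBranch w w' n σ τ)
    (hw : IsPreorbit P.map.toFun w) (hw' : IsPreorbit P.map.toFun w')
    (hn : ∀ n, ‖(w n).1‖ ≤ 2 * ε) (hn' : ∀ n, ‖(w' n).1‖ ≤ 2 * ε) :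
    |Real.sin |τ| + Real.sin |σ| - lam * Real.sin q| ≤ 20 * lam ^ 2 / m := by
  obtain ⟨heq, hσ, hτ, h1, h2, h3⟩ := h
  have hε := P.ε_pos
  have hlam := P.lam_pos
  have hm := P.H.m_pos
  have hone := P.eight_lam_le_one
  have hπ := Real.pi_gt_three
  have hX : ∀ n, |circRep (w n).1| ≤ 2 * ε := fun n => by rw [abs_circRep]; exact hn n
  have hX' : ∀ n, |circRep (w' n).1| ≤ 2 * ε := fun n => by rw [abs_circRep]; exact hn' n
  set X := circRep (w (n + 1)).1
  set X' := circRep (w' (n + 1)).1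
  have e1 : lam * X + ε * Real.sin (Real.pi + σ) = lam * X' + ε * Real.sin τ := by
    refine P.sin_relation (hX _) (hX' _) ?_
    rw [coe_circRep, coe_circRep, ← h1, ← h2]
    exact (hw n).trans ((heq n le_rfl).trans (hw' n).symm)
  have hstep : ∀ {w : ℕ → T2}, IsPreorbit P.map.toFun w → (∀ n, |circRep (w n).1| ≤ 2 * ε) →
      ∀ n, circRep (w n).1 = lam * circRep (w (n + 1)).1 +
        ε * Real.sin (circRep (w (n + 1)).2) := by
    intro w hw hX n
    refine P.fst_eq (t := (w n).2) (hX n) (hX (n + 1)) ?_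
    rw [coe_circRep, coe_circRep, coe_circRep]
    exact hw n
  have g1 := P.H.abs_sin_preimage_of_near_pi (a := (w (n + 2)).2) (hσ.trans hone) (by
    rw [← P.map_snd, ← h1]; exact congrArg Prod.snd (hw (n + 1)))
  have g2 := P.H.abs_sin_preimage_of_near_zero (a := (w' (n + 2)).2) (hτ.trans hone) (by
    rw [← P.map_snd, ← h2]; exact congrArg Prod.snd (hw' (n + 1)))
  set Y := Real.sin (circRep (w (n + 2)).2)
  set Y' := Real.sin (circRep (w' (n + 2)).2)
  have eX : X = lam * circRep (w (n + 2)).1 + ε * Y := hstep hw hX (n + 1)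
  have eX' : X' = lam * circRep (w' (n + 2)).1 + ε * Y' := hstep hw' hX' (n + 1)
  set κ := lam / m with hκ
  have hκ1 : lam ≤ κ := by
    rw [hκ, le_div_iff₀ hm]
    nlinarith [P.H.m_le_one]
  have g1' : |(|Y|) - Real.sin q| ≤ 8 * κ := by
    refine g1.trans ?_
    rw [hκ, ← mul_div_assoc]
    gcongr
  have g2' : |Y'| ≤ 8 * κ := by
    refine g2.trans ?_
    rw [hκ, ← mul_div_assoc]
    gcongr
  -- The 20 collects 2 + 2 from the terms λs of the two earlier points, 8 from the sine close to 0
  -- and 8 from the sine close to ± sin q.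
  have hXX : |(|X - X'|) - ε * Real.sin q| ≤ ε * (20 * κ) := by
    have a1 : |(|X - X'|) - (|ε * Y|)| ≤ ε * (12 * κ) := by
      refine (abs_abs_sub_abs_le _ _).trans ?_
      rw [show X - X' - ε * Y = lam * circRep (w (n + 2)).1 - lam * circRep (w' (n + 2)).1
        - ε * Y' by rw [eX, eX']; ring]
      refine (abs_sub _ _).trans ((add_le_add_left (abs_sub _ _) _).trans ?_)
      rw [abs_mul, abs_mul, abs_mul, abs_of_pos hlam, abs_of_pos hε]
      have b1 := mul_le_mul hκ1 (hX (n + 2)) (abs_nonneg _) (hlam.le.trans hκ1)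
      have b2 := mul_le_mul hκ1 (hX' (n + 2)) (abs_nonneg _) (hlam.le.trans hκ1)
      have b3 := mul_le_mul_of_nonneg_left g2' hε.le
      linarith
    have a2 : |(|ε * Y|) - ε * Real.sin q| ≤ ε * (8 * κ) := by
      rw [abs_mul, abs_of_pos hε, ← mul_sub, abs_mul, abs_of_pos hε]
      exact mul_le_mul_of_nonneg_left g1' hε.le
    have a3 := abs_sub_le (|X - X'|) (|ε * Y|) (ε * Real.sin q)
    linarith
  have hsum : Real.sin |τ| + Real.sin |σ| = |Real.sin τ + Real.sin σ| := by
    have hsgn := (P.H.map_pi_add_abs h3).2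
    by_cases h0 : 0 ≤ σ
    · have h0' := hsgn.1 h0
      rw [abs_of_nonneg h0, abs_of_nonneg h0', abs_of_nonneg]
      rw [abs_of_nonneg h0] at hσ
      rw [abs_of_nonneg h0'] at hτ
      exact add_nonneg (Real.sin_nonneg_of_nonneg_of_le_pi h0' (by linarith))
        (Real.sin_nonneg_of_nonneg_of_le_pi h0 (by linarith))
    · have h0' : ¬ 0 ≤ τ := fun h => h0 (hsgn.2 h)
      rw [not_le] at h0 h0'
      rw [abs_of_neg h0] at hσ ⊢
      rw [abs_of_neg h0'] at hτ ⊢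
      have s1 := Real.sin_nonneg_of_nonneg_of_le_pi (x := -σ) (by linarith) (by linarith)
      have s2 := Real.sin_nonneg_of_nonneg_of_le_pi (x := -τ) (by linarith) (by linarith)
      rw [Real.sin_neg] at s1 s2 ⊢
      rw [Real.sin_neg, abs_of_nonpos (by linarith)]
      ring
  have e2 : ε * (Real.sin |τ| + Real.sin |σ|) = lam * |X - X'| := by
    rw [add_comm Real.pi, Real.sin_add_pi] at e1
    have e : ε * (Real.sin τ + Real.sin σ) = lam * (X - X') := by linarith
    have e' := congrArg abs e
    rwa [abs_mul, abs_mul, abs_of_pos hε, abs_of_pos hlam, ← hsum] at e'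
  have e3 : ε * |Real.sin |τ| + Real.sin |σ| - lam * Real.sin q| ≤ ε * (20 * lam ^ 2 / m) := by
    rw [← abs_of_pos hε, ← abs_mul, abs_of_pos hε, mul_sub, e2,
      show lam * |X - X'| - ε * (lam * Real.sin q) = lam * (|X - X'| - ε * Real.sin q) by ring,
      abs_mul, abs_of_pos hlam]
    refine (mul_le_mul_of_nonneg_left hXX hlam.le).trans_eq ?_
    rw [hκ]
    ring
  exact le_of_mul_le_mul_left e3 hε

/-- If z has t = 0, injectivity of `f₂` near 0 gives τ = 0 and then σ = 0. The estimate would become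
λ sin q ≤ 20λ²/m, contrary to the smallness of λ. -/
theorem not_isBranch_of_snd_eq_zero (P : Params δ s₀ η ε lam f₁ f₂ φ m M ρ θ q) {w w' : ℕ → T2}
    {n : ℕ} {σ τ : ℝ}
    (hw : IsPreorbit P.map.toFun w) (hw' : IsPreorbit P.map.toFun w')
    (hn : ∀ n, ‖(w n).1‖ ≤ 2 * ε) (hn' : ∀ n, ‖(w' n).1‖ ≤ 2 * ε) (h0 : (w' 0).2 = 0) :
    ¬ P.IsBranch w w' n σ τ := by
  intro h
  have hest := h.estimate hw hw' hn hn'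
  obtain ⟨-, hσ, hτ, h1, h2, h3⟩ := h
  have hone := P.eight_lam_le_one
  have hπ := Real.pi_gt_three
  have hnorm : ‖(τ : Circ)‖ = |τ| := norm_coe_of_abs_le (by linarith)
  have hmono := P.H.map.strictMono
  have hτ0 : |τ| = 0 := by
    have e := hw'.iterate 0 (n + 1)
    have e2 := congrArg (fun z : T2 => ‖z.2‖) e
    simp only [zero_add] at e2
    rw [P.iterate_snd, h2, h0, norm_zero, P.H.norm_circ_iterate, hnorm] at e2
    · refine (hmono.iterate (n + 1)).injective (e2.trans ?_)
      exact (Function.iterate_fixed P.H.map.map_zero _).symm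
    · rw [hnorm]
      linarith [P.lam_le_ρ, P.H.ρ_lt, P.H.ρ_pos]
  have hτ1 : τ = 0 := abs_eq_zero.1 hτ0
  have hσ0 : σ = 0 := by
    rw [hτ1, P.H.map.map_zero, zero_add, ← P.H.map.map_pi] at h3
    linarith [hmono.injective h3]
  rw [hτ1, hσ0, abs_zero, Real.sin_zero, add_zero, zero_sub, abs_neg,
    abs_of_pos (mul_pos P.lam_pos P.H.sin_q_pos), le_div_iff₀ P.H.m_pos] at hest
  have h4 := P.lam_small
  have hlam := P.lam_pos
  have hθ := P.H.θ_pos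
  have hmS := mul_pos P.H.m_pos P.H.sin_q_pos
  have h5 : m * Real.sin q ≤ 20 * lam := by
    refine le_of_mul_le_mul_left ?_ hlam
    linarith
  nlinarith

/-- Both branches satisfy the same estimate up to O(λ²), but the later passage near 0 is a
contracted image of the earlier one. The lost fraction 1 - θ of a quantity of order λ cannot be
absorbed by an error of order λ². -/
theorem IsBranch.not_isBranch {P : Params δ s₀ η ε lam f₁ f₂ φ m M ρ θ q} {w₁ w₂ w₃ : ℕ → T2}
    {a b : ℕ} {σ τ σ' τ' : ℝ} (h : P.IsBranch w₁ w₂ a σ τ)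
    (hw₁ : IsPreorbit P.map.toFun w₁) (hw₂ : IsPreorbit P.map.toFun w₂)
    (hw₃ : IsPreorbit P.map.toFun w₃)
    (hn₁ : ∀ n, ‖(w₁ n).1‖ ≤ 2 * ε) (hn₂ : ∀ n, ‖(w₂ n).1‖ ≤ 2 * ε)
    (hn₃ : ∀ n, ‖(w₃ n).1‖ ≤ 2 * ε) : ¬ P.IsBranch w₂ w₃ b σ' τ' := by
  intro h'
  have hest := h.estimate hw₁ hw₂ hn₁ hn₂
  have hest' := h'.estimate hw₂ hw₃ hn₂ hn₃
  obtain ⟨-, hσ, hτ, h1, h2, h3⟩ := h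
  obtain ⟨heq', hσ', hτ', h1', h2', h3'⟩ := h'
  have hone := P.eight_lam_le_one
  have hρ := P.lam_le_ρ
  have hρδ := P.H.ρ_lt
  have hρ0 := P.H.ρ_pos
  have hπ := Real.pi_gt_three
  have hnτ : ‖(τ : Circ)‖ = |τ| := norm_coe_of_abs_le (by linarith)
  have hnτ' : ‖(τ' : Circ)‖ = |τ'| := norm_coe_of_abs_le (by linarith)
  have hmono := P.H.map.strictMono
  -- `w₂` is near 0 at index a + 1 and near π at index b + 1. Orbits near 0 stay there in forward
  -- time, so the visit near π must lie deeper in the past.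
  have hab : a < b := by
    by_contra! hle
    obtain ⟨k, rfl⟩ := Nat.exists_eq_add_of_le hle
    have e := congrArg Prod.snd (hw₂.iterate (b + 1) k)
    rw [P.iterate_snd, add_right_comm, h2, h1'] at e
    have e2 := P.H.norm_circ_iterate_le (a := (τ : Circ)) (by rw [hnτ]; linarith) k
    rw [e, hnτ] at e2
    have e3 := norm_sub_norm_le ((Real.pi : ℝ) : Circ) ((Real.pi + σ' : ℝ) : Circ)
    have e4 := dist_coe_le Real.pi (Real.pi + σ')
    rw [norm_eq_pi_iff.2 rfl, ← dist_eq_norm] at e3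
    rw [sub_add_cancel_left, abs_neg] at e4
    linarith
  obtain ⟨k, rfl⟩ := Nat.exists_eq_add_of_lt hab
  -- `w₂` and `w₃` agree up to index b, so `w₃` runs from τ' to τ in k + 1 ≥ 1 steps near 0, the
  -- first of which contracts by θ.
  have hθτ : |τ| ≤ θ * |τ'| := by
    have e := congrArg (fun z : T2 => ‖z.2‖) (hw₃.iterate (a + 1) (k + 1))
    rw [← heq' (a + 1) (by omega), h2, P.iterate_snd,
      show a + 1 + (k + 1) = a + k + 1 + 1 by ring, h2', P.H.norm_circ_iterate
        (by rw [hnτ']; linarith), hnτ, hnτ', Function.iterate_succ_apply] at e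
    have b0 : 0 ≤ f₂ |τ'| := by
      rw [← P.H.map.map_zero]
      exact hmono.monotone (abs_nonneg _)
    have b1 := P.H.map_le_mul (abs_nonneg τ') (hτ'.trans hρ)
    have b2 : θ * |τ'| ≤ |τ'| := mul_le_of_le_one_left (abs_nonneg _) P.H.θ_lt.le
    rw [← e]
    exact (P.H.iterate_bounds b0 (by linarith) k).2.trans b1
  have hs := (P.H.map_pi_add_abs h3).1
  have hs' := (P.H.map_pi_add_abs h3').1
  have hle := P.H.le_of_map_pi_add (abs_nonneg _) (hσ'.trans hρ) (abs_nonneg _) (hτ'.trans hρ) hs'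
  have hττ : |τ| ≤ |τ'| := hθτ.trans (mul_le_of_le_one_left (abs_nonneg _) P.H.θ_lt.le)
  have hσσ : |σ| ≤ |σ'| := by
    have : Real.pi + |σ| ≤ Real.pi + |σ'| := by
      rw [← hmono.le_iff_le, hs, hs']
      linarith [hmono.monotone hττ]
    linarith
  have hsinσ : Real.sin |σ| ≤ Real.sin |σ'| :=
    Real.sin_le_sin_of_le_of_le_pi_div_two (by linarith [abs_nonneg σ]) (by linarith) hσσ
  have hsub := sub_le_four_mul_sin_sub (abs_nonneg τ) hττ (hτ'.trans hone)
  have hsin1 := Real.sin_le (abs_nonneg τ')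
  have hsin2 := Real.sin_le (abs_nonneg σ')
  set E := 20 * lam ^ 2 / m with hE
  rw [abs_le] at hest hest'
  -- The two sums differ by at most 2E and sin|σ| ≤ sin|σ'|, so sin|τ'| - sin|τ| ≤ 2E, and passing
  -- from sines to angles costs a factor 4. With the lower bound on |τ'| this gives (1 - θ) λ sin q
  -- ≤ 17E, excluded by the constant 1000 in `lam_small`.
  have k1 : (1 - θ) * |τ'| ≤ 8 * E := by linarith
  have k2 : lam * Real.sin q - E ≤ 2 * |τ'| := by linarith
  have hθ1 : 0 < 1 - θ := by linarith [P.H.θ_lt]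
  have k3 : (1 - θ) * (lam * Real.sin q - E) ≤ 16 * E := by
    have := mul_le_mul_of_nonneg_left k2 hθ1.le
    linarith
  have hEm : E * m = 20 * lam ^ 2 := by
    rw [hE, div_mul_cancel₀ _ P.H.m_pos.ne']
  have hE0 : 0 ≤ E := div_nonneg (by positivity) P.H.m_pos.le
  have k4 : (1 - θ) * (lam * Real.sin q) ≤ 17 * E := by nlinarith [P.H.θ_pos]
  have k5 := mul_le_mul_of_nonneg_right k4 P.H.m_pos.le
  rw [mul_assoc 17, hEm] at k5
  have k6 := mul_le_mul_of_nonneg_left P.lam_small P.lam_pos.le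
  nlinarith [P.lam_pos]

end Params

theorem span_slope_injective {u u' : ℝ}
    (h : Submodule.span ℝ {((u, 1) : ℝ × ℝ)} = Submodule.span ℝ {((u', 1) : ℝ × ℝ)}) : u = u' := by
  have h1 : ((u, 1) : ℝ × ℝ) ∈ Submodule.span ℝ {((u', 1) : ℝ × ℝ)} :=
    h ▸ Submodule.mem_span_singleton_self _
  obtain ⟨c, hc⟩ := Submodule.mem_span_singleton.1 h1
  simp only [Prod.smul_mk, smul_eq_mul, mul_one, Prod.mk.injEq] at hc
  rw [← hc.1, hc.2, one_mul]

theorem span_horizontal_ne_span_slope (u : ℝ) :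
    Submodule.span ℝ {((1, 0) : ℝ × ℝ)} ≠ Submodule.span ℝ {((u, 1) : ℝ × ℝ)} := by
  intro h
  have h1 : ((u, 1) : ℝ × ℝ) ∈ Submodule.span ℝ {((1, 0) : ℝ × ℝ)} :=
    h ▸ Submodule.mem_span_singleton_self _
  obtain ⟨c, hc⟩ := Submodule.mem_span_singleton.1 h1
  simp at hc

namespace Params

variable {δ s₀ η ε lam : ℝ} {f₁ f₂ φ : ℝ → ℝ} {m M ρ θ q : ℝ}

/-! ### Stable spaces -/

theorem sinkPt_mem_Om (P : Params δ s₀ η ε lam f₁ f₂ φ m M ρ θ q) : sinkPt ∈ P.map.Om := by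
  rw [P.Om_eq]
  exact Or.inl (Or.inl (Or.inl rfl))

theorem saddlePt_mem_Om (P : Params δ s₀ η ε lam f₁ f₂ φ m M ρ θ q) : saddlePt ∈ P.map.Om := by
  rw [P.Om_eq]
  exact Or.inl (Or.inl (Or.inr rfl))

/-- Small balls around the sink are forward invariant, hence contained in its local stable set,
whose tangent space is therefore the whole plane. -/
theorem isStableSpace_of_tendsto_sinkPt (P : Params δ s₀ η ε lam f₁ f₂ φ m M ρ θ q) {z : T2}
    (h : Tendsto (fun n => P.map.toFun^[n] z) atTop (𝓝 sinkPt)) : P.map.IsStableSpace z ⊤ := by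
  have hfix : ∀ n, P.map.toFun^[n] sinkPt = sinkPt := fun n =>
    Function.iterate_fixed P.map_sinkPt n
  have hd := tendsto_iff_dist_tendsto_zero.1 h
  refine ⟨⟨sinkPt, P.sinkPt_mem_Om, ?_⟩, fun x hx hxz => ?_⟩
  · simpa only [TorusEndo.IsFutureAsymptotic, hfix, dist_comm] using hd
  · obtain rfl : x = sinkPt := by
      refine eq_of_mem_nonwanderingSet_of_tendsto P.continuous_map hx (fun O hO => P.sinkPt_basis hO)
        (tendsto_iff_dist_tendsto_zero.2 ?_)
      have := hxz.add hd
      rw [add_zero] at this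
      exact squeeze_zero (fun _ => dist_nonneg) (fun _ => dist_triangle _ _ _) this
    refine ⟨min s₀ δ, lt_min P.s₀_pos P.H.δ_pos, fun r hr hr' => ?_⟩
    rw [lt_min_iff] at hr'
    have hsub : Metric.ball sinkPt r ⊆ P.map.localStable r sinkPt := by
      intro y hy n
      have hy' : dist y sinkPt < r := hy
      rw [hfix, dist_comm]
      exact lt_of_le_of_lt ((P.mapsTo_closedBall (hy'.trans hr'.1) (hy'.trans hr'.2).le).iterate n
        (Metric.mem_closedBall.2 le_rfl)) hy'
    filter_upwards [h.eventually (Metric.isOpen_ball.mem_nhds (Metric.mem_ball_self hr))] with k hk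
    rw [hfix]
    refine ⟨hsub hk, ?_⟩
    rw [tangentSpaceOf_of_mem_nhds (mem_of_superset (Metric.isOpen_ball.mem_nhds hk) hsub),
      Submodule.comap_top]

theorem not_tendsto_of_snd_mem_repeller (P : Params δ s₀ η ε lam f₁ f₂ φ m M ρ θ q) {x y : T2}
    (hx : x.2 = 0) (hy : y.2 ∈ repeller δ f₂) :
    ¬ Tendsto (fun n : ℕ => dist (P.map.toFun^[n] x) (P.map.toFun^[n] y)) atTop (𝓝 0) := by
  intro h
  obtain ⟨n, hn⟩ := (h.eventually (gt_mem_nhds P.H.δ_pos)).exists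
  have h1 : dist (P.map.toFun^[n] x).2 (P.map.toFun^[n] y).2 ≤
    dist (P.map.toFun^[n] x) (P.map.toFun^[n] y) := le_max_right _ _
  rw [P.iterate_snd, P.iterate_snd, hx, Function.iterate_fixed P.H.circ_zero, dist_zero_left] at h1
  exact (h1.trans_lt hn).not_ge (hy n)

theorem iterate_fst_eq_pi (P : Params δ s₀ η ε lam f₁ f₂ φ m M ρ θ q) {x : T2}
    (hx : x.1 = ((Real.pi : ℝ) : Circ)) (n : ℕ) :
    (P.map.toFun^[n] x).1 = ((Real.pi : ℝ) : Circ) := by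
  induction n with
  | zero => exact hx
  | succ n ih =>
    rw [Function.iterate_succ_apply']
    exact (P.map_fst_eq_pi_iff _).2 ih

theorem one_lt_dist_pi (P : Params δ s₀ η ε lam f₁ f₂ φ m M ρ θ q) {a : Circ}
    (ha : ‖a‖ ≤ 2 * ε) : 1 < dist ((Real.pi : ℝ) : Circ) a := by
  have h := norm_sub_norm_le ((Real.pi : ℝ) : Circ) a
  rw [norm_eq_pi_iff.2 rfl, ← dist_eq_norm] at h
  linarith [P.ε_lt, Real.pi_gt_three]

/-- A point off s = π eventually enters |s| ≤ 2ε, at distance more than 1 from π, so it cannot stay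
close to the saddle point. -/
theorem mem_localStable_saddlePt (P : Params δ s₀ η ε lam f₁ f₂ φ m M ρ θ q) {r : ℝ}
    (hr : r ≤ δ) (hr1 : r ≤ 1) {y : T2} :
    y ∈ P.map.localStable r saddlePt ↔ y.1 = ((Real.pi : ℝ) : Circ) ∧ ‖y.2‖ < r := by
  have hfix : ∀ n, P.map.toFun^[n] saddlePt = saddlePt := fun n =>
    Function.iterate_fixed P.map_saddlePt n
  constructor
  · intro h
    simp only [TorusEndo.localStable, mem_ofPred_eq, hfix] at h
    refine ⟨?_, ?_⟩
    · by_contra hne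
      obtain ⟨n, hn⟩ := P.exists_norm_iterate_lt hne
      have h1 := P.one_lt_dist_pi (P.norm_map_fst_le hn)
      have h2 := h (n + 1)
      rw [Function.iterate_succ_apply'] at h2
      have h3 : dist ((Real.pi : ℝ) : Circ) (P.map (P.map.toFun^[n] y)).1 ≤
        dist saddlePt (P.map (P.map.toFun^[n] y)) := le_max_left _ _
      linarith
    · have h3 : dist (0 : Circ) y.2 ≤ dist saddlePt y := le_max_right _ _
      rw [dist_zero_left] at h3
      exact h3.trans_lt (h 0)
  · rintro ⟨h1, h2⟩ n
    rw [hfix, Prod.dist_eq, P.iterate_fst_eq_pi h1, P.iterate_snd]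
    refine max_lt ?_ ?_
    · rw [show saddlePt.1 = ((Real.pi : ℝ) : Circ) from rfl, dist_self]
      exact (norm_nonneg _).trans_lt h2
    · rw [show saddlePt.2 = 0 from rfl, dist_zero_left]
      exact (P.H.norm_circ_iterate_le (h2.le.trans hr) n).trans_lt h2

theorem isStableSpace_saddlePt (P : Params δ s₀ η ε lam f₁ f₂ φ m M ρ θ q) :
    P.map.IsStableSpace saddlePt (Submodule.span ℝ {(0, 1)}) := by
  have hfix : ∀ n, P.map.toFun^[n] saddlePt = saddlePt := fun n =>
    Function.iterate_fixed P.map_saddlePt n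
  refine ⟨⟨saddlePt, P.saddlePt_mem_Om, ?_⟩, fun x hx hxz => ?_⟩
  · simpa only [TorusEndo.IsFutureAsymptotic, dist_self] using tendsto_const_nhds
  · obtain rfl : x = saddlePt := by
      rw [P.Om_eq] at hx
      have hxz' : Tendsto (fun n : ℕ => dist (P.map.toFun^[n] saddlePt) (P.map.toFun^[n] x))
          atTop (𝓝 0) := Tendsto.congr (fun n => dist_comm _ _) hxz
      rcases hx with ((hx | hx) | hx) | hx
      · obtain rfl : x = sinkPt := hx
        have h1 : ∀ n, P.map.toFun^[n] sinkPt = sinkPt := fun n =>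
          Function.iterate_fixed P.map_sinkPt n
        simp only [hfix, h1] at hxz'
        exact (dist_eq_zero.1 (tendsto_nhds_unique tendsto_const_nhds hxz')).symm
      · exact hx
      · exact absurd hxz' (P.not_tendsto_of_snd_mem_repeller rfl hx.2)
      · exact absurd hxz' (P.not_tendsto_of_snd_mem_repeller rfl (P.solenoid_subset hx).2)
    refine ⟨min δ 1, lt_min P.H.δ_pos one_pos, fun r hr hr' => Eventually.of_forall fun k => ?_⟩
    rw [lt_min_iff] at hr'
    have hmem := fun y => P.mem_localStable_saddlePt hr'.1.le hr'.2.le (y := y)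
    have ht : tangentSpaceOf (P.map.localStable r saddlePt) saddlePt =
        Submodule.span ℝ {(0, 1)} := by
      refine tangentSpaceOf_graph (Φ := fun _ => circRep saddlePt.1) (hasDerivAt_const _ _) rfl
        ?_ ?_
      · filter_upwards [(continuous_fst.tendsto (torusRep saddlePt)).eventually
          (eventually_eq_of_coe_eq (circRep saddlePt.1))] with y hy hyS
        refine hy ?_
        rw [coe_circRep]
        exact ((hmem _).1 hyS).1
      · have hlt : ‖((circRep saddlePt.2 : ℝ) : Circ)‖ < r := by
          rw [coe_circRep]
          simpa [saddlePt] using hr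
        filter_upwards [(continuous_coe_circ.norm.tendsto _).eventually_lt_const hlt] with t ht
        exact (hmem _).2 ⟨coe_circRep saddlePt.1, ht⟩
    rw [hfix, ht]
    refine ⟨(hmem _).2 ⟨rfl, by simpa [saddlePt] using hr⟩, ?_⟩
    ext v
    rw [Submodule.mem_comap, Submodule.mem_span_singleton, Submodule.mem_span_singleton]
    have e := P.diff_saddlePt k v
    have hf := (P.h₁.deriv_pos Real.pi).ne'
    constructor
    · rintro ⟨c, rfl⟩
      exact ⟨deriv f₂ 0 ^ k * c, by
        refine Eq.trans ?_ (P.diff_saddlePt k _).symm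
        simp⟩
    · rintro ⟨c, hc⟩
      replace hc := hc.trans e
      simp only [Prod.smul_mk, smul_eq_mul, mul_zero, Prod.mk.injEq] at hc
      refine ⟨v.2, Prod.ext ?_ (by simp)⟩
      simpa using ((mul_eq_zero.1 hc.1.symm).resolve_left (pow_ne_zero k hf)).symm

theorem norm_map_fst_lt (P : Params δ s₀ η ε lam f₁ f₂ φ m M ρ θ q) {z : T2}
    (hz : ‖z.1‖ ≤ 2 * ε) : ‖(P.map z).1‖ < 2 * ε := by
  obtain ⟨x, y, hx, hx', rfl, -⟩ := P.exists_lift hz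
  rw [P.map_proj_of_lt hx']
  refine (norm_coe_le_abs _).trans_lt ((abs_add_le _ _).trans_lt ?_)
  rw [abs_mul, abs_mul, abs_of_pos P.lam_pos, abs_of_pos P.ε_pos]
  have h1 := mul_le_mul_of_nonneg_left hx P.lam_pos.le
  have h2 := mul_le_of_le_one_right P.ε_pos.le (Real.abs_sin_le_one y)
  nlinarith [P.lam_le, P.ε_pos]

/-- Expansivity on the repeller forces points that stay close forever to share their t-coordinate,
and fibres of the annulus contract. Local stable sets are thus horizontal near the orbit of z. -/
theorem isStableSpace_of_mem_solenoid (P : Params δ s₀ η ε lam f₁ f₂ φ m M ρ θ q) {z : T2}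
    (hz : z ∈ P.solenoid) : P.map.IsStableSpace z (Submodule.span ℝ {(1, 0)}) := by
  have hzs := P.solenoid_subset hz
  refine ⟨⟨z, P.isBasicPiece_solenoid.subset hz, ?_⟩, fun x hx hxz => ?_⟩
  · simpa only [TorusEndo.IsFutureAsymptotic, dist_self] using tendsto_const_nhds
  · have hx2 : x.2 ∈ repeller δ f₂ := (P.snd_mem_of_mem_Om hx).resolve_left fun h =>
      P.not_tendsto_of_snd_mem_repeller h hzs.2 hxz
    have hx1 : x.1 ≠ ((Real.pi : ℝ) : Circ) := by
      intro h
      obtain ⟨n, hn⟩ := (hxz.eventually (gt_mem_nhds one_pos)).exists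
      have h1 : dist (P.map.toFun^[n] x).1 (P.map.toFun^[n] z).1 ≤
        dist (P.map.toFun^[n] x) (P.map.toFun^[n] z) := le_max_left _ _
      rw [P.iterate_fst_eq_pi h] at h1
      linarith [P.one_lt_dist_pi (P.norm_iterate_fst_le hzs.1 n)]
    have hxs := P.mem_solenoid_of_mem_Om hx hx1 hx2
    have hM := P.H.one_le_M
    refine ⟨min ρ (1 / M), lt_min P.H.ρ_pos (by positivity), fun r hr hr' => ?_⟩
    rw [lt_min_iff, lt_div_iff₀ (by positivity)] at hr'
    obtain ⟨N, hN⟩ := eventually_atTop.1 (hxz.eventually (gt_mem_nhds hr))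
    -- Taking k ≥ 1 makes |s| < 2ε strict at the k-th iterate of z, so that nearby points of its
    -- fibre also lie in the annulus.
    refine eventually_atTop.2 ⟨N + 1, fun k hk => ?_⟩
    have hsnd : ∀ y ∈ P.map.localStable r (P.map.toFun^[k] x), (P.map.toFun^[k] x).2 = y.2 := by
      intro y hy
      refine P.H.eq_of_forall_dist_le (a := (P.map.toFun^[k] x).2) (b := y.2) ?_ hr'.1.le
        (by linarith [Real.pi_gt_three]) fun n => ?_
      · rw [P.iterate_snd]
        exact SecondConsts.iterate_mem_repeller hx2 k
      · rw [← P.iterate_snd, ← P.iterate_snd]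
        exact (le_max_right _ _).trans (hy n).le
    have hmem : P.map.toFun^[k] z ∈ P.map.localStable r (P.map.toFun^[k] x) := fun n => by
      rw [← Function.iterate_add_apply, ← Function.iterate_add_apply]
      exact hN _ (by omega)
    have hxk := P.norm_iterate_fst_le (P.solenoid_subset hxs).1 k
    have hzk : ‖(P.map.toFun^[k] z).1‖ < 2 * ε := by
      obtain ⟨j, rfl⟩ := Nat.exists_eq_add_of_le' (show 1 ≤ k by omega)
      rw [Function.iterate_succ_apply']
      exact P.norm_map_fst_lt (P.norm_iterate_fst_le hzs.1 j)
    refine ⟨hmem, ?_⟩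
    have ht : tangentSpaceOf (P.map.localStable r (P.map.toFun^[k] x)) (P.map.toFun^[k] z) =
        Submodule.span ℝ {(1, 0)} := by
      refine tangentSpaceOf_horizontal ?_ ?_
      · filter_upwards [(continuous_snd.tendsto (torusRep (P.map.toFun^[k] z))).eventually
          (eventually_eq_of_coe_eq (circRep (P.map.toFun^[k] z).2))] with y hy hyS
        refine hy ?_
        rw [coe_circRep, ← hsnd _ hmem]
        exact (hsnd _ hyS).symm
      · set a := P.map.toFun^[k] z with ha
        have hlt : ‖((circRep a.1 : ℝ) : Circ)‖ < 2 * ε := by rwa [coe_circRep]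
        have hlt' : dist (P.map.toFun^[k] x) (torusProj (circRep a.1, circRep a.2)) < r := by
          have e : torusProj (circRep a.1, circRep a.2) = a := torusProj_torusRep a
          rw [e]
          exact hmem 0
        have hc : Continuous fun s : ℝ =>
            dist (P.map.toFun^[k] x) (torusProj (s, circRep a.2)) :=
          continuous_const.dist (continuous_torusProj.comp (continuous_id.prodMk continuous_const))
        filter_upwards [(continuous_coe_circ.norm.tendsto _).eventually_lt_const hlt,
          (hc.tendsto _).eventually_lt_const hlt'] with s hs hs' n
        refine (P.dist_iterate_le hxk (w := torusProj (s, circRep a.2)) hs.le ?_ n).trans_lt ?_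
        · rw [hsnd _ hmem]
          exact (coe_circRep _).symm
        · exact (mul_le_of_le_one_left dist_nonneg
            (pow_le_one₀ P.lam_pos.le P.lam_lt_one.le)).trans_lt hs'
    rw [ht, P.comap_diff_horizontal]

/-! ### The Strong Transversality Condition -/

open Classical in
/-- The unstable space along a preorbit in the unstable set of `Γ`. -/
noncomputable def unstableSpace (P : Params δ s₀ η ε lam f₁ f₂ φ m M ρ θ q) (w : ℕ → T2) :
    Submodule ℝ (ℝ × ℝ) :=
  if ∀ n, ‖(w n).1‖ ≤ 2 * ε then Submodule.span ℝ {(P.slope fun n => circRep (w n).2, 1)}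
  else Submodule.span ℝ {(1, 0)}

theorem unstableSpace_near (P : Params δ s₀ η ε lam f₁ f₂ φ m M ρ θ q) {w : ℕ → T2}
    (h : ∀ n, ‖(w n).1‖ ≤ 2 * ε) :
    P.unstableSpace w = Submodule.span ℝ {(P.slope fun n => circRep (w n).2, 1)} := if_pos h

theorem unstableSpace_far (P : Params δ s₀ η ε lam f₁ f₂ φ m M ρ θ q) {w : ℕ → T2}
    (h : ¬ ∀ n, ‖(w n).1‖ ≤ 2 * ε) : P.unstableSpace w = Submodule.span ℝ {(1, 0)} := if_neg h

theorem isUnstableSpace_unstableSpace (P : Params δ s₀ η ε lam f₁ f₂ φ m M ρ θ q) {w : ℕ → T2}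
    (hw : IsPreorbit P.map.toFun w) : P.map.IsUnstableSpace w (P.unstableSpace w) := by
  by_cases h : ∀ n, ‖(w n).1‖ ≤ 2 * ε
  · rw [P.unstableSpace_near h]
    exact P.isUnstableSpace_slope hw h
  · rw [P.unstableSpace_far h]
    push Not at h
    exact P.isUnstableSpace_horizontal hw h

theorem exists_unstableSpace_eq (P : Params δ s₀ η ε lam f₁ f₂ φ m M ρ θ q) (w : ℕ → T2) :
    ∃ v ≠ 0, P.unstableSpace w = Submodule.span ℝ {v} := by
  by_cases h : ∀ n, ‖(w n).1‖ ≤ 2 * ε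
  · exact ⟨_, by simp, P.unstableSpace_near h⟩
  · exact ⟨_, by simp, P.unstableSpace_far h⟩

theorem snd_eq_zero_of_far (P : Params δ s₀ η ε lam f₁ f₂ φ m M ρ θ q) {z : T2}
    (w : P.map.UnstablePreorbit z) (h : ¬ ∀ n, ‖(w.1 n).1‖ ≤ 2 * ε) (n : ℕ) : (w.1 n).2 = 0 := by
  obtain ⟨x, hx⟩ := w.2.2.2
  rcases P.pastAsymptotic_cases hx with hxs | hxs
  · exact P.snd_eq_zero_of_tendsto w.2.2.1 (by simpa only [hxs] using hx.2.2) n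
  · exact absurd (P.norm_fst_le_of_tendsto w.2.2.1 hxs hx.2.2) h

theorem eq_of_far (P : Params δ s₀ η ε lam f₁ f₂ φ m M ρ θ q) {z : T2}
    {w w' : P.map.UnstablePreorbit z} (h : ¬ ∀ n, ‖(w.1 n).1‖ ≤ 2 * ε)
    (h' : ¬ ∀ n, ‖(w'.1 n).1‖ ≤ 2 * ε) : w = w' := by
  have h2 := P.snd_eq_zero_of_far w h
  have h2' := P.snd_eq_zero_of_far w' h'
  refine Subtype.ext (funext fun n => ?_)
  induction n with
  | zero => rw [w.2.1, w'.2.1]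
  | succ n ih =>
    exact P.eq_of_map_eq ((h2 _).trans (h2' _).symm) ((w.2.2.1 n).trans (ih.trans (w'.2.2.1 n).symm))

theorem exists_isBranch_of_ne (P : Params δ s₀ η ε lam f₁ f₂ φ m M ρ θ q) {z : T2}
    {w w' : P.map.UnstablePreorbit z} (h : ∀ n, ‖(w.1 n).1‖ ≤ 2 * ε)
    (h' : ∀ n, ‖(w'.1 n).1‖ ≤ 2 * ε) (hne : w ≠ w') :
    (∃ n σ τ, P.IsBranch w.1 w'.1 n σ τ) ∨ ∃ n σ τ, P.IsBranch w'.1 w.1 n σ τ := by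
  obtain ⟨n, σ, τ, hb | hb⟩ := P.exists_isBranch w.2.2.1 w'.2.2.1 h h' (w.2.1.trans w'.2.1.symm)
    fun he => hne (Subtype.ext he)
  · exact Or.inl ⟨n, σ, τ, hb⟩
  · exact Or.inr ⟨n, σ, τ, hb⟩

theorem eq_of_near_of_snd_eq_zero (P : Params δ s₀ η ε lam f₁ f₂ φ m M ρ θ q) {z : T2}
    (hz : z.2 = 0) {w w' : P.map.UnstablePreorbit z} (h : ∀ n, ‖(w.1 n).1‖ ≤ 2 * ε)
    (h' : ∀ n, ‖(w'.1 n).1‖ ≤ 2 * ε) : w = w' := by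
  by_contra hne
  rcases P.exists_isBranch_of_ne h h' hne with ⟨n, σ, τ, hb⟩ | ⟨n, σ, τ, hb⟩
  · exact P.not_isBranch_of_snd_eq_zero w.2.2.1 w'.2.2.1 h h' (by rw [w'.2.1, hz]) hb
  · exact P.not_isBranch_of_snd_eq_zero w'.2.2.1 w.2.2.1 h' h (by rw [w.2.1, hz]) hb

theorem unstableSpace_ne (P : Params δ s₀ η ε lam f₁ f₂ φ m M ρ θ q) {z : T2}
    {w w' : P.map.UnstablePreorbit z} (hne : w ≠ w') :
    P.unstableSpace w.1 ≠ P.unstableSpace w'.1 := by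
  by_cases h : ∀ n, ‖(w.1 n).1‖ ≤ 2 * ε <;> by_cases h' : ∀ n, ‖(w'.1 n).1‖ ≤ 2 * ε
  · rw [P.unstableSpace_near h, P.unstableSpace_near h']
    intro he
    have he' := span_slope_injective he
    rcases P.exists_isBranch_of_ne h h' hne with ⟨n, σ, τ, hb⟩ | ⟨n, σ, τ, hb⟩
    · exact hb.slope_ne he'
    · exact hb.slope_ne he'.symm
  · rw [P.unstableSpace_near h, P.unstableSpace_far h']
    exact (span_horizontal_ne_span_slope _).symm
  · rw [P.unstableSpace_far h, P.unstableSpace_near h']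
    exact span_horizontal_ne_span_slope _
  · exact absurd (P.eq_of_far h h') hne

/-- There are at most two preorbits of a point in the unstable set of `Γ`. -/
theorem not_three_unstablePreorbits (P : Params δ s₀ η ε lam f₁ f₂ φ m M ρ θ q) {z : T2}
    (w₁ w₂ w₃ : P.map.UnstablePreorbit z) (h12 : w₁ ≠ w₂) (h13 : w₁ ≠ w₃) (h23 : w₂ ≠ w₃) :
    False := by
  by_cases hfar : ∃ w : P.map.UnstablePreorbit z, ¬ ∀ n, ‖(w.1 n).1‖ ≤ 2 * ε
  · obtain ⟨w, hw⟩ := hfar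
    have hz : z.2 = 0 := by
      rw [← w.2.1]
      exact P.snd_eq_zero_of_far w hw 0
    by_cases h1 : ∀ n, ‖(w₁.1 n).1‖ ≤ 2 * ε <;> by_cases h2 : ∀ n, ‖(w₂.1 n).1‖ ≤ 2 * ε <;>
      by_cases h3 : ∀ n, ‖(w₃.1 n).1‖ ≤ 2 * ε
    · exact h12 (P.eq_of_near_of_snd_eq_zero hz h1 h2)
    · exact h12 (P.eq_of_near_of_snd_eq_zero hz h1 h2)
    · exact h13 (P.eq_of_near_of_snd_eq_zero hz h1 h3)
    · exact h23 (P.eq_of_far h2 h3)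
    · exact h23 (P.eq_of_near_of_snd_eq_zero hz h2 h3)
    · exact h13 (P.eq_of_far h1 h3)
    · exact h12 (P.eq_of_far h1 h2)
    · exact h12 (P.eq_of_far h1 h2)
  -- Branching orients each pair of preorbits, and any orientation of a triangle contains a directed
  -- path of length two; such a path has just been excluded.
  · push Not at hfar
    have key : ∀ a b c : P.map.UnstablePreorbit z, (∃ n σ τ, P.IsBranch a.1 b.1 n σ τ) →
        (∃ n σ τ, P.IsBranch b.1 c.1 n σ τ) → False := by
      rintro a b c ⟨n, σ, τ, hab⟩ ⟨k, σ', τ', hbc⟩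
      exact hab.not_isBranch a.2.2.1 b.2.2.1 c.2.2.1 (hfar a) (hfar b) (hfar c) hbc
    rcases P.exists_isBranch_of_ne (hfar w₁) (hfar w₂) h12 with a | a <;>
      rcases P.exists_isBranch_of_ne (hfar w₂) (hfar w₃) h23 with b | b
    · exact key _ _ _ a b
    · rcases P.exists_isBranch_of_ne (hfar w₁) (hfar w₃) h13 with c | c
      · exact key _ _ _ c b
      · exact key _ _ _ c a
    · rcases P.exists_isBranch_of_ne (hfar w₁) (hfar w₃) h13 with c | c
      · exact key _ _ _ a c
      · exact key _ _ _ b c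
    · exact key _ _ _ b a

/-- If s = π, then z is the saddle point. Over the repeller all preorbits stay in the strip, where
injectivity makes them unique and puts z into Γ₀. All other points are in the basin of the sink,
where the stable space is everything. -/
theorem exists_isStableSpace_transverse (P : Params δ s₀ η ε lam f₁ f₂ φ m M ρ θ q) {z : T2}
    (w : P.map.UnstablePreorbit z) : ∃ Es, P.map.IsStableSpace z Es ∧
      Es ⊔ ⨅ w : P.map.UnstablePreorbit z, P.unstableSpace w.1 = ⊤ := by
  have hle : ∀ {E F : Submodule ℝ (ℝ × ℝ)}, IsCompl E F →
      (∀ w : P.map.UnstablePreorbit z, P.unstableSpace w.1 = F) →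
      E ⊔ ⨅ w : P.map.UnstablePreorbit z, P.unstableSpace w.1 = ⊤ := by
    intro E F hEF hF
    exact eq_top_iff.2 (hEF.sup_eq_top.ge.trans
      (sup_le_sup_left (le_iInf fun w => (hF w).ge) _))
  by_cases h1 : z.1 = ((Real.pi : ℝ) : Circ)
  · have hfar : ∀ w : P.map.UnstablePreorbit z, ¬ ∀ n, ‖(w.1 n).1‖ ≤ 2 * ε := fun w h =>
      P.fst_ne_pi_of_norm_le (h 0) (by rw [w.2.1, h1])
    obtain rfl : z = saddlePt := Prod.ext h1 (by
      rw [← w.2.1]; exact P.snd_eq_zero_of_far w (hfar w) 0)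
    exact ⟨_, P.isStableSpace_saddlePt, hle (isCompl_horizontal_span 0).symm
      fun w => P.unstableSpace_far (hfar w)⟩
  by_cases h2 : z.2 ∈ repeller δ f₂
  · have hnear : ∀ w : P.map.UnstablePreorbit z, ∀ n, ‖(w.1 n).1‖ ≤ 2 * ε := fun w => by
      by_contra h
      have h0 := P.snd_eq_zero_of_far w h 0
      rw [w.2.1] at h0
      exact P.H.zero_notMem_repeller (h0 ▸ h2)
    have hstrip : ∀ (w : P.map.UnstablePreorbit z) n, w.1 n ∈ strip δ ε f₂ := fun w n => by
      refine ⟨hnear w n, P.H.mem_repeller_of_iterate_mem n ?_⟩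
      have e := w.2.2.1.iterate 0 n
      rw [zero_add] at e
      rwa [← P.iterate_snd, e, w.2.1]
    have huniq : ∀ w' : P.map.UnstablePreorbit z, w' = w := fun w' => by
      refine Subtype.ext (funext fun n => ?_)
      induction n with
      | zero => rw [w.2.1, w'.2.1]
      | succ n ih =>
        exact P.injOn_strip (hstrip _ _) (hstrip _ _)
          ((w'.2.2.1 n).trans (ih.trans (w.2.2.1 n).symm))
    have hz : z ∈ P.solenoid := w.2.1 ▸ P.mem_solenoid_of_preorbit w.2.2.1 (hstrip w)
    exact ⟨_, P.isStableSpace_of_mem_solenoid hz, hle (isCompl_horizontal_span _)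
      fun w' => by rw [huniq w', P.unstableSpace_near (hnear w)]⟩
  · exact ⟨⊤, P.isStableSpace_of_tendsto_sinkPt (P.tendsto_sinkPt h1 h2), top_sup_eq _⟩

theorem strongTransversality (P : Params δ s₀ η ε lam f₁ f₂ φ m M ρ θ q) :
    P.map.StrongTransversality := fun _ =>
  ⟨fun w => P.unstableSpace w.1, fun w => P.isUnstableSpace_unstableSpace w.2.2.1,
    generalPosition_of_lines (fun w => P.exists_unstableSpace_eq w.1)
      (fun _ _ hne => P.unstableSpace_ne hne) P.not_three_unstablePreorbits,
    fun ⟨w⟩ => P.exists_isStableSpace_transverse w⟩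

end Params

/-! ### Choice of the parameters and conclusion -/

theorem SecondConsts.exists_lam {δ : ℝ} {f₂ : ℝ → ℝ} {m M ρ θ q : ℝ}
    (H : SecondConsts δ f₂ m M ρ θ q) {s₀ ε : ℝ} (hε : 0 < ε) :
    ∃ lam₀ > 0, ∀ lam : ℝ, 0 < lam → lam < lam₀ → 4 * lam ≤ 1 ∧ lam * s₀ ≤ ε ∧ 4 * lam ≤ m ∧
      (∀ t ∈ Icc δ (Real.pi - δ / 3), 2 * lam < Real.sin t) ∧ 8 * lam ≤ ρ ∧ M * (16 * lam) ≤ 1 ∧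
      1000 * lam ≤ (1 - θ) * m * Real.sin q := by
  have hδ := H.δ_pos
  have hm := H.m_pos
  have hM := H.one_le_M
  have hρ := H.ρ_pos
  obtain ⟨c, hc, hmin⟩ : ∃ c > 0, ∀ t ∈ Icc δ (Real.pi - δ / 3), c ≤ Real.sin t := by
    obtain ⟨a, ha, hmin⟩ := isCompact_Icc.exists_isMinOn
      (nonempty_Icc.2 (H.map.lt_pi_sub hδ H.δ_lt).le) Real.continuous_sin.continuousOn
    exact ⟨_, Real.sin_pos_of_pos_of_lt_pi (by linarith [ha.1]) (by linarith [ha.2]),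
      fun t ht => hmin ht⟩
  have hS : 0 < (1 - θ) * m * Real.sin q :=
    mul_pos (mul_pos (by linarith [H.θ_lt]) hm) H.sin_q_pos
  have hev : ∀ (a : ℝ) {b : ℝ}, 0 < b → ∀ᶠ lam in 𝓝[>] (0 : ℝ), a * lam < b := fun a b hb => by
    have h : Tendsto (fun lam : ℝ => a * lam) (𝓝[>] 0) (𝓝 (a * 0)) :=
      ((continuous_const.mul continuous_id).tendsto _).mono_left nhdsWithin_le_nhds
    rw [mul_zero] at h
    exact h.eventually_lt_const hb
  have hall := (hev 4 one_pos).and ((hev s₀ hε).and ((hev 4 hm).and ((hev 2 hc).and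
    ((hev 8 hρ).and ((hev (M * 16) one_pos).and (hev 1000 hS))))))
  obtain ⟨lam₀, h0, hsub⟩ := mem_nhdsGT_iff_exists_Ioo_subset.1 hall
  refine ⟨lam₀, h0, fun lam hl hl' => ?_⟩
  obtain ⟨h1, h2, h3, h4, h5, h6, h7⟩ := hsub ⟨hl, hl'⟩
  refine ⟨h1.le, by linarith, h3.le, fun t ht => h4.trans_le (hmin t ht), h5.le, by linarith, h7.le⟩

theorem proposition4p1
    (δ s₀ η : ℝ) (hδ : 0 < δ) (hδπ : δ < Real.pi) (hs₀ : 0 < s₀) (hη : 0 < η)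
    (f₂ : ℝ → ℝ) (h₂ : IsSecondMap δ f₂) :
    ∃ ε₀ > 0, ∀ ε : ℝ, 0 < ε → ε < ε₀ → ∃ lam₀ > 0, ∀ lam : ℝ, 0 < lam → lam < lam₀ →
      ∀ (f₁ φ : ℝ → ℝ) (h₁ : IsFirstMap s₀ η lam f₁) (hφ : IsBump s₀ ε φ),
      (∀ s, |deriv φ s| < |deriv f₁ s|) →
      ∀ (f : TorusEndo) (K₁ : Set Circ) (p C : T2) (K : Set T2),
      f = przytyckiMap h₁ h₂ hφ →
      K₁ = nonwanderingSet (inducedCircleMap f₂) \ {0} →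
      p = ((0 : Circ), (0 : Circ)) →
      C = (((Real.pi : ℝ) : Circ), (0 : Circ)) →
      K = {((Real.pi : ℝ) : Circ)} ×ˢ K₁ →
      -- `f` is a two-fold covering without critical points
      IsCoveringMap f ∧ (∀ z, (f ⁻¹' {z}).ncard = 2) ∧ (∀ z, ¬ f.IsCritical z) ∧
      -- Axiom A
      f.AxiomA ∧
      -- the nonwandering set and its basic pieces
      (∃ Γ₀ : Set T2,
        f.Om = {p} ∪ {C} ∪ K ∪ Γ₀ ∧
        [{p}, {C}, K, Γ₀].Pairwise Disjoint ∧
        (∀ L ∈ [{p}, {C}, K, Γ₀], IsBasicPiece f L) ∧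
        (f p = p ∧ IsAttractingSet f {p}) ∧
        (f C = C ∧ f.IsSaddleSet {C}) ∧
        (f.IsExpandingOn K ∧ Nonempty (K ≃ₜ (ℕ → Bool))) ∧
        (f.IsSaddleSet Γ₀ ∧ InjOn f Γ₀ ∧
          ∀ z ∈ Γ₀, z.2 ∈ K₁ ∧ ∃ s : ℝ, |s| ≤ 2 * ε ∧ z.1 = (s : Circ))) ∧
      -- the Strong Transversality Condition
      f.StrongTransversality ∧
      -- `f` is neither invertible nor expanding
      ¬ Function.Injective f ∧ ¬ f.IsExpandingOn univ := by
  obtain ⟨m, M, ρ, θ, q, H⟩ := h₂.exists_consts hδ hδπ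
  -- Exactly the bounds 2ε < 1, 2ε < s₀ and 2ε ≤ η required by `Params`; all remaining smallness is
  -- imposed on λ.
  refine ⟨min (1 / 2) (min (s₀ / 2) (η / 2)), by positivity, fun ε hε hε₀ => ?_⟩
  rw [lt_min_iff, lt_min_iff] at hε₀
  obtain ⟨lam₀, hlam₀, hlam⟩ := H.exists_lam (s₀ := s₀) hε
  refine ⟨lam₀, hlam₀, fun lam hl hl' f₁ φ h₁ hφ hderiv f K₁ p C K hf hK₁ hp hC hK => ?_⟩
  obtain ⟨a1, a2, a3, a4, a5, a6, a7⟩ := hlam lam hl hl'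
  have P : Params δ s₀ η ε lam f₁ f₂ φ m M ρ θ q :=
    ⟨H, h₁, hφ, hderiv, hs₀, hη, hε, by linarith, by linarith, by linarith, hl, a1, a2, a3, a4, a5,
      a6, a7⟩
  rw [H.nonwanderingSet_circ] at hK₁
  obtain rfl : f = P.map := hf
  obtain rfl : p = sinkPt := hp
  obtain rfl : C = saddlePt := hC
  subst hK₁
  obtain rfl : K = expandingPiece δ f₂ := hK
  obtain ⟨e, -⟩ := H.exists_coding
  refine ⟨P.isCoveringMap, P.ncard_preimage, P.not_isCritical, P.axiomA, ⟨P.solenoid, P.Om_eq,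
    P.pairwise_disjoint, ?_, ⟨P.map_sinkPt, P.isAttractingSet_sinkPt⟩,
    ⟨P.map_saddlePt, P.isSaddleSet_saddlePt⟩, ⟨P.isExpandingOn_expandingPiece, ⟨?_⟩⟩,
    P.isSaddleSet_solenoid, P.injOn_strip.mono P.solenoid_subset, fun z hz => ?_⟩,
    P.strongTransversality, P.not_injective, P.not_isExpandingOn_univ⟩
  · simp only [List.mem_cons, List.not_mem_nil, or_false, forall_eq_or_imp, forall_eq]
    exact ⟨P.isBasicPiece_sinkPt, P.isBasicPiece_saddlePt, P.isBasicPiece_expandingPiece,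
      P.isBasicPiece_solenoid⟩
  · exact (Homeomorph.Set.prod _ _).trans ((Homeomorph.uniqueProd _ _).trans e)
  · obtain ⟨s, hs, hs'⟩ := exists_coe_eq_abs z.1
    exact ⟨(P.solenoid_subset hz).2, s, hs' ▸ (P.solenoid_subset hz).1, hs.symm⟩
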